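/- Let $n,k\ge 1$ and let $\mathbb P^n$ be projective space over $\mathbb C$. A Steiner bundle $S\in\mathcal S_{n,k}$ is a vector bundle of rank $n$ on $\mathbb P^n$ whose dual $S^*$ fits into an exact sequence $$0\to S^*\to \mathcal O^{\,n+k}\to \mathcal O(1)^{k}\to 0 .$$ A hyperplane $H\subset\mathbb P^n$ is an unstable hyperplane of $S$ if $h^0(H,S^*|_H)\ne 0$; let $W(S)$ be the set of unstable hyperplanes of $S$. A finite set $\mathcal H$ of hyperplanes has normal crossing if at every point of $\mathbb P^n$ the equations of the members of $\mathcal H$ through that point are linearly independent; for such $\mathcal H$, let $\Omega(\log\mathcal H)$ be the bundle of meromorphic $1$-forms on $\mathbb P^n$ having at most logarithmic poles on the union of the members of $\mathcal H$. The bundle $S$ is called logarithmic if $S\cong\Omega(\log\mathcal H)$ for some finite set $\mathcal H$ of hyperplanes with normal crossing. Let $S\in\mathcal S_{n,k}$. (1) $S$ is logarithmic if and only if $W(S)$ contains at least $n+k+1$ hyperplanes. (2) Let $\mathcal H\subset W(S)$ be a subset consisting of exactly $n+k+1$ hyperplanes; if $k=1$, assume in addition that $\mathcal H$ has normal crossing.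 Then $\mathcal H$ has normal crossing and $S\cong\Omega(\log\mathcal H)$. -/

import Mathlib

open AlgebraicGeometry CategoryTheory Limits TopologicalSpace Opposite

noncomputable section
namespace SteinerLog

section Dual

variable {X : Scheme.{0}} (E : X.Modules)

/-- The sections over `U` of the sheaf of homomorphisms from `E` to the structure sheaf: families of
`𝒪(V)`-linear maps `E(V) → 𝒪(V)`, for `V ⊆ U` open, compatible with restriction. -/
def dualSections (U : X.Opens) :
    AddSubgroup (∀ V : {V : X.Opens // V ≤ U}, Γ(E, V.1) →ₗ[Γ(X, V.1)] Γ(X, V.1)) where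
  carrier := {φ | ∀ (V W : {V : X.Opens // V ≤ U}) (h : W.1 ≤ V.1) (s : Γ(E, V.1)),
    φ W (E.presheaf.map (homOfLE h).op s) = X.presheaf.map (homOfLE h).op (φ V s)}
  zero_mem' V W h s := by simp
  add_mem' {φ ψ} hφ hψ V W h s := by simp [hφ V W h s, hψ V W h s]
  neg_mem' {φ} hφ V W h s := by simp [hφ V W h s]

variable {E} in
def dualSections.smul {U : X.Opens} (r : Γ(X, U)) (φ : dualSections E U) : dualSections E U :=
  ⟨fun V => X.presheaf.map (homOfLE V.2).op r • φ.1 V, fun V W h s => by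
    have h1 := φ.2 V W h s
    simp only [LinearMap.smul_apply, smul_eq_mul, map_mul]
    rw [h1, ← CommRingCat.comp_apply, ← Functor.map_comp]
    rfl⟩

instance dualSections.module (U : X.Opens) : Module Γ(X, U) (dualSections E U) where
  smul := dualSections.smul
  one_smul φ := Subtype.ext <| funext fun V => by
    change X.presheaf.map (homOfLE V.2).op 1 • φ.1 V = φ.1 V
    simp
  mul_smul r r' φ := Subtype.ext <| funext fun V => by
    change X.presheaf.map (homOfLE V.2).op (r * r') • φ.1 V =
      X.presheaf.map (homOfLE V.2).op r • X.presheaf.map (homOfLE V.2).op r' • φ.1 V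
    simp [mul_smul]
  smul_zero r := Subtype.ext <| funext fun V => by
    change X.presheaf.map (homOfLE V.2).op r • (0 : Γ(E, V.1) →ₗ[Γ(X, V.1)] Γ(X, V.1)) = 0
    simp
  smul_add r φ ψ := Subtype.ext <| funext fun V => by
    change X.presheaf.map (homOfLE V.2).op r • (φ.1 V + ψ.1 V) =
      X.presheaf.map (homOfLE V.2).op r • φ.1 V + X.presheaf.map (homOfLE V.2).op r • ψ.1 V
    simp
  add_smul r r' φ := Subtype.ext <| funext fun V => by
    change X.presheaf.map (homOfLE V.2).op (r + r') • φ.1 V =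
      X.presheaf.map (homOfLE V.2).op r • φ.1 V + X.presheaf.map (homOfLE V.2).op r' • φ.1 V
    simp [add_smul]
  zero_smul φ := Subtype.ext <| funext fun V => by
    change X.presheaf.map (homOfLE V.2).op 0 • φ.1 V = 0
    simp

variable {E} in
def dualSections.res {U U' : X.Opens} (h : U' ≤ U) : dualSections E U →+ dualSections E U' where
  toFun φ := ⟨fun V => φ.1 ⟨V.1, V.2.trans h⟩, fun V W hVW s =>
    φ.2 ⟨V.1, V.2.trans h⟩ ⟨W.1, W.2.trans h⟩ hVW s⟩
  map_zero' := rfl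
  map_add' _ _ := rfl

def dualPresheaf : TopCat.Presheaf Ab X where
  obj U := AddCommGrpCat.of (dualSections E U.unop)
  map i := AddCommGrpCat.ofHom (dualSections.res i.unop.le)

theorem dualPresheaf_isSheaf : (dualPresheaf E).IsSheaf := by
  refine (TopCat.Presheaf.isSheaf_iff_isSheaf_comp (forget AddCommGrpCat) _).2 ?_
  refine TopCat.Presheaf.isSheaf_of_isSheafUniqueGluing_types _ ?_
  intro ι U sf hsf
  change ∀ i, dualSections E (U i) at sf
  have hsf' : ∀ i j (V : X.Opens) (hi : V ≤ U i) (hj : V ≤ U j),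
      (sf i).1 ⟨V, hi⟩ = (sf j).1 ⟨V, hj⟩ := by
    intro i j V hi hj
    have := congrArg (fun φ : dualSections E (U i ⊓ U j) => φ.1 ⟨V, le_inf hi hj⟩) (hsf i j)
    exact this
  have cov : ∀ V : X.Opens, V ≤ iSup U → V ≤ ⨆ i, V ⊓ U i := fun V hV => by
    rw [← inf_iSup_eq]; exact le_inf le_rfl hV
  have key : ∀ (V : X.Opens) (_ : V ≤ iSup U) (s : Γ(E, V)), ∃ t : Γ(X, V), ∀ i,
      X.presheaf.map (homOfLE (inf_le_left : V ⊓ U i ≤ V)).op t =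
        (sf i).1 ⟨V ⊓ U i, inf_le_right⟩
          (E.presheaf.map (homOfLE (inf_le_left : V ⊓ U i ≤ V)).op s) := by
    intro V hV s
    obtain ⟨t, ht, -⟩ := TopCat.Sheaf.existsUnique_gluing' X.sheaf (fun i => V ⊓ U i) V
      (fun i => homOfLE inf_le_left) (cov V hV)
      (fun i => (sf i).1 ⟨V ⊓ U i, inf_le_right⟩
          (E.presheaf.map (homOfLE (inf_le_left : V ⊓ U i ≤ V)).op s)) (by
        intro i j
        have h1 := (sf i).2 ⟨V ⊓ U i, inf_le_right⟩
          ⟨(V ⊓ U i) ⊓ (V ⊓ U j), inf_le_left.trans inf_le_right⟩ inf_le_left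
          (E.presheaf.map (homOfLE (inf_le_left : V ⊓ U i ≤ V)).op s)
        have h2 := (sf j).2 ⟨V ⊓ U j, inf_le_right⟩
          ⟨(V ⊓ U i) ⊓ (V ⊓ U j), inf_le_right.trans inf_le_right⟩ inf_le_right
          (E.presheaf.map (homOfLE (inf_le_left : V ⊓ U j ≤ V)).op s)
        refine h1.symm.trans (Eq.trans ?_ h2)
        rw [hsf' i j _ _ (inf_le_right.trans inf_le_right), ← ConcreteCategory.comp_apply,
          ← ConcreteCategory.comp_apply, ← Functor.map_comp, ← Functor.map_comp]
        rfl)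
    exact ⟨t, ht⟩
  choose T hT using key
  have uniq : ∀ (V : X.Opens) (_ : V ≤ iSup U) (t t' : Γ(X, V)),
      (∀ i, X.presheaf.map (homOfLE (inf_le_left : V ⊓ U i ≤ V)).op t =
        X.presheaf.map (homOfLE (inf_le_left : V ⊓ U i ≤ V)).op t') → t = t' := fun V hV t t' h =>
    TopCat.Sheaf.eq_of_locally_eq' X.sheaf (fun i => V ⊓ U i) V
      (fun i => homOfLE inf_le_left) (cov V hV) t t' h
  let Φ : dualSections E (iSup U) := ⟨fun V =>
    { toFun := T V.1 V.2
      map_add' := fun s s' => uniq V.1 V.2 _ _ fun i => by simp [hT]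
      map_smul' := fun r s => uniq V.1 V.2 _ _ fun i => by simp [hT] },
    fun V W h s => uniq W.1 W.2 _ _ fun i => by
      change X.presheaf.map _ (T W.1 W.2 _) = X.presheaf.map _ (X.presheaf.map _ (T V.1 V.2 s))
      rw [hT]
      have e : (sf i).1 ⟨W.1 ⊓ U i, inf_le_right⟩
          (E.presheaf.map (homOfLE (inf_le_inf_right (U i) h : W.1 ⊓ U i ≤ V.1 ⊓ U i)).op
            (E.presheaf.map (homOfLE (inf_le_left : V.1 ⊓ U i ≤ V.1)).op s)) =
          X.presheaf.map (homOfLE (inf_le_inf_right (U i) h : W.1 ⊓ U i ≤ V.1 ⊓ U i)).op _ :=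
        (sf i).2 ⟨V.1 ⊓ U i, inf_le_right⟩ ⟨W.1 ⊓ U i, inf_le_right⟩ _ _
      rw [← hT] at e
      rw [← ConcreteCategory.comp_apply, ← Functor.map_comp] at e ⊢
      rw [← ConcreteCategory.comp_apply, ← Functor.map_comp] at e ⊢
      exact e⟩
  refine ⟨Φ, fun i => ?_, fun Ψ hΨ => ?_⟩
  · refine Subtype.ext <| funext fun V => LinearMap.ext fun s => ?_
    change T V.1 (V.2.trans (le_iSup U i)) s = (sf i).1 V s
    refine uniq V.1 (V.2.trans (le_iSup U i)) _ _ fun j => ?_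
    rw [hT, hsf' j i _ _ (inf_le_left.trans V.2)]
    exact (sf i).2 V ⟨V.1 ⊓ U j, inf_le_left.trans V.2⟩ inf_le_left s
  · change dualSections E (iSup U) at Ψ
    refine Subtype.ext <| funext fun V => LinearMap.ext fun s => ?_
    change Ψ.1 V s = T V.1 V.2 s
    refine uniq V.1 V.2 _ _ fun i => ?_
    rw [hT]
    have h1 : Ψ.1 ⟨V.1 ⊓ U i, inf_le_right.trans (le_iSup U i)⟩ = (sf i).1 ⟨V.1 ⊓ U i, inf_le_right⟩ :=
      congrArg (fun φ : dualSections E (U i) => φ.1 ⟨V.1 ⊓ U i, inf_le_right⟩) (hΨ i)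
    rw [← h1]
    exact (Ψ.2 V ⟨V.1 ⊓ U i, inf_le_right.trans (le_iSup U i)⟩ inf_le_left s).symm

/-- The dual sheaf of modules `E* = ℋom(E, 𝒪)`. -/
def dual : X.Modules where
  val :=
    letI (U : (Opens X)ᵒᵖ) : Module (X.ringCatSheaf.obj.obj U) ((dualPresheaf E).obj U) :=
      dualSections.module E U.unop
    .ofPresheaf (dualPresheaf E) fun U U' i r φ => by
      change Γ(X, U.unop) at r
      change dualSections E U.unop at φ
      refine Subtype.ext <| funext fun W => ?_
      change X.presheaf.map (homOfLE (W.2.trans i.unop.le)).op r •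
          φ.1 ⟨W.1, W.2.trans i.unop.le⟩ =
        X.presheaf.map (homOfLE W.2).op (X.presheaf.map i r) • φ.1 ⟨W.1, W.2.trans i.unop.le⟩
      rw [← ConcreteCategory.comp_apply, ← Functor.map_comp]
      rfl
  isSheaf := dualPresheaf_isSheaf E

end Dual

/-- The grading of `ℂ[X 0, …, X n]` by the degree. -/
abbrev grading (n : ℕ) : ℕ → Submodule ℂ (MvPolynomial (Fin (n + 1)) ℂ) :=
  fun d => MvPolynomial.homogeneousSubmodule (Fin (n + 1)) ℂ d

instance (n : ℕ) : GradedAlgebra (grading n) := MvPolynomial.gradedAlgebra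

/-- Projective `n`-space over the complex numbers, with homogeneous coordinates `X 0, …, X n`. -/
abbrev PSpace (n : ℕ) : Scheme.{0} := Proj (grading n)

abbrev PTop (n : ℕ) : TopCat.{0} := (PSpace n).carrier

/-- The homogeneous prime ideal of a point of projective space. -/
def pointIdeal {n : ℕ} (x : PTop n) : Ideal (MvPolynomial (Fin (n + 1)) ℂ) :=
  (ProjectiveSpectrum.asHomogeneousIdeal (𝒜 := grading n) x).toIdeal

instance {n : ℕ} (x : PTop n) : (pointIdeal x).IsPrime :=
  ProjectiveSpectrum.isPrime (𝒜 := grading n) x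

/-- The local ring of projective space at `x`: fractions `a / b` with `a`, `b` homogeneous of the
same degree and `b` outside the prime ideal of `x`. -/
abbrev PStalk {n : ℕ} (x : PTop n) : Type :=
  HomogeneousLocalization.AtPrime (grading n) (pointIdeal x)

/-- The germ at `x` of a regular function. -/
def evalAt {n : ℕ} {U : (PSpace n).Opens} (s : Γ(PSpace n, U)) (x : U) : PStalk x.1 :=
  (show ProjectiveSpectrum.StructureSheaf.sectionsSubring (𝒜 := grading n) (op U) from s).1 x

section FunctionSheaf

variable {n : ℕ} {M : PTop n → Type}
  [∀ x, AddCommGroup (M x)] [∀ x, Module (PStalk x) (M x)]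

/-- A local condition on functions `x ↦ f x ∈ M x` that cuts out a sheaf of modules. -/
structure IsLinearPredicate (P : TopCat.LocalPredicate (X := PTop n) M) : Prop where
  zero : ∀ U : (PSpace n).Opens, P.pred (U := U) (fun _ => 0)
  add : ∀ (U : (PSpace n).Opens) (f g : ∀ x : U, M x),
    P.pred f → P.pred g → P.pred (fun x => f x + g x)
  smul : ∀ (U : (PSpace n).Opens) (s : Γ(PSpace n, U)) (f : ∀ x : U, M x),
    P.pred f → P.pred (fun x => evalAt s x • f x)

variable {P : TopCat.LocalPredicate (X := PTop n) M} (hP : IsLinearPredicate P)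

def functionSections (U : (PSpace n).Opens) : AddSubgroup (∀ x : U, M x) where
  carrier := {f | P.pred f}
  zero_mem' := hP.zero U
  add_mem' := hP.add U _ _
  neg_mem' {f} hf := by
    have := hP.smul U (-1 : Γ(PSpace n, U)) f hf
    have e : (fun x => evalAt (-1 : Γ(PSpace n, U)) x • f x) = -f := funext fun x => by
      change (-1 : PStalk x.1) • f x = - f x
      simp
    rwa [e] at this

instance functionSections.module (U : (PSpace n).Opens) :
    Module Γ(PSpace n, U) (functionSections hP U) where
  smul s f := ⟨fun x => evalAt s x • f.1 x, hP.smul U s f.1 f.2⟩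
  one_smul f := Subtype.ext <| funext fun x => one_smul (PStalk x.1) (f.1 x)
  mul_smul s t f := Subtype.ext <| funext fun x => mul_smul (evalAt s x) (evalAt t x) (f.1 x)
  smul_zero s := Subtype.ext <| funext fun x => smul_zero (evalAt s x)
  smul_add s f g := Subtype.ext <| funext fun x => smul_add (evalAt s x) (f.1 x) (g.1 x)
  add_smul s t f := Subtype.ext <| funext fun x => add_smul (evalAt s x) (evalAt t x) (f.1 x)
  zero_smul f := Subtype.ext <| funext fun x => zero_smul (PStalk x.1) (f.1 x)

def functionPresheaf : TopCat.Presheaf Ab (PTop n) where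
  obj U := AddCommGrpCat.of (functionSections hP U.unop)
  map i := AddCommGrpCat.ofHom
    { toFun := fun f => ⟨fun x => f.1 (i.unop x), P.res i.unop f.1 f.2⟩
      map_zero' := rfl
      map_add' := fun _ _ => rfl }

/-- The sheaf of modules of all functions `x ↦ f x ∈ M x` satisfying a linear local condition. -/
def functionSheaf : (PSpace n).Modules where
  val :=
    letI (U : (PSpace n).Opensᵒᵖ) :
        Module ((PSpace n).ringCatSheaf.obj.obj U) ((functionPresheaf hP).obj U) :=
      functionSections.module hP U.unop
    .ofPresheaf (functionPresheaf hP) fun _ _ _ _ _ => rfl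
  isSheaf := (TopCat.Presheaf.isSheaf_iff_isSheaf_comp (forget AddCommGrpCat) _).2
    (TopCat.subsheafToTypes P).2

end FunctionSheaf

section Twist

variable (n : ℕ)

/-- A function is given on `U` by one fraction `a / b` with `deg a = deg b + 1`. -/
def twistPrelocal :
    TopCat.PrelocalPredicate (X := PTop n) fun x => Localization.AtPrime (pointIdeal x) where
  pred {U} f := ∃ (d : ℕ) (a : grading n (d + 1)) (b : grading n d),
    ∀ x : U, ∃ hb : (b : MvPolynomial (Fin (n + 1)) ℂ) ∉ pointIdeal x.1,
      f x = Localization.mk a.1 ⟨b.1, hb⟩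
  res := by
    rintro U V i f ⟨d, a, b, h⟩
    exact ⟨d, a, b, fun x => h (i x)⟩

def twistPredicate :
    TopCat.LocalPredicate (X := PTop n) fun x => Localization.AtPrime (pointIdeal x) :=
  (twistPrelocal n).sheafify

/-- Regular functions are locally fractions of homogeneous polynomials of the same degree. -/
theorem exists_fraction {n : ℕ} {U : (PSpace n).Opens} (s : Γ(PSpace n, U)) (x : U) :
    ∃ (V : (PSpace n).Opens) (_ : x.1 ∈ V) (i : V ⟶ U) (d : ℕ) (a b : grading n d),
      ∀ y : V, ∃ hb : (b : MvPolynomial (Fin (n + 1)) ℂ) ∉ pointIdeal y.1,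
        evalAt s (i y) = HomogeneousLocalization.mk ⟨d, a, b, hb⟩ := by
  obtain ⟨V, hV, i, d, a, b, hb, h⟩ :=
    (show ProjectiveSpectrum.StructureSheaf.sectionsSubring (𝒜 := grading n) (op U) from s).2 x
  exact ⟨V, hV, i, d, a, b, fun y => ⟨hb y, h y⟩⟩

theorem twistPredicate_isLinear : IsLinearPredicate (twistPredicate n) where
  zero U x := ⟨U, x.2, 𝟙 U, 0, 0, ⟨1, SetLike.one_mem_graded _⟩, fun y =>
    ⟨(Ideal.ne_top_iff_one _).1 (Ideal.IsPrime.ne_top inferInstance),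
      (Localization.mk_zero _).symm⟩⟩
  add U f g hf hg x := by
    obtain ⟨V, hV, i, d, a, b, h⟩ := hf x
    obtain ⟨V', hV', i', d', a', b', h'⟩ := hg x
    refine ⟨V ⊓ V', ⟨hV, hV'⟩, Opens.infLELeft _ _ ≫ i, d + d',
      ⟨b.1 * a'.1 + b'.1 * a.1, add_mem ?_ ?_⟩, ⟨b.1 * b'.1, ?_⟩, fun y => ?_⟩
    · rw [add_assoc]; exact SetLike.mul_mem_graded b.2 a'.2
    · rw [show d + d' + 1 = d' + (d + 1) by ring]; exact SetLike.mul_mem_graded b'.2 a.2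
    · exact SetLike.mul_mem_graded b.2 b'.2
    · obtain ⟨hb, e⟩ := h ⟨y.1, y.2.1⟩
      obtain ⟨hb', e'⟩ := h' ⟨y.1, y.2.2⟩
      refine ⟨fun hm => (Ideal.IsPrime.mem_or_mem inferInstance hm).elim hb hb', ?_⟩
      refine (congrArg₂ (· + ·) e e').trans ?_
      exact Localization.add_mk _ _ _ _
  smul U s f hf x := by
    obtain ⟨V, hV, i, d, a, b, h⟩ := hf x
    obtain ⟨V', hV', i', d', a', b', h'⟩ := exists_fraction s x
    refine ⟨V ⊓ V', ⟨hV, hV'⟩, Opens.infLELeft _ _ ≫ i, d' + d,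
      ⟨a'.1 * a.1, ?_⟩, ⟨b'.1 * b.1, SetLike.mul_mem_graded b'.2 b.2⟩, fun y => ?_⟩
    · rw [add_assoc]; exact SetLike.mul_mem_graded a'.2 a.2
    · obtain ⟨hb, e⟩ := h ⟨y.1, y.2.1⟩
      obtain ⟨hb', e'⟩ := h' ⟨y.1, y.2.2⟩
      refine ⟨fun hm => (Ideal.IsPrime.mem_or_mem inferInstance hm).elim hb' hb, ?_⟩
      refine (congrArg₂ (· • ·) e' e).trans ?_
      exact (Algebra.smul_def _ _).trans (Localization.mk_mul _ _ _ _)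

/-- The line bundle `𝒪(1)`: its sections are the functions into the localizations at the points
that are locally fractions `a / b` with `a`, `b` homogeneous and `deg a = deg b + 1`. -/
def twist : (PSpace n).Modules := functionSheaf (twistPredicate_isLinear n)

end Twist

section Hyperplanes

/-- Hyperplanes of projective space: nonzero linear forms up to nonzero scalars. -/
abbrev Hyperplane (n : ℕ) : Type := Projectivization ℂ (grading n 1)

/-- The closed subset of points lying on the hyperplane. -/
def Hyperplane.support {n : ℕ} (H : Hyperplane n) : Closeds (PSpace n) where
  carrier := {x | (H.rep : MvPolynomial (Fin (n + 1)) ℂ) ∈ pointIdeal x}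
  isClosed' := by
    have h := ProjectiveSpectrum.isClosed_zeroLocus (grading n)
      {(H.rep : MvPolynomial (Fin (n + 1)) ℂ)}
    have e : {x : PSpace n | (H.rep : MvPolynomial (Fin (n + 1)) ℂ) ∈ pointIdeal x} =
        ProjectiveSpectrum.zeroLocus (grading n) {(H.rep : MvPolynomial (Fin (n + 1)) ℂ)} :=
      Set.ext fun x => (Set.singleton_subset_iff
        (a := (H.rep : MvPolynomial (Fin (n + 1)) ℂ))
        (s := (pointIdeal x : Set (MvPolynomial (Fin (n + 1)) ℂ)))).symm
    rw [e]
    exact h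

/-- The hyperplane as a (reduced) closed subscheme. -/
def Hyperplane.subscheme {n : ℕ} (H : Hyperplane n) : Scheme.{0} :=
  (Scheme.IdealSheafData.vanishingIdeal H.support).subscheme

/-- The closed immersion of the hyperplane. -/
def Hyperplane.ι {n : ℕ} (H : Hyperplane n) : H.subscheme ⟶ PSpace n :=
  (Scheme.IdealSheafData.vanishingIdeal H.support).subschemeι

/-- The union of finitely many hyperplanes has normal crossing: at every point `p`, the equations of
the members passing through `p` are linearly independent. -/
def NormalCrossing {n : ℕ} (𝓗 : Finset (Hyperplane n)) : Prop :=
  ∀ p : Fin (n + 1) → ℂ, p ≠ 0 →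
    LinearIndependent ℂ fun H : {H : Hyperplane n //
      H ∈ 𝓗 ∧ MvPolynomial.eval p (H.rep : MvPolynomial (Fin (n + 1)) ℂ) = 0} => H.1.rep

end Hyperplanes

section LogForms

open KaehlerDifferential

variable {n : ℕ}

/-- The field of rational functions of projective space: fractions `a / b` with `a`, `b` homogeneous
of the same degree and `b ≠ 0`. -/
def FunctionField (n : ℕ) : Type :=
  HomogeneousLocalization.AtPrime (grading n) (⊥ : Ideal (MvPolynomial (Fin (n + 1)) ℂ))

instance : CommRing (FunctionField n) :=
  inferInstanceAs <| CommRing <|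
    HomogeneousLocalization.AtPrime (grading n) (⊥ : Ideal (MvPolynomial (Fin (n + 1)) ℂ))

instance : Algebra ℂ (FunctionField n) :=
  RingHom.toAlgebra <|
    (HomogeneousLocalization.fromZeroRingHom (grading n)
      (⊥ : Ideal (MvPolynomial (Fin (n + 1)) ℂ)).primeCompl).comp (algebraMap ℂ (grading n 0))

/-- The rational function `a / b`. -/
def FunctionField.ofFraction {d : ℕ} (a b : grading n d) (hb : b ≠ 0) : FunctionField n :=
  HomogeneousLocalization.mk ⟨d, a, b, fun h => hb (Subtype.ext h)⟩

/-- The inclusion of the local ring at `x` in the function field. -/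
def stalkToFunctionField (x : PTop n) : PStalk x →+* FunctionField n :=
  HomogeneousLocalization.mapId (grading n)
    (fun _ ha h => ha ((bot_le : ⊥ ≤ pointIdeal x) h))

/-- Rational (meromorphic) differential `1`-forms, viewed as a module over the local ring at `x`. -/
def RationalForm (_ : PTop n) : Type := Ω[FunctionField n⁄ℂ]

instance (x : PTop n) : AddCommGroup (RationalForm x) :=
  inferInstanceAs (AddCommGroup Ω[FunctionField n⁄ℂ])

instance (x : PTop n) : Module (PStalk x) (RationalForm x) :=
  Module.compHom Ω[FunctionField n⁄ℂ] (stalkToFunctionField x)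

theorem ne_zero_of_notMem {d : ℕ} {x : PTop n} {m : grading n d}
    (hm : (m : MvPolynomial (Fin (n + 1)) ℂ) ∉ pointIdeal x) : m ≠ 0 := fun h =>
  hm (h ▸ (pointIdeal x).zero_mem)

/-- The form `d(l / m) / (l / m)`. -/
def dlog (l m : grading n 1) (hl : l ≠ 0) (hm : m ≠ 0) : Ω[FunctionField n⁄ℂ] :=
  FunctionField.ofFraction m l hl • D ℂ (FunctionField n) (FunctionField.ofFraction l m hm)

/-- The germs at `x` of forms with at most logarithmic poles on the union of `𝓗`: the module over the
local ring at `x` generated by the `df`, with `f` in the local ring, and by the `dg / g`, with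
`g = l / m` the equation near `x` of a member `l = 0` of `𝓗` (where `m` is a linear form with
`m(x) ≠ 0`). -/
def logStalk (𝓗 : Finset (Hyperplane n)) (x : PTop n) : Submodule (PStalk x) (RationalForm x) :=
  Submodule.span (PStalk x)
    ({ω | ∃ f : PStalk x, ω = D ℂ (FunctionField n) (stalkToFunctionField x f)} ∪
      {ω | ∃ H ∈ 𝓗, ∃ (m : grading n 1)
        (hm : (m : MvPolynomial (Fin (n + 1)) ℂ) ∉ pointIdeal x),
          ω = dlog H.rep m H.rep_nonzero (ne_zero_of_notMem hm)})

/-- A function on `U` is given by one rational form, with logarithmic poles at all points of `U`. -/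
def logPrelocal (𝓗 : Finset (Hyperplane n)) :
    TopCat.PrelocalPredicate (X := PTop n) RationalForm where
  pred {U} f := ∃ η : Ω[FunctionField n⁄ℂ], ∀ x : U, f x = η ∧ f x ∈ logStalk 𝓗 x.1
  res := by
    rintro U V i f ⟨η, h⟩
    exact ⟨η, fun x => h (i x)⟩

def logPredicate (𝓗 : Finset (Hyperplane n)) :
    TopCat.LocalPredicate (X := PTop n) RationalForm :=
  (logPrelocal 𝓗).sheafify

theorem logPredicate_isLinear (𝓗 : Finset (Hyperplane n)) :
    IsLinearPredicate (logPredicate 𝓗) where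
  zero U x := ⟨U, x.2, 𝟙 U, 0, fun y => ⟨rfl, Submodule.zero_mem _⟩⟩
  add U f g hf hg x := by
    obtain ⟨V, hV, i, η, h⟩ := hf x
    obtain ⟨V', hV', i', η', h'⟩ := hg x
    refine ⟨V ⊓ V', ⟨hV, hV'⟩, Opens.infLELeft _ _ ≫ i, η + η', fun y => ?_⟩
    have e := h ⟨y.1, y.2.1⟩
    have e' := h' ⟨y.1, y.2.2⟩
    exact ⟨congrArg₂ (fun a b : Ω[FunctionField n⁄ℂ] => a + b) e.1 e'.1,
      Submodule.add_mem _ e.2 e'.2⟩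
  smul U s f hf x := by
    obtain ⟨V, hV, i, η, h⟩ := hf x
    obtain ⟨V', hV', i', d, a, b, h'⟩ := exists_fraction s x
    have hb : b ≠ 0 := ne_zero_of_notMem (h' ⟨x.1, hV'⟩).1
    refine ⟨V ⊓ V', ⟨hV, hV'⟩, Opens.infLELeft _ _ ≫ i,
      FunctionField.ofFraction a b hb • η, fun y => ?_⟩
    have e := h ⟨y.1, y.2.1⟩
    obtain ⟨hy, e'⟩ := h' ⟨y.1, y.2.2⟩
    refine ⟨?_, Submodule.smul_mem _ _ e.2⟩
    have e2 : stalkToFunctionField y.1 (evalAt s (i' ⟨y.1, y.2.2⟩)) =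
        FunctionField.ofFraction a b hb := by
      rw [e']; rfl
    exact congrArg₂ (fun (c : FunctionField n) (ω : Ω[FunctionField n⁄ℂ]) => c • ω) e2 e.1

/-- The sheaf `Ω(log 𝓗)` of rational `1`-forms with at most logarithmic poles on the union of `𝓗`. -/
def logForms (𝓗 : Finset (Hyperplane n)) : (PSpace n).Modules :=
  functionSheaf (logPredicate_isLinear 𝓗)

end LogForms

section Steiner

variable {n : ℕ}

/-- Locally free of rank `r`. -/
def IsVectorBundleOfRank {X : Scheme.{0}} (E : X.Modules) (r : ℕ) : Prop :=
  ∀ x : X, ∃ U : X.Opens, x ∈ U ∧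
    Nonempty (E.restrict U.ι ≅ SheafOfModules.free (R := U.toScheme.ringCatSheaf) (Fin r))

instance (X : Scheme.{0}) : HasFiniteBiproducts X.Modules := Abelian.hasFiniteBiproducts

/-- The trivial bundle `𝒪^r`. -/
def trivialBundle (X : Scheme.{0}) (r : ℕ) : X.Modules :=
  SheafOfModules.free (R := X.ringCatSheaf) (Fin r)

/-- Membership in `𝒮_{n,k}`: a vector bundle `S` of rank `n` with an exact sequence
`0 → S* → 𝒪^(n+k) → 𝒪(1)^k → 0`. -/
structure IsSteiner (k : ℕ) (S : (PSpace n).Modules) : Prop where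
  isVectorBundle : IsVectorBundleOfRank S n
  exact : ∃ (f : dual S ⟶ trivialBundle (PSpace n) (n + k))
    (g : trivialBundle (PSpace n) (n + k) ⟶ ⨁ fun _ : Fin k => twist n) (w : f ≫ g = 0),
    (ShortComplex.mk f g w).ShortExact

/-- The set `W(S)` of unstable hyperplanes: those `H` for which the restriction of `S*` to `H` has a
nonzero global section. -/
def unstableHyperplanes (S : (PSpace n).Modules) : Set (Hyperplane n) :=
  {H | Nontrivial Γ((Scheme.Modules.pullback H.ι).obj (dual S), ⊤)}

/-- `S` is isomorphic to `Ω(log 𝓗)` for a finite union `𝓗` of hyperplanes with normal crossing. -/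
def IsLogarithmic (S : (PSpace n).Modules) : Prop :=
  ∃ 𝓗 : Finset (Hyperplane n), NormalCrossing 𝓗 ∧ Nonempty (S ≅ logForms 𝓗)

end Steiner

end SteinerLog

end

/-! # Steiner bundles with many unstable hyperplanes are logarithmic

All sheaves are compared through their duals. The dual of a Steiner bundle `S` is the kernel of a
`k × (n + k)` matrix `A` of linear forms, of rank `k` at every point of projective space
(`IsSteiner.exists_presentation`), and a vector bundle is determined by its dual
(`nonempty_iso_of_dual`), so `S` is determined by `A`.

A hyperplane with equation `ℓ` is unstable if and only if `A v = ℓ w` for a nonzero constant vector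
`v` and a constant vector `w`: the coordinates of a section of the dual over the hyperplane are
constants (`Presentation.exists_mulConst_of_nontrivial`, `Presentation.nontrivial_of_mulConst`).

Let `ℓ i`, `v i`, `w i` belong to `n + k + 1` unstable hyperplanes. Evaluated at vectors `p`, the
matrix `A` is a bilinear map such that `A p` is surjective for `p ≠ 0`. By the theorem of Hopf on
bilinear maps without zero divisors (`finrank_add_finrank_le_of_nonsingular`), applied to transposes
of restrictions of `A`, any `n + k` of the `v i` are independent (`linearIndepOn_of_unstable`); for
`k = 1` this needs that the hyperplanes have normal crossing. So there is exactly one relation among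
the `v i`. It has no zero coefficients, and after rescaling it reads `∑ v i = 0`. Applying `A` gives
`∑ ℓ i w i = 0`, whence the `ℓ i` are in general position (`card_zeros_lt_of_unstable`). With
respect to the basis `v 1, …, v (n + k)`, the columns of `A` are `ℓ i w i`, so the rows of `A` are
the `k` independent linear relations among all the `ℓ i`.

For an arrangement `𝓗` with normal crossing and more than `n` members, the same matrix presents the
dual of the logarithmic forms (`nonempty_presentation_logForms`): a section `φ` is determined by its
values on the forms `dlog (ℓ i / ℓ last)`, and if `∑ c i ℓ i = 0` then `∑ c i ℓ i φ i = 0`, because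
`∑ c i (ℓ i / ℓ last) dlog (ℓ i / ℓ last) = ∑ c i d (ℓ i / ℓ last) = 0`. This gives the isomorphism.

Conversely, the unit vectors and their negative sum show that the members of `𝓗` are unstable for
the logarithmic forms (`nontrivial_of_logMatrix`). A logarithmic Steiner bundle belongs to an
arrangement with more than `n` members (`card_gt_of_presentation`), and the Hilbert functions of the
two presentations of its dual show that it has at least `n + k + 1` (`le_of_nondegenerate`). For
`k = 1` the entries of `A` are a basis of the linear forms, all hyperplanes are unstable, and any
`n + 2` hyperplanes in general position may be taken. -/

noncomputable section
namespace SteinerLog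

/-! ### Nonsingular bilinear maps over the complex numbers -/

section Segre

open MvPolynomial

variable (a b : ℕ)

/-- The coordinate ring of the cone of matrices of rank at most one, as the subalgebra of
`ℂ[x₀, …, x_a, y₀, …, y_b]` generated by the products `x_i y_j`. -/
def segreRing : Subalgebra ℂ (MvPolynomial (Fin (a + 1) ⊕ Fin (b + 1)) ℂ) :=
  Algebra.adjoin ℂ (Set.range fun p : Fin (a + 1) × Fin (b + 1) =>
    (X (Sum.inl p.1) * X (Sum.inr p.2) : MvPolynomial (Fin (a + 1) ⊕ Fin (b + 1)) ℂ))

instance : Algebra.FiniteType ℂ (segreRing a b) :=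
  Subalgebra.fg_iff_finiteType _ |>.1 (Subalgebra.fg_def.2 ⟨_, Set.finite_range _, rfl⟩)

instance : IsNoetherianRing (segreRing a b) :=
  Algebra.FiniteType.isNoetherianRing ℂ _

instance : IsJacobsonRing (segreRing a b) :=
  isJacobsonRing_of_finiteType (A := ℂ)

variable {a b} in
/-- The generator `x_i y_j`. -/
def segreRing.gen (i : Fin (a + 1)) (j : Fin (b + 1)) : segreRing a b :=
  ⟨X (Sum.inl i) * X (Sum.inr j), Algebra.subset_adjoin ⟨(i, j), rfl⟩⟩

/-- The order in which the variables are set to zero along a chain of primes; the last `y` comes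
last, and the last `x` just before it. -/
def segreOrder : Fin (a + 1) ⊕ Fin (b + 1) → ℕ
  | Sum.inl i => if (i : ℕ) < a then i else a + b
  | Sum.inr j => if (j : ℕ) < b then a + j else a + b + 1

/-- Setting the first `t` variables to zero. -/
def segreKill (t : ℕ) : MvPolynomial (Fin (a + 1) ⊕ Fin (b + 1)) ℂ →ₐ[ℂ]
    MvPolynomial (Fin (a + 1) ⊕ Fin (b + 1)) ℂ :=
  aeval fun v => if segreOrder a b v < t then 0 else X v

/-- The vanishing of the first `t` variables. For `t ≤ a + b + 1` these primes of the Segre ring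
form a strictly increasing chain, which ends with the vertex of the cone. -/
def segrePrime (t : ℕ) : Ideal (segreRing a b) :=
  RingHom.ker ((segreKill a b t).comp (segreRing a b).val)

instance (t : ℕ) : (segrePrime a b t).IsPrime := RingHom.ker_isPrime _

variable {a b}

theorem mem_segrePrime {t : ℕ} {r : segreRing a b} :
    r ∈ segrePrime a b t ↔ segreKill a b t r.1 = 0 := by
  rw [segrePrime, RingHom.mem_ker, AlgHom.comp_apply, Subalgebra.coe_val]

theorem gen_mem_segrePrime (t : ℕ) (i : Fin (a + 1)) (j : Fin (b + 1)) :
    segreRing.gen i j ∈ segrePrime a b t ↔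
      segreOrder a b (Sum.inl i) < t ∨ segreOrder a b (Sum.inr j) < t := by
  rw [mem_segrePrime, segreRing.gen, map_mul, mul_eq_zero, segreKill, aeval_X, aeval_X]
  simp only [ite_eq_left_iff, X_ne_zero, imp_false, not_not]

theorem segrePrime_lt (t : ℕ) (ht : t ≤ a + b) : segrePrime a b t < segrePrime a b (t + 1) := by
  refine lt_of_le_of_ne ?_ ?_
  · intro r hr
    have h : (segreKill a b (t + 1)).comp (segreKill a b t) = segreKill a b (t + 1) := by
      refine algHom_ext fun v => ?_
      rw [AlgHom.comp_apply, segreKill, segreKill, aeval_X, aeval_X]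
      by_cases h1 : segreOrder a b v < t
      · rw [if_pos h1, if_pos (by omega), map_zero]
      · rw [if_neg h1, aeval_X]
    rw [mem_segrePrime] at hr ⊢
    rw [← h, AlgHom.comp_apply, hr, map_zero]
  · intro h
    have key : ∀ i j, segreOrder a b (Sum.inl i) < t + 1 ∨ segreOrder a b (Sum.inr j) < t + 1 →
        segreOrder a b (Sum.inl i) < t ∨ segreOrder a b (Sum.inr j) < t := fun i j => by
      rw [← gen_mem_segrePrime, ← gen_mem_segrePrime, h]
      exact id
    rcases lt_or_ge t a with h1 | h1
    · have := key ⟨t, by omega⟩ (Fin.last b) (Or.inl (by simp [segreOrder, h1]))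
      simp [segreOrder, h1] at this
      omega
    rcases lt_or_ge t (a + b) with h2 | h2
    · have := key (Fin.last a) ⟨t - a, by omega⟩ (Or.inr (by
          simp only [segreOrder]; split_ifs <;> omega))
      simp only [segreOrder, Fin.val_last, lt_irrefl, if_false] at this
      split_ifs at this <;> omega
    · have := key (Fin.last a) (Fin.last b) (Or.inl (by
          simp only [segreOrder, Fin.val_last, lt_irrefl, if_false]; omega))
      simp only [segreOrder, Fin.val_last, lt_irrefl, if_false] at this
      omega

theorem le_height_segrePrime (t : ℕ) (ht : t ≤ a + b + 1) :
    (t : ℕ∞) ≤ (segrePrime a b t).height := by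
  induction t with
  | zero => simp
  | succ t ih =>
    push_cast
    exact (add_le_add_left (ih (by omega)) 1).trans
      (Ideal.height_add_one_le_of_lt_of_isPrime (segrePrime_lt t (by omega)))

/-- The vertex of the cone is cut out by the `x_i y_j`. -/
theorem segrePrime_le_of_gen_mem {Q : Ideal (segreRing a b)}
    (hQ : ∀ i j, segreRing.gen i j ∈ Q) {t : ℕ} (hQt : Q ≤ segrePrime a b t) :
    segrePrime a b t ≤ Q := by
  have key : ∀ (r) (hr : r ∈ segreRing a b), ∃ c : ℂ,
      (⟨r, hr⟩ : segreRing a b) - algebraMap ℂ _ c ∈ Q := by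
    intro r hr
    induction hr using Algebra.adjoin_induction with
    | mem x hx =>
      obtain ⟨p, rfl⟩ := hx
      exact ⟨0, by simpa [segreRing.gen] using hQ p.1 p.2⟩
    | algebraMap c => exact ⟨c, by convert Q.zero_mem using 1; exact sub_self _⟩
    | add x y hx hy ihx ihy =>
      obtain ⟨c, hc⟩ := ihx
      obtain ⟨d, hd⟩ := ihy
      refine ⟨c + d, ?_⟩
      convert Q.add_mem hc hd using 1
      rw [map_add]
      exact add_sub_add_comm (⟨x, hx⟩ : segreRing a b) ⟨y, hy⟩ _ _
    | mul x y hx hy ihx ihy =>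
      obtain ⟨c, hc⟩ := ihx
      obtain ⟨d, hd⟩ := ihy
      refine ⟨c * d, ?_⟩
      convert Q.add_mem (Q.mul_mem_right (⟨y, hy⟩ : segreRing a b) hc)
        (Q.mul_mem_left (algebraMap ℂ _ c) hd) using 1
      rw [map_mul]
      change (⟨x, hx⟩ : segreRing a b) * ⟨y, hy⟩ - _ = _
      ring
  intro r hr
  obtain ⟨c, hc⟩ := key r.1 r.2
  have h1 : algebraMap ℂ (segreRing a b) c ∈ segrePrime a b t := by
    have := (segrePrime a b t).sub_mem hr (hQt hc)
    simpa using this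
  have h2 : c = 0 := by
    by_contra h0
    refine (Ideal.IsPrime.ne_top (inferInstance : (segrePrime a b t).IsPrime))
      (Ideal.eq_top_of_isUnit_mem _ h1 ((IsUnit.mk0 c h0).map _))
  simpa [h2] using hc

/-- By the Nullstellensatz, a prime of the Segre ring that contains the linear forms of a
nonsingular bilinear map contains all `x_i y_j`. -/
theorem gen_mem_of_nonsingular {c : ℕ} {β : Fin c → Fin (a + 1) → Fin (b + 1) → ℂ}
    (hβ : ∀ (p : Fin (a + 1) → ℂ) (q : Fin (b + 1) → ℂ),
      (∀ l, ∑ i, ∑ j, β l i j * (p i * q j) = 0) → p = 0 ∨ q = 0)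
    {Q : Ideal (segreRing a b)} [hQ : Q.IsPrime]
    (hJ : ∀ l, ∑ i, ∑ j, β l i j • segreRing.gen i j ∈ Q) (i : Fin (a + 1)) (j : Fin (b + 1)) :
    segreRing.gen i j ∈ Q := by
  by_contra hij
  have hjac : Q.jacobson = Q := IsJacobsonRing.out inferInstance hQ.isRadical
  rw [← hjac, Ideal.jacobson, Ideal.mem_sInf] at hij
  push Not at hij
  obtain ⟨M, ⟨hQM, hM⟩, hijM⟩ := hij
  let _ := Ideal.Quotient.field M
  have : Module.Finite ℂ (segreRing a b ⧸ M) := finite_of_finite_type_of_isJacobsonRing ℂ _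
  have hbij := IsAlgClosed.algebraMap_bijective_of_isIntegral (k := ℂ) (K := segreRing a b ⧸ M)
  let e : ℂ ≃ₐ[ℂ] (segreRing a b ⧸ M) := AlgEquiv.ofBijective (Algebra.ofId _ _) hbij
  let ev : segreRing a b →ₐ[ℂ] ℂ := e.symm.toAlgHom.comp (Ideal.Quotient.mkₐ ℂ M)
  have hev : ∀ r, ev r = 0 ↔ r ∈ M := fun r => by
    change e.symm (Ideal.Quotient.mk M r) = 0 ↔ _
    rw [EmbeddingLike.map_eq_zero_iff, Ideal.Quotient.eq_zero_iff_mem]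
  have hz : ev (segreRing.gen i j) ≠ 0 := fun h => hijM ((hev _).1 h)
  have hrel : ∀ k l, ev (segreRing.gen k j) * ev (segreRing.gen i l) =
      ev (segreRing.gen i j) * ev (segreRing.gen k l) := fun k l => by
    rw [← map_mul, ← map_mul]
    congr 1
    refine Subtype.ext ?_
    change X (Sum.inl k) * X (Sum.inr j) * (X (Sum.inl i) * X (Sum.inr l)) =
      X (Sum.inl i) * X (Sum.inr j) * (X (Sum.inl k) * X (Sum.inr l))
    ring
  -- the point has rank one: its row and column through a nonzero entry are `p` and `q`
  rcases hβ (fun k => ev (segreRing.gen k j)) (fun l => ev (segreRing.gen i l)) (fun l => by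
    simp only [hrel]
    have := (hev _).2 (hQM (hJ l))
    simp only [map_sum, map_smul, smul_eq_mul] at this
    rw [← mul_zero (ev (segreRing.gen i j)), ← this, Finset.mul_sum]
    refine Finset.sum_congr rfl fun k _ => ?_
    rw [Finset.mul_sum]
    exact Finset.sum_congr rfl fun l' _ => by ring) with h | h
  · exact hz (congrFun h i)
  · exact hz (congrFun h j)

/-- The linear forms `β l` generate an ideal whose only minimal prime is the vertex of the cone, of
height at least `a + b + 1`. By Krull's height theorem there are at least as many of them. -/
theorem le_of_nonsingular_matrix {c : ℕ} {β : Fin c → Fin (a + 1) → Fin (b + 1) → ℂ}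
    (hβ : ∀ (p : Fin (a + 1) → ℂ) (q : Fin (b + 1) → ℂ),
      (∀ l, ∑ i, ∑ j, β l i j * (p i * q j) = 0) → p = 0 ∨ q = 0) :
    a + b + 1 ≤ c := by
  classical
  let g : Fin c → segreRing a b := fun l => ∑ i, ∑ j, β l i j • segreRing.gen i j
  let J : Ideal (segreRing a b) := Ideal.span (Finset.univ.image g : Finset (segreRing a b))
  have hg : ∀ l, g l ∈ J := fun l => Ideal.subset_span (by simp)
  have hall : ∀ i j, segreRing.gen i j ∈ segrePrime a b (a + b + 1) := fun i j =>
    (gen_mem_segrePrime _ _ _).2 (Or.inl (by simp only [segreOrder]; split_ifs <;> omega))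
  have hmin : segrePrime a b (a + b + 1) ∈ J.minimalPrimes := by
    refine ⟨⟨inferInstance, ?_⟩, ?_⟩
    · refine Ideal.span_le.2 ?_
      intro x hx
      simp only [Finset.coe_image, Set.mem_image, Finset.coe_univ] at hx
      obtain ⟨l, -, rfl⟩ := hx
      refine Ideal.sum_mem _ fun i _ => Ideal.sum_mem _ fun j _ => ?_
      rw [Algebra.smul_def]
      exact Ideal.mul_mem_left _ _ (hall i j)
    · rintro Q ⟨hQ, hJQ⟩ hle
      exact segrePrime_le_of_gen_mem (gen_mem_of_nonsingular hβ fun l => hJQ (hg l)) hle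
  have h1 := le_height_segrePrime (a := a) (b := b) (a + b + 1) le_rfl
  have h2 := Ideal.height_le_spanRank_toENat_of_mem_minimalPrimes J _ hmin
  rw [J.spanRank_toENat_eq_iInf_finset_card] at h2
  have h3 := (h1.trans h2).trans (iInf_le _ ⟨Finset.univ.image g, rfl⟩)
  have h4 : a + b + 1 ≤ (Finset.univ.image g).card := by exact_mod_cast h3
  exact h4.trans (Finset.card_image_le.trans (by simp))

end Segre

/-- **Hopf's theorem** over `ℂ`: a bilinear map without zero divisors `X × Y → Z` between nonzero
spaces has `dim X + dim Y ≤ dim Z + 1`. -/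
theorem finrank_add_finrank_le_of_nonsingular {X Y Z : Type*} [AddCommGroup X] [Module ℂ X]
    [AddCommGroup Y] [Module ℂ Y] [AddCommGroup Z] [Module ℂ Z] [FiniteDimensional ℂ X]
    [FiniteDimensional ℂ Y] [FiniteDimensional ℂ Z] [Nontrivial X] [Nontrivial Y]
    (B : X →ₗ[ℂ] Y →ₗ[ℂ] Z) (hB : ∀ x y, B x y = 0 → x = 0 ∨ y = 0) :
    Module.finrank ℂ X + Module.finrank ℂ Y ≤ Module.finrank ℂ Z + 1 := by
  obtain ⟨a, ha⟩ := Nat.exists_eq_succ_of_ne_zero (Module.finrank_pos (R := ℂ) (M := X)).ne'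
  obtain ⟨b, hb⟩ := Nat.exists_eq_succ_of_ne_zero (Module.finrank_pos (R := ℂ) (M := Y)).ne'
  let bX := Module.finBasisOfFinrankEq ℂ X ha
  let bY := Module.finBasisOfFinrankEq ℂ Y hb
  let bZ := Module.finBasis ℂ Z
  have := le_of_nonsingular_matrix (a := a) (b := b)
    (β := fun l i j => bZ.repr (B (bX i) (bY j)) l) (fun p q h => by
      have h0 : B (∑ i, p i • bX i) (∑ j, q j • bY j) = 0 := by
        refine bZ.ext_elem fun l => ?_
        rw [map_zero, Finsupp.zero_apply, ← h l]
        simp only [map_sum, map_smul, LinearMap.sum_apply, LinearMap.smul_apply,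
          Finsupp.finsetSum_apply, Finsupp.smul_apply, smul_eq_mul, Finset.mul_sum]
        rw [Finset.sum_comm]
        exact Finset.sum_congr rfl fun i _ => Finset.sum_congr rfl fun j _ => by ring
      rcases hB _ _ h0 with h1 | h1
      · exact Or.inl (funext fun i =>
          Fintype.linearIndependent_iff.1 bX.linearIndependent p h1 i)
      · exact Or.inr (funext fun j =>
          Fintype.linearIndependent_iff.1 bY.linearIndependent q h1 j))
  omega

/-! ### Pencils of linear maps and their unstable forms -/

section Tensor

open Module

variable {V I W : Type*} [AddCommGroup V] [Module ℂ V] [AddCommGroup I] [Module ℂ I]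
  [AddCommGroup W] [Module ℂ W] [FiniteDimensional ℂ V] [FiniteDimensional ℂ I]
  [FiniteDimensional ℂ W]

/-- The dimension estimate behind all independence statements: if `T p : I → W` is surjective for
`p ≠ 0` and `T p` maps `I'` to `W'` for all `p ∈ P`, apply Hopf's theorem to the pairing of `P` with
the annihilator of `W'`, with values in the annihilator of `I'`. -/
theorem finrank_add_le_of_surjective (T : V →ₗ[ℂ] I →ₗ[ℂ] W)
    (hT : ∀ p, p ≠ 0 → Function.Surjective (T p)) (P : Submodule ℂ V) (I' : Submodule ℂ I)
    (W' : Submodule ℂ W) (hP : P ≠ ⊥) (hW : W' ≠ ⊤) (h : ∀ p ∈ P, ∀ v ∈ I', T p v ∈ W') :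
    finrank ℂ P + finrank ℂ W + finrank ℂ I' ≤ finrank ℂ I + finrank ℂ W' + 1 := by
  let B : P →ₗ[ℂ] W'.dualAnnihilator →ₗ[ℂ] I'.dualAnnihilator :=
    LinearMap.mk₂ ℂ (fun p f => ⟨f.1.comp (T p), (Submodule.mem_dualAnnihilator _).2 fun v hv =>
        (Submodule.mem_dualAnnihilator _).1 f.2 _ (h p p.2 v hv)⟩)
      (fun p p' f => Subtype.ext <| LinearMap.ext fun v => by simp)
      (fun c p f => Subtype.ext <| LinearMap.ext fun v => by simp)
      (fun p f f' => Subtype.ext <| LinearMap.ext fun v => by simp)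
      (fun c p f => Subtype.ext <| LinearMap.ext fun v => by simp)
  have : Nontrivial P := Submodule.nontrivial_iff_ne_bot.2 hP
  have hN : Nontrivial W'.dualAnnihilator := by
    refine Submodule.nontrivial_iff_ne_bot.2 fun h0 => hW ?_
    have := congrArg Submodule.dualCoannihilator h0
    simpa using this
  have h1 := finrank_add_finrank_le_of_nonsingular B (fun p f h0 => by
    by_cases hp : p = 0
    · exact Or.inl hp
    refine Or.inr (Subtype.ext <| LinearMap.ext fun w => ?_)
    obtain ⟨v, rfl⟩ := hT p (fun h => hp (Subtype.ext h)) w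
    exact LinearMap.congr_fun (congrArg Subtype.val h0) v)
  have h2 := Subspace.finrank_add_finrank_dualAnnihilator_eq W'
  have h3 := Subspace.finrank_add_finrank_dualAnnihilator_eq I'
  omega

variable [Nontrivial V] [Nontrivial W]

theorem eq_zero_of_forall_apply_eq_zero (T : V →ₗ[ℂ] I →ₗ[ℂ] W)
    (hT : ∀ p, p ≠ 0 → Function.Surjective (T p))
    (hdim : finrank ℂ I + 1 = finrank ℂ V + finrank ℂ W) {v : I} (hv : ∀ p, T p v = 0) : v = 0 := by
  by_contra h0
  have := finrank_add_le_of_surjective T hT ⊤ (Submodule.span ℂ {v}) ⊥ top_ne_bot bot_ne_top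
    (fun p _ u hu => by
      obtain ⟨c, rfl⟩ := Submodule.mem_span_singleton.1 hu
      simp [hv])
  rw [finrank_span_singleton h0] at this
  simp at this
  omega

variable {ι : Type*} {T : V →ₗ[ℂ] I →ₗ[ℂ] W} {l : ι → Dual ℂ V} {v : ι → I} {w : ι → W}

/-- At most `dim I` vectors `v i ≠ 0` with `T p (v i) = l i p • w i` are linearly independent; if
`W` is a line, the forms `l i` are assumed to be in general position.
In a minimal relation, the ranks of the `l i` and of the `w i` add up to at most the number of
terms; the dimension estimate, applied on the common zeros of the `l i` and modulo the span of the
`w i`, leaves no room for it. -/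
theorem linearIndepOn_of_unstable (hT : ∀ p, p ≠ 0 → Function.Surjective (T p))
    (hdim : finrank ℂ I + 1 = finrank ℂ V + finrank ℂ W)
    (hl : ∀ i j, i ≠ j → LinearIndependent ℂ ![l i, l j])
    (hv : ∀ i, v i ≠ 0) (hvw : ∀ i p, T p (v i) = l i p • w i)
    (hW : 2 ≤ finrank ℂ W ∨ ∀ p, p ≠ 0 → LinearIndepOn ℂ l {i | l i p = 0})
    (s : Finset ι) (hs : s.card ≤ finrank ℂ I) : LinearIndepOn ℂ v (s : Set ι) := by
  classical
  induction hn : s.card generalizing s with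
  | zero => simp [Finset.card_eq_zero.1 hn]
  | succ N ih =>
  by_contra hdep
  -- all proper subsets are independent, so `s` is a circuit
  have hsub : ∀ i ∈ s, LinearIndepOn ℂ v ((s.erase i : Finset ι) : Set ι) := fun i hi =>
    ih _ ((Finset.card_erase_le).trans hs) (by rw [Finset.card_erase_of_mem hi, hn]; rfl)
  rw [linearIndepOn_finset_iff] at hdep
  push Not at hdep
  obtain ⟨c, hc, i₀, hi₀, hci₀⟩ := hdep
  have hc0 : ∀ i ∈ s, c i ≠ 0 := by
    intro i hi h0
    have h1 := linearIndepOn_finset_iff.1 (hsub i hi) c (by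
      rw [← hc, ← Finset.add_sum_erase s _ hi, h0, zero_smul, zero_add])
    by_cases h2 : i₀ = i
    · exact hci₀ (h2 ▸ h0)
    · exact hci₀ (h1 i₀ (Finset.mem_erase.2 ⟨h2, hi₀⟩))
  have hrel : ∀ p, ∑ i ∈ s, (c i * l i p) • w i = 0 := fun p => by
    have := congrArg (T p) hc
    simpa only [map_sum, map_smul, hvw, map_zero, smul_smul] using this
  let L : V →ₗ[ℂ] (s → ℂ) := LinearMap.pi fun i => c i • l i
  let M : (s → ℂ) →ₗ[ℂ] W := Fintype.linearCombination ℂ fun i : s => w i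
  have hML : LinearMap.range L ≤ LinearMap.ker M := by
    rintro _ ⟨p, rfl⟩
    rw [LinearMap.mem_ker, ← hrel p, ← Finset.sum_attach]
    simp [M, L, Fintype.linearCombination_apply]
  let I' : Submodule ℂ I := Submodule.span ℂ (v '' (s : Set ι))
  have hI' : N ≤ finrank ℂ I' := by
    have h1 := finrank_span_eq_card (hsub i₀ hi₀)
    have h2 :
        Submodule.span ℂ (Set.range fun x : ((s.erase i₀ : Finset ι) : Set ι) => v x) ≤ I' := by
      refine Submodule.span_mono ?_
      rintro _ ⟨x, rfl⟩
      exact ⟨x, Finset.mem_of_mem_erase x.2, rfl⟩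
    have h3 := Submodule.finrank_mono h2
    rw [h1] at h3
    simp only [Finset.coe_sort_coe, Fintype.card_coe, Finset.card_erase_of_mem hi₀, hn] at h3
    exact h3
  -- the relation, evaluated at all `p`, bounds the ranks of `L` and `M`
  have hLr := L.finrank_range_add_finrank_ker
  have hMr := M.finrank_range_add_finrank_ker
  have hLM := Submodule.finrank_mono hML
  have hcard : finrank ℂ (s → ℂ) = N + 1 := by simp [hn]
  rw [hcard] at hMr
  have hN : 1 ≤ N := by
    by_contra h0
    have h1 : s.card = 1 := by omega
    obtain ⟨j, rfl⟩ := Finset.card_eq_one.1 h1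
    rw [Finset.sum_singleton] at hc
    exact (smul_ne_zero (hc0 j (by simp)) (hv j)) hc
  have hL2 : 2 ≤ finrank ℂ (LinearMap.range L) := by
    obtain ⟨i, hi, j, hj, hij⟩ := Finset.one_lt_card.1 (show 1 < s.card by omega)
    have h1 := hl i j hij
    by_contra h2
    have h3 := L.finrank_range_add_finrank_ker
    -- the two forms `l i`, `l j` cut out a subspace of codimension two
    have h4 : LinearMap.ker L ≤ (Submodule.span ℂ (Set.range ![l i, l j])).dualCoannihilator := by
      intro p hp
      rw [Submodule.mem_dualCoannihilator]
      intro f hf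
      have hz : ∀ k ∈ s, l k p = 0 := fun k hk => by
        have := congrFun (LinearMap.mem_ker.1 hp) ⟨k, hk⟩
        simpa [L, hc0 k hk] using this
      refine Submodule.span_induction ?_ rfl (fun f g _ _ hf hg => by simp [hf, hg])
        (fun a f _ hf => by simp [hf]) hf
      rintro _ ⟨k, rfl⟩
      fin_cases k
      · exact hz i hi
      · exact hz j hj
    have h5 := Submodule.finrank_mono h4
    have h6 := Subspace.finrank_add_finrank_dualCoannihilator_eq
      (Submodule.span ℂ (Set.range ![l i, l j]))
    rw [finrank_span_eq_card h1, Fintype.card_fin] at h6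
    omega
  have hI'M : ∀ p, ∀ u ∈ I', T p u ∈ LinearMap.range M := by
    intro p u hu
    refine Submodule.span_induction ?_ (by simp) (fun a b _ _ ha hb => by
      rw [map_add]; exact add_mem ha hb) (fun a b _ hb => by
      rw [map_smul]; exact Submodule.smul_mem _ _ hb) hu
    rintro _ ⟨i, hi, rfl⟩
    refine ⟨Pi.single ⟨i, hi⟩ (l i p), ?_⟩
    simp [M, hvw]
  have hWtop : LinearMap.range M = ⊤ := by
    by_contra hne
    have h1 := finrank_add_le_of_surjective T hT ⊤ I' (LinearMap.range M) top_ne_bot hne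
      (fun p _ u hu => hI'M p u hu)
    rw [finrank_top] at h1
    omega
  have hb : finrank ℂ (LinearMap.range M) = finrank ℂ W := by rw [hWtop, finrank_top]
  have hWpos : 0 < finrank ℂ W := finrank_pos
  by_cases hP : LinearMap.ker L = ⊥
  · rw [hP, finrank_bot] at hLr
    omega
  · have h1 := finrank_add_le_of_surjective T hT (LinearMap.ker L) I' ⊥ hP bot_ne_top (by
      intro p hp u hu
      rw [Submodule.mem_bot]
      have hz : ∀ k ∈ s, l k p = 0 := fun k hk => by
        have := congrFun (LinearMap.mem_ker.1 hp) ⟨k, hk⟩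
        simpa [L, hc0 k hk] using this
      refine Submodule.span_induction ?_ (by simp) (fun a b _ _ ha hb => by
        rw [map_add, ha, hb, add_zero]) (fun a b _ hb => by rw [map_smul, hb, smul_zero]) hu
      rintro _ ⟨i, hi, rfl⟩
      rw [hvw, hz i hi, zero_smul])
    rw [finrank_bot] at h1
    rcases hW with hW | hW
    · omega
    · obtain ⟨p, hp, hp0⟩ := Submodule.exists_mem_ne_zero_of_ne_bot hP
      have hz : ∀ k ∈ s, l k p = 0 := fun k hk => by
        have := congrFun (LinearMap.mem_ker.1 hp) ⟨k, hk⟩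
        simpa [L, hc0 k hk] using this
      have h2 : LinearIndepOn ℂ l (s : Set ι) := (hW p hp0).mono hz
      -- independent forms make `L` surjective, so `M` vanishes
      have h3 : finrank ℂ (LinearMap.ker L) ≤ finrank ℂ
          (Submodule.span ℂ (Set.range fun x : (s : Set ι) => l x)).dualCoannihilator := by
        refine Submodule.finrank_mono fun q hq => ?_
        rw [Submodule.mem_dualCoannihilator]
        intro f hf
        refine Submodule.span_induction ?_ rfl (fun f g _ _ hf hg => by simp [hf, hg])
          (fun a f _ hf => by simp [hf]) hf
        rintro _ ⟨k, rfl⟩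
        have := congrFun (LinearMap.mem_ker.1 hq) ⟨k.1, k.2⟩
        simpa [L, hc0 k.1 k.2] using this
      have h4 := Subspace.finrank_add_finrank_dualCoannihilator_eq
        (Submodule.span ℂ (Set.range fun x : (s : Set ι) => l x))
      have h5 : Fintype.card (s : Set ι) = N + 1 := by
        simp only [Finset.coe_sort_coe, Fintype.card_coe, hn]
      rw [finrank_span_eq_card h2, h5] at h4
      omega

variable {m : ℕ} {l : Fin (m + 1) → Dual ℂ V} {v : Fin (m + 1) → I} {w : Fin (m + 1) → W}

/-- `dim I + 1` vectors `v i` with `T p (v i) = l i p • w i` satisfy a linear relation without zero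
coefficients. -/
theorem exists_relation_of_unstable (hm : finrank ℂ I = m)
    (hind : ∀ s : Finset (Fin (m + 1)), s.card ≤ m → LinearIndepOn ℂ v (s : Set (Fin (m + 1)))) :
    ∃ c : Fin (m + 1) → ℂ, (∀ i, c i ≠ 0) ∧ ∑ i, c i • v i = 0 := by
  have hdep : ¬ LinearIndependent ℂ v := fun h => by
    have := h.fintype_card_le_finrank
    simp [hm] at this
  obtain ⟨c, hc, i, hi⟩ := Fintype.not_linearIndependent_iff.1 hdep
  refine ⟨c, fun j hj => ?_, hc⟩
  have h1 := linearIndepOn_finset_iff.1 (hind (Finset.univ.erase j) (by simp)) c (by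
    rw [← hc, ← Finset.add_sum_erase _ _ (Finset.mem_univ j), hj, zero_smul, zero_add])
  by_cases hij : i = j
  · exact hi (hij ▸ hj)
  · exact hi (h1 i (by simp [hij]))

/-- The first `dim I` of the `dim I + 1` vectors are a basis. -/
theorem top_le_span_of_unstable (hm : finrank ℂ I = m)
    (hind : ∀ s : Finset (Fin (m + 1)), s.card ≤ m → LinearIndepOn ℂ v (s : Set (Fin (m + 1)))) :
    LinearIndependent ℂ (fun i : Fin m => v i.castSucc) ∧
      ⊤ ≤ Submodule.span ℂ (Set.range fun i : Fin m => v i.castSucc) := by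
  have h1 : LinearIndependent ℂ (fun i : Fin m => v i.castSucc) := by
    have h2 := hind (Finset.univ.map Fin.castSuccEmb) (by simp)
    have h3 : LinearIndepOn ℂ v (Set.range (Fin.castSucc : Fin m → Fin (m + 1))) := by
      convert h2 using 1
      ext; simp
    exact h3.comp (fun i : Fin m => ⟨i.castSucc, i, rfl⟩)
      (fun i j h => Fin.castSucc_injective m (congrArg Subtype.val h))
  exact ⟨h1, (h1.span_eq_top_of_card_eq_finrank' (by simp [hm])).ge⟩

end Tensor

section Zeros

open Module

variable {V I W : Type*} [AddCommGroup V] [Module ℂ V] [AddCommGroup I] [Module ℂ I]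
  [AddCommGroup W] [Module ℂ W]

/-- The zeros of at least `dim V` of the forms are the origin only: at a common zero `p`, the map
`T p` has rank less than `dim W`, because of the relation `∑ l i p • w i = 0`. -/
theorem card_zeros_lt_of_unstable [FiniteDimensional ℂ W] [Nontrivial W] {m : ℕ}
    {T : V →ₗ[ℂ] I →ₗ[ℂ] W} {l : Fin (m + 1) → Dual ℂ V} {v : Fin (m + 1) → I}
    {w : Fin (m + 1) → W} (hT : ∀ p, p ≠ 0 → Function.Surjective (T p))
    (hdim : m + 1 = finrank ℂ V + finrank ℂ W)
    (hvw : ∀ i p, T p (v i) = l i p • w i)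
    (hspan : ⊤ ≤ Submodule.span ℂ (Set.range fun i : Fin m => v i.castSucc))
    (hrel : ∑ i, v i = 0) {p : V} (hp : p ≠ 0) (s : Finset (Fin (m + 1)))
    (hs : ∀ i ∈ s, l i p = 0) : s.card < finrank ℂ V := by
  classical
  have hsp : ⊤ ≤ Submodule.span ℂ (Set.range fun i : (sᶜ : Finset (Fin (m + 1))) =>
      l i p • w i) := by
    intro x _
    obtain ⟨u, rfl⟩ := hT p hp x
    refine Submodule.span_induction ?_ (by simp) (fun a b _ _ ha hb => by
      rw [map_add]; exact add_mem ha hb) (fun a b _ hb => by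
      rw [map_smul]; exact Submodule.smul_mem _ _ hb) (hspan (Submodule.mem_top (x := u)))
    rintro _ ⟨i, rfl⟩
    by_cases hi : i.castSucc ∈ s
    · simp [hvw, hs _ hi]
    · simp only [hvw]
      exact Submodule.subset_span ⟨⟨i.castSucc, by simpa using hi⟩, rfl⟩
  have hWpos : 0 < finrank ℂ W := finrank_pos
  have hcard : Fintype.card (sᶜ : Finset (Fin (m + 1))) + s.card = m + 1 := by
    rw [Fintype.card_coe, Finset.card_compl, Fintype.card_fin]
    have := s.card_le_univ
    rw [Fintype.card_fin] at this
    omega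
  have h1 : finrank ℂ W ≤ Fintype.card (sᶜ : Finset (Fin (m + 1))) := by
    rw [← finrank_top ℂ W, ← top_le_iff.1 hsp]
    exact finrank_range_le_card _
  by_contra h2
  have hind := linearIndependent_of_top_le_span_of_card_eq_finrank hsp (by omega)
  have hr := congrArg (T p) hrel
  simp only [map_sum, hvw, map_zero] at hr
  rw [← Finset.sum_compl_add_sum s, Finset.sum_eq_zero (s := s) (fun i hi => by
    rw [hs i hi, zero_smul]), add_zero, ← Finset.sum_coe_sort] at hr
  have h3 := Fintype.linearIndependent_iff.1 hind (fun _ => 1) (by simpa using hr)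
  have : Nonempty (sᶜ : Finset (Fin (m + 1))) := Fintype.card_pos_iff.1 (by omega)
  exact one_ne_zero (h3 (Classical.arbitrary _))

/-- Forms of which any `dim V` have no common zero are in general position. -/
theorem linearIndepOn_of_card_zeros_lt [FiniteDimensional ℂ V] {ι : Type*} [Fintype ι]
    {l : ι → Dual ℂ V}
    (hcard : finrank ℂ V ≤ Fintype.card ι)
    (h : ∀ p, p ≠ 0 → ∀ s : Finset ι, (∀ i ∈ s, l i p = 0) → s.card < finrank ℂ V)
    (s : Finset ι) (hs : s.card ≤ finrank ℂ V) : LinearIndepOn ℂ l (s : Set ι) := by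
  classical
  obtain ⟨t, hst, -, ht⟩ := Finset.exists_subsuperset_card_eq (Finset.subset_univ s) hs
    (by simpa using hcard)
  refine LinearIndepOn.mono ?_ (Finset.coe_subset.2 hst)
  let L : V →ₗ[ℂ] (t → ℂ) := LinearMap.pi fun i => l i
  have hinj : Function.Injective L := by
    rw [← LinearMap.ker_eq_bot, LinearMap.ker_eq_bot']
    intro p hp
    by_contra h0
    exact (h p h0 t fun i hi => congrFun hp ⟨i, hi⟩).ne ht
  have hsurj := (LinearMap.injective_iff_surjective_of_finrank_eq_finrank
    (by simp [ht])).1 hinj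
  rw [linearIndepOn_finset_iff]
  intro c hc i hi
  obtain ⟨p, hp⟩ := hsurj (Pi.single ⟨i, hi⟩ 1)
  have h1 := LinearMap.congr_fun hc p
  rw [LinearMap.sum_apply, ← Finset.sum_coe_sort, Finset.sum_eq_single ⟨i, hi⟩] at h1
  · have h2 := congrFun hp ⟨i, hi⟩
    simp only [L, LinearMap.pi_apply, Pi.single_eq_same] at h2
    simpa [h2] using h1
  · intro j _ hj
    have h2 := congrFun hp j
    simp only [L, LinearMap.pi_apply, Pi.single_eq_of_ne hj] at h2
    simp [h2]
  · simp

end Zeros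

/-! ### Points, regular functions and twisted functions on projective space -/

/-- The homogeneous coordinate ring of projective space. -/
abbrev Pol (n : ℕ) : Type := MvPolynomial (Fin (n + 1)) ℂ

/-- The field of fractions of the homogeneous coordinate ring. Functions, sections of `𝒪(1)` and
coefficients of differential forms are all compared inside this field. -/
abbrev Frac (n : ℕ) : Type := FractionRing (Pol n)

section Points

variable {n : ℕ}

/-- The point of projective space given by a homogeneous prime that misses some coordinate. -/
def pointOfIdeal (I : Ideal (Pol n)) (hI : I.IsHomogeneous (grading n)) (hp : I.IsPrime)
    (i : Fin (n + 1)) (hi : (MvPolynomial.X i : Pol n) ∉ I) : PTop n :=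
  (⟨⟨I, hI⟩, hp, fun h => hi (h (by
    rw [HomogeneousIdeal.mem_irrelevant_iff, GradedRing.proj_apply,
      DirectSum.decompose_of_mem_ne (grading n) (MvPolynomial.isHomogeneous_X ℂ i) one_ne_zero]))⟩ :
    ProjectiveSpectrum (grading n))

theorem pointIdeal_pointOfIdeal (I : Ideal (Pol n)) (hI : I.IsHomogeneous (grading n))
    (hp : I.IsPrime) (i : Fin (n + 1)) (hi : (MvPolynomial.X i : Pol n) ∉ I) :
    pointIdeal (pointOfIdeal I hI hp i hi) = I := rfl

theorem exists_X_notMem (x : PTop n) : ∃ i, (MvPolynomial.X i : Pol n) ∉ pointIdeal x := by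
  by_contra! h
  refine ProjectiveSpectrum.not_irrelevant_le (𝒜 := grading n) x ?_
  intro f hf
  change f ∈ pointIdeal x
  rw [HomogeneousIdeal.mem_irrelevant_iff, GradedRing.proj_apply] at hf
  change ((MvPolynomial.decomposition.decompose' f 0 : _) : Pol n) = 0 at hf
  rw [MvPolynomial.decomposition.decompose'_apply, MvPolynomial.homogeneousComponent_zero,
    MvPolynomial.C_eq_zero] at hf
  have h1 : f ∈ Ideal.span ((MvPolynomial.X : Fin (n + 1) → Pol n) '' Set.univ) := by
    rw [MvPolynomial.mem_ideal_span_X_image]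
    intro m hm
    by_contra! h0
    have : m = 0 := Finsupp.ext fun i => h0 i trivial
    rw [this, MvPolynomial.mem_support_iff] at hm
    exact hm hf
  exact Ideal.span_le.2 (by rintro _ ⟨i, -, rfl⟩; exact h i) h1

/-- The basic open subset `b ≠ 0`. -/
abbrev basicOpen (b : Pol n) : (PSpace n).Opens := Proj.basicOpen (grading n) b

theorem mem_basicOpen {b : Pol n} {x : PTop n} : x ∈ basicOpen b ↔ b ∉ pointIdeal x := Iff.rfl

/-- The generic point. -/
def genericPt (n : ℕ) : PTop n :=
  pointOfIdeal ⊥ (Ideal.IsHomogeneous.bot _) Ideal.isPrime_bot 0 (MvPolynomial.X_ne_zero _)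

theorem genericPt_mem {U : (PSpace n).Opens} {x : PTop n} (hx : x ∈ U) : genericPt n ∈ U := by
  have h : x ∈ closure {genericPt n} :=
    (ProjectiveSpectrum.le_iff_mem_closure (𝒜 := grading n) (genericPt n) x).1
      (show (⊥ : HomogeneousIdeal (grading n)) ≤ _ from bot_le)
  obtain ⟨y, hy, rfl⟩ := mem_closure_iff.1 h U U.2 hx
  exact hy

/-- An ideal containing, for each point of projective space, a homogeneous element not vanishing
there, contains powers of all coordinates. -/
theorem exists_X_pow_mem (I : Ideal (Pol n))
    (hI : ∀ x : PTop n, ∃ e, ∃ b ∈ grading n e, b ∈ I ∧ b ∉ pointIdeal x) (i : Fin (n + 1)) :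
    ∃ N, (MvPolynomial.X i : Pol n) ^ N ∈ I := by
  suffices h : (MvPolynomial.X i : Pol n) ∈ (I.homogeneousCore (grading n)).toIdeal.radical by
    obtain ⟨N, hN⟩ := h
    exact ⟨N, Ideal.toIdeal_homogeneousCore_le _ _ hN⟩
  rw [Ideal.IsHomogeneous.radical_eq (I.homogeneousCore (grading n)).2, Ideal.mem_sInf]
  rintro J ⟨hJ, hIJ, hp⟩
  by_contra hi
  obtain ⟨e, b, hb, hbI, hbJ⟩ := hI (pointOfIdeal J hJ hp i hi)
  exact hbJ (hIJ (Ideal.mem_homogeneousCore_of_homogeneous_of_mem ⟨e, hb⟩ hbI))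

/-- Such an ideal contains all forms of large degree. -/
theorem exists_forall_grading_le (I : Ideal (Pol n))
    (hI : ∀ x : PTop n, ∃ e, ∃ b ∈ grading n e, b ∈ I ∧ b ∉ pointIdeal x) :
    ∃ N, ∀ d, N ≤ d → ∀ f ∈ grading n d, f ∈ I := by
  have h1 : Ideal.span (Set.range (MvPolynomial.X : Fin (n + 1) → Pol n)) ≤ I.radical :=
    Ideal.span_le.2 (by rintro _ ⟨i, rfl⟩; exact exists_X_pow_mem I hI i)
  obtain ⟨N, hN⟩ := Ideal.exists_pow_le_of_le_radical_of_fg h1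
    (Submodule.fg_span (Set.finite_range _))
  refine ⟨N, fun d hd f hf => hN (Ideal.pow_le_pow_right hd ?_)⟩
  rw [Ideal.mem_span_pow_iff_exists_isHomogeneous]
  exact ⟨MvPolynomial.map MvPolynomial.C f, hf.map _, by
    rw [MvPolynomial.eval_map]; exact MvPolynomial.eval₂_eta f⟩

end Points
section Regular

variable {n : ℕ}

/-- An element of the field of fractions that is, at the point `x`, a fraction of homogeneous
polynomials of degrees `e + d` and `e`, with denominator not vanishing at `x`. -/
def IsRegularAt (d : ℕ) (x : PTop n) (z : Frac n) : Prop :=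
  ∃ e, ∃ a ∈ grading n (e + d), ∃ b ∈ grading n e, b ∉ pointIdeal x ∧
    z * algebraMap (Pol n) (Frac n) b = algebraMap (Pol n) (Frac n) a

theorem ne_zero_of_notMem_pointIdeal {x : PTop n} {b : Pol n} (hb : b ∉ pointIdeal x) : b ≠ 0 :=
  fun h => hb (h ▸ (pointIdeal x).zero_mem)

theorem algebraMap_ne_zero_of_notMem {x : PTop n} {b : Pol n} (hb : b ∉ pointIdeal x) :
    algebraMap (Pol n) (Frac n) b ≠ 0 :=
  (map_ne_zero_iff _ (IsFractionRing.injective _ _)).2 (ne_zero_of_notMem_pointIdeal hb)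

theorem mul_notMem {x : PTop n} {a b : Pol n} (ha : a ∉ pointIdeal x) (hb : b ∉ pointIdeal x) :
    a * b ∉ pointIdeal x := fun h => (Ideal.IsPrime.mem_or_mem inferInstance h).elim ha hb

theorem isRegularAt_of_mem {d : ℕ} {a : Pol n} (ha : a ∈ grading n d) (x : PTop n) :
    IsRegularAt d x (algebraMap (Pol n) (Frac n) a) :=
  ⟨0, a, by rwa [zero_add], 1, SetLike.one_mem_graded _,
    (Ideal.ne_top_iff_one _).1 (Ideal.IsPrime.ne_top inferInstance), by simp⟩

theorem IsRegularAt.mul {d d' : ℕ} {x : PTop n} {z w : Frac n} (hz : IsRegularAt d x z)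
    (hw : IsRegularAt d' x w) : IsRegularAt (d + d') x (z * w) := by
  obtain ⟨e, a, ha, b, hb, hbx, h⟩ := hz
  obtain ⟨e', a', ha', b', hb', hbx', h'⟩ := hw
  refine ⟨e + e', a * a', ?_, b * b', SetLike.mul_mem_graded hb hb', mul_notMem hbx hbx', ?_⟩
  · rw [show e + e' + (d + d') = (e + d) + (e' + d') by ring]; exact SetLike.mul_mem_graded ha ha'
  · simp only [map_mul, ← h, ← h']; ring

theorem isRegularAt_div {d e : ℕ} {x : PTop n} {a b : Pol n} (ha : a ∈ grading n (e + d))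
    (hb : b ∈ grading n e) (hbx : b ∉ pointIdeal x) :
    IsRegularAt d x (algebraMap (Pol n) (Frac n) a / algebraMap (Pol n) (Frac n) b) :=
  ⟨e, a, ha, b, hb, hbx, div_mul_cancel₀ _ (algebraMap_ne_zero_of_notMem hbx)⟩

/-- A function regular of degree `d` at all points of projective space of positive dimension is a
homogeneous polynomial of degree `d`. -/
theorem exists_polynomial_of_isRegularAt (hn : 1 ≤ n) {d : ℕ} {z : Frac n}
    (hz : ∀ x : PTop n, IsRegularAt d x z) :
    ∃ f ∈ grading n d, algebraMap (Pol n) (Frac n) f = z := by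
  let ι := algebraMap (Pol n) (Frac n)
  have hι : Function.Injective ι := IsFractionRing.injective _ _
  -- the ideal of denominators of `z` contains powers of all coordinates
  let I : Ideal (Pol n) :=
    { carrier := {b | ∃ a, z * ι b = ι a}
      zero_mem' := ⟨0, by simp⟩
      add_mem' := by
        rintro b b' ⟨a, h⟩ ⟨a', h'⟩
        exact ⟨a + a', by rw [map_add, map_add, mul_add, h, h']⟩
      smul_mem' := by
        rintro c b ⟨a, h⟩
        exact ⟨c * a, by rw [smul_eq_mul, map_mul, map_mul, ← h]; ring⟩ }
  have hI : ∀ x : PTop n, ∃ e, ∃ b ∈ grading n e, b ∈ I ∧ b ∉ pointIdeal x := fun x => by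
    obtain ⟨e, a, ha, b, hb, hbx, h⟩ := hz x
    exact ⟨e, b, hb, ⟨a, h⟩, hbx⟩
  obtain ⟨N, f, hf⟩ := exists_X_pow_mem I hI 0
  obtain ⟨M, g, hg⟩ := exists_X_pow_mem I hI ⟨1, by omega⟩
  have h01 : f * MvPolynomial.X ⟨1, by omega⟩ ^ M = g * MvPolynomial.X 0 ^ N := hι (by
    rw [map_mul, map_mul, ← hf, ← hg]; ring)
  have hdvd : (MvPolynomial.X 0 : Pol n) ^ N ∣ f := by
    refine (MvPolynomial.X_prime (R := ℂ)).pow_dvd_of_dvd_mul_right N ?_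
      (Dvd.intro_left _ h01.symm)
    intro h
    have := (MvPolynomial.X_prime (R := ℂ) (i := (0 : Fin (n + 1)))).dvd_of_dvd_pow h
    rw [MvPolynomial.X_dvd_X] at this
    simp [Fin.ext_iff] at this
  obtain ⟨p, rfl⟩ := hdvd
  have hp : ι p = z := by
    have h0 : ι (MvPolynomial.X 0 ^ N) ≠ 0 :=
      (map_ne_zero_iff _ hι).2 (pow_ne_zero _ (MvPolynomial.X_ne_zero _))
    refine mul_right_cancel₀ h0 ?_
    rw [hf, map_mul]; ring
  refine ⟨p, ?_, hp⟩
  obtain ⟨e, a, ha, b, hb, hbx, h⟩ := hz (genericPt n)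
  have hb0 : b ≠ 0 := ne_zero_of_notMem_pointIdeal hbx
  have h1 : b * p = a := hι (by rw [map_mul, hp, ← h]; ring)
  have h2 : b * (DirectSum.decompose (grading n) p d : Pol n) = b * p := by
    rw [← DirectSum.coe_decompose_mul_add_of_left_mem (grading n) hb, h1,
      DirectSum.decompose_of_mem_same (grading n) ha]
  rw [← mul_left_cancel₀ hb0 h2]
  exact (DirectSum.decompose (grading n) p d).2

/-- The inclusion of the localization at a point in the field of fractions. -/
def locToFrac (x : PTop n) : Localization.AtPrime (pointIdeal x) →+* Frac n :=
  IsLocalization.lift (M := (pointIdeal x).primeCompl) (g := algebraMap (Pol n) (Frac n))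
    fun b => (algebraMap_ne_zero_of_notMem b.2).isUnit

theorem locToFrac_mk (x : PTop n) (a : Pol n) (b : (pointIdeal x).primeCompl) :
    locToFrac x (Localization.mk a b) * algebraMap (Pol n) (Frac n) b =
      algebraMap (Pol n) (Frac n) a := by
  rw [Localization.mk_eq_mk', mul_comm, locToFrac]
  exact ((IsLocalization.lift_mk'_spec _ _ _ _).1 rfl).symm

theorem locToFrac_injective (x : PTop n) : Function.Injective (locToFrac x) := by
  rw [injective_iff_map_eq_zero]
  intro z hz
  induction z using Localization.induction_on with
  | _ y =>
    have h := locToFrac_mk x y.1 y.2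
    rw [hz, zero_mul] at h
    have h1 : y.1 = 0 := IsFractionRing.injective (Pol n) (Frac n) (by rw [← h, map_zero])
    rw [show y = (y.1, y.2) from rfl, h1]
    exact Localization.mk_zero _

/-- The inclusion of the local ring at a point in the field of fractions. -/
def stalkToFrac (x : PTop n) : PStalk x →+* Frac n :=
  (locToFrac x).comp (algebraMap (PStalk x) (Localization.AtPrime (pointIdeal x)))

theorem stalkToFrac_mk (x : PTop n) {d : ℕ} (a b : grading n d)
    (hb : (b : Pol n) ∉ pointIdeal x) :
    stalkToFrac x (HomogeneousLocalization.mk ⟨d, a, b, hb⟩) * algebraMap (Pol n) (Frac n) b =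
      algebraMap (Pol n) (Frac n) a :=
  locToFrac_mk x a ⟨b, hb⟩

theorem stalkToFrac_injective (x : PTop n) : Function.Injective (stalkToFrac x) :=
  (locToFrac_injective x).comp (HomogeneousLocalization.val_injective _)

theorem stalkToFrac_isRegularAt (x : PTop n) (s : PStalk x) :
    IsRegularAt 0 x (stalkToFrac x s) := by
  obtain ⟨⟨d, a, b, hb⟩, rfl⟩ := HomogeneousLocalization.mk_surjective s
  exact ⟨d, a, a.2, b, b.2, hb, stalkToFrac_mk x a b hb⟩

theorem IsRegularAt.exists_stalk {x : PTop n} {z : Frac n} (hz : IsRegularAt 0 x z) :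
    ∃ s : PStalk x, stalkToFrac x s = z := by
  obtain ⟨d, a, ha, b, hb, hbx, h⟩ := hz
  refine ⟨HomogeneousLocalization.mk ⟨d, ⟨a, ha⟩, ⟨b, hb⟩, hbx⟩, ?_⟩
  refine mul_right_cancel₀ (algebraMap_ne_zero_of_notMem hbx) ?_
  rw [h]
  exact stalkToFrac_mk x ⟨a, ha⟩ ⟨b, hb⟩ hbx

/-- Being regular is an open condition. -/
theorem IsRegularAt.exists_open {d : ℕ} {x : PTop n} {z : Frac n} (hz : IsRegularAt d x z) :
    ∃ V : (PSpace n).Opens, x ∈ V ∧ ∃ e, ∃ a ∈ grading n (e + d), ∃ b ∈ grading n e,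
      ∀ y ∈ V, b ∉ pointIdeal y ∧
        z * algebraMap (Pol n) (Frac n) b = algebraMap (Pol n) (Frac n) a := by
  obtain ⟨e, a, ha, b, hb, hbx, h⟩ := hz
  exact ⟨basicOpen b, hbx, e, a, ha, b, hb, fun y hy => ⟨hy, h⟩⟩

/-- The rational function defined by a regular function on an open neighbourhood of `x`. -/
def ratAt {U : (PSpace n).Opens} (x : U) : Γ(PSpace n, U) →+* Frac n where
  toFun s := stalkToFrac x.1 (evalAt s x)
  map_one' := map_one (stalkToFrac x.1)
  map_zero' := map_zero (stalkToFrac x.1)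
  map_mul' s t := map_mul (stalkToFrac x.1) (evalAt s x) (evalAt t x)
  map_add' s t := map_add (stalkToFrac x.1) (evalAt s x) (evalAt t x)

theorem ratAt_map {U V : (PSpace n).Opens} (i : V ⟶ U) (s : Γ(PSpace n, U)) (x : V) :
    ratAt x ((PSpace n).presheaf.map i.op s) = ratAt (i x) s := rfl

theorem ratAt_isRegularAt {U : (PSpace n).Opens} (x : U) (s : Γ(PSpace n, U)) :
    IsRegularAt 0 x.1 (ratAt x s) := stalkToFrac_isRegularAt _ _

theorem ratAt_eq_genericPt {U : (PSpace n).Opens} (s : Γ(PSpace n, U)) (x : U) :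
    ratAt x s = ratAt ⟨genericPt n, genericPt_mem x.2⟩ s := by
  obtain ⟨V, hV, i, d, a, b, h⟩ := exists_fraction s x
  obtain ⟨hb, e⟩ := h ⟨x.1, hV⟩
  obtain ⟨hb', e'⟩ := h ⟨genericPt n, genericPt_mem hV⟩
  refine mul_right_cancel₀ (algebraMap_ne_zero_of_notMem hb) ?_
  have h1 : ratAt x s * algebraMap (Pol n) (Frac n) b = algebraMap (Pol n) (Frac n) a :=
    (congrArg (stalkToFrac x.1 · * _) e).trans (stalkToFrac_mk _ a b hb)
  have h2 : ratAt ⟨genericPt n, genericPt_mem x.2⟩ s * algebraMap (Pol n) (Frac n) b =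
      algebraMap (Pol n) (Frac n) a :=
    (congrArg (stalkToFrac (genericPt n) · * _) e').trans (stalkToFrac_mk _ a b hb')
  exact h1.trans h2.symm

theorem ratAt_eq {U : (PSpace n).Opens} (s : Γ(PSpace n, U)) (x y : U) : ratAt x s = ratAt y s :=
  (ratAt_eq_genericPt s x).trans (ratAt_eq_genericPt s y).symm

theorem section_ext {U : (PSpace n).Opens} {s t : Γ(PSpace n, U)}
    (h : ∀ x : U, ratAt x s = ratAt x t) : s = t :=
  Subtype.ext (funext fun x => stalkToFrac_injective x.1 (h x))

theorem ratAt_injective {U : (PSpace n).Opens} (x : U) : Function.Injective (ratAt x) :=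
  fun s t h => section_ext fun y => by rw [ratAt_eq s y x, ratAt_eq t y x, h]

/-- An element of the field of fractions regular at all points of `U` is a regular function. -/
theorem exists_section {U : (PSpace n).Opens} {z : Frac n}
    (hz : ∀ x : U, IsRegularAt 0 x.1 z) : ∃ s : Γ(PSpace n, U), ∀ x : U, ratAt x s = z := by
  choose f hf using fun x : U => (hz x).exists_stalk
  refine ⟨⟨f, fun x => ?_⟩, hf⟩
  obtain ⟨V, hV, d, a, ha, b, hb, h⟩ := (hz x).exists_open
  refine ⟨V ⊓ U, ⟨hV, x.2⟩, Opens.infLERight V U, d, ⟨a, ha⟩, ⟨b, hb⟩, fun y => (h y.1 y.2.1).1,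
    fun y => ?_⟩
  refine stalkToFrac_injective y.1 ?_
  refine mul_right_cancel₀ (algebraMap_ne_zero_of_notMem (h y.1 y.2.1).1) ?_
  refine Eq.trans ?_ (stalkToFrac_mk y.1 ⟨a, ha⟩ ⟨b, hb⟩ (h y.1 y.2.1).1).symm
  refine Eq.trans ?_ (h y.1 y.2.1).2
  exact congrArg (· * _) (hf ⟨y.1, y.2.2⟩)

end Regular

/-! ### Sheaves of modules through their sections: exactness, local bases, reflexivity -/

section SheavesOfModules

variable {X : Scheme.{0}}

/-- The structure sheaf as a sheaf of modules over itself. -/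
abbrev structureModule (X : Scheme.{0}) : X.Modules := SheafOfModules.unit X.ringCatSheaf

/-- Sections of the structure sheaf, seen as a module, are regular functions. -/
def unitSection (U : X.Opens) : Γ(structureModule X, U) →ₗ[Γ(X, U)] Γ(X, U) where
  toFun s := s
  map_add' _ _ := rfl
  map_smul' _ _ := rfl

theorem app_map {M N : X.Modules} (f : M ⟶ N) {U V : X.Opens} (i : V ⟶ U) (s : Γ(M, U)) :
    f.app V (M.presheaf.map i.op s) = N.presheaf.map i.op (f.app U s) :=
  congr($(f.mapPresheaf.naturality i.op) s)

theorem map_map (M : X.Modules) {U V W : X.Opens} (i : V ⟶ U) (j : W ⟶ V) (s : Γ(M, U)) :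
    M.presheaf.map j.op (M.presheaf.map i.op s) = M.presheaf.map (j ≫ i).op s := by
  rw [op_comp, M.presheaf.map_comp]; rfl

theorem sum_app {M N : X.Modules} {ι : Type*} (t : Finset ι) (f : ι → (M ⟶ N))
    (U : X.Opens) (s : Γ(M, U)) :
    (∑ i ∈ t, f i).app U s = ∑ i ∈ t, (f i).app U s := by
  classical
  induction t using Finset.induction_on with
  | empty => simp
  | insert i t hi ih => rw [Finset.sum_insert hi, Finset.sum_insert hi, ← ih]; rfl

/-- The functor of sections over `U`. -/
def sectionsFunctor (U : X.Opens) : X.Modules ⥤ Ab :=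
  Scheme.Modules.toPresheaf X ⋙
    (show TopCat.Presheaf Ab X ⥤ Ab from (CategoryTheory.evaluation (Opens X)ᵒᵖ Ab).obj (op U))

instance (U : X.Opens) : PreservesFiniteLimits (sectionsFunctor U) :=
  letI : PreservesFiniteLimits
      (show TopCat.Presheaf Ab X ⥤ Ab from (CategoryTheory.evaluation (Opens X)ᵒᵖ Ab).obj (op U)) :=
    inferInstanceAs (PreservesFiniteLimits ((CategoryTheory.evaluation (Opens X)ᵒᵖ Ab).obj (op U)))
  comp_preservesFiniteLimits _ _

instance (U : X.Opens) : (sectionsFunctor U).PreservesZeroMorphisms := ⟨fun _ _ => rfl⟩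

theorem app_injective_of_mono {M N : X.Modules} (f : M ⟶ N) [Mono f] (U : X.Opens) :
    Function.Injective (f.app U) :=
  (AddCommGrpCat.mono_iff_injective _).1 (inferInstanceAs (Mono ((sectionsFunctor U).map f)))

theorem exists_of_exact {M N K : X.Modules} (f : M ⟶ N) (g : N ⟶ K) (w : f ≫ g = 0)
    (h : (ShortComplex.mk f g w).ShortExact) (U : X.Opens) (s : Γ(N, U)) (hs : g.app U s = 0) :
    ∃ t, f.app U t = s := by
  have := h.mono_f
  have h6 := h.exact.map_of_mono_of_preservesKernel (sectionsFunctor U) inferInstance inferInstance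
  exact (ShortComplex.ab_exact_iff _).1 h6 s hs

/-- The inclusion of a summand of the trivial bundle. -/
def coordι {r : ℕ} (i : Fin r) : structureModule X ⟶ trivialBundle X r := SheafOfModules.ιFree i

/-- The projection of the trivial bundle to a summand. -/
def coordπ {r : ℕ} (i : Fin r) : trivialBundle X r ⟶ structureModule X :=
  Cofan.IsColimit.desc (SheafOfModules.isColimitFreeCofan (R := X.ringCatSheaf) (Fin r))
    fun j => if j = i then 𝟙 _ else 0

theorem coordι_coordπ {r : ℕ} (i j : Fin r) :
    coordι (X := X) i ≫ coordπ j = if i = j then 𝟙 _ else 0 := by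
  exact Cofan.IsColimit.fac (SheafOfModules.isColimitFreeCofan (R := X.ringCatSheaf) (Fin r)) _ _

theorem sum_coordπ_coordι (r : ℕ) : ∑ i : Fin r, coordπ (X := X) i ≫ coordι i = 𝟙 _ := by
  refine Cofan.IsColimit.hom_ext (SheafOfModules.isColimitFreeCofan (R := X.ringCatSheaf) (Fin r))
    _ _ fun j => ?_
  have : coordι (X := X) j ≫ ∑ i : Fin r, coordπ (X := X) i ≫ coordι i = coordι j := by
    rw [Preadditive.comp_sum]
    simp_rw [← Category.assoc, coordι_coordπ]
    simp [ite_comp]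
  exact this.trans (Category.comp_id _).symm

/-- The morphism of sheaves of modules given by linear maps on sections that commute with the
restrictions. -/
def mkHom {M N : X.Modules} (f : ∀ U : X.Opens, Γ(M, U) →ₗ[Γ(X, U)] Γ(N, U))
    (hf : ∀ (U V : X.Opens) (h : V ≤ U) (s : Γ(M, U)),
      f V (M.presheaf.map (homOfLE h).op s) = N.presheaf.map (homOfLE h).op (f U s)) : M ⟶ N :=
  ⟨PresheafOfModules.homMk
    { app := fun U => AddCommGrpCat.ofHom (f U.unop).toAddMonoidHom
      naturality := fun U V i => by
        ext s
        exact hf U.unop V.unop i.unop.le s }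
    (fun U r m => (f U.unop).map_smul r m)⟩

theorem isIso_of_bijective {M N : X.Modules} (f : M ⟶ N)
    (h : ∀ U, Function.Bijective (f.app U)) : IsIso f :=
  Scheme.Modules.Hom.isIso_iff_isIso_app.2 fun U =>
    (ConcreteCategory.isIso_iff_bijective _).2 (h U)

theorem eq_of_locally_eq (M : X.Modules) {U : X.Opens} (s t : Γ(M, U))
    (h : ∀ x ∈ U, ∃ (V : X.Opens) (i : V ⟶ U), x ∈ V ∧
      M.presheaf.map i.op s = M.presheaf.map i.op t) : s = t := by
  choose V i hV e using fun x : U => h x.1 x.2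
  exact TopCat.Sheaf.eq_of_locally_eq' ⟨M.presheaf, M.isSheaf⟩ V U i
    (fun x hx => Opens.mem_iSup.2 ⟨⟨x, hx⟩, hV _⟩) s t e

theorem exists_glue (M : X.Modules) {ι : Type} (U : X.Opens) (V : ι → X.Opens) (hV : ∀ i, V i ≤ U)
    (hU : ∀ x ∈ U, ∃ i, x ∈ V i) (s : ∀ i, Γ(M, V i))
    (hs : ∀ i j, M.presheaf.map (homOfLE (inf_le_left : V i ⊓ V j ≤ V i)).op (s i) =
      M.presheaf.map (homOfLE (inf_le_right : V i ⊓ V j ≤ V j)).op (s j)) :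
    ∃ t : Γ(M, U), ∀ i, M.presheaf.map (homOfLE (hV i)).op t = s i := by
  obtain ⟨t, ht, -⟩ := TopCat.Sheaf.existsUnique_gluing' (C := Ab) ⟨M.presheaf, M.isSheaf⟩ V U
    (fun i => homOfLE (hV i)) (fun x hx => Opens.mem_iSup.2 (hU x hx)) s hs
  exact ⟨t, ht⟩

/-- Epimorphisms of sheaves of modules are locally surjective: the projection of the target to the
sheafified presheaf cokernel vanishes, and sheafification is locally injective. -/
theorem exists_preimage_of_epi {M N : X.Modules} (g : M ⟶ N) [Epi g] (U : X.Opens)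
    (s : Γ(N, U)) (x : X) (hx : x ∈ U) :
    ∃ (V : X.Opens) (i : V ⟶ U) (_ : x ∈ V) (t : Γ(M, V)), g.app V t = N.presheaf.map i.op s := by
  let P := cokernel g.val
  let α : X.ringCatSheaf.obj ⟶ X.ringCatSheaf.obj := 𝟙 _
  let F : X.Modules := (PresheafOfModules.sheafification α).obj P
  let η : P ⟶ F.val := (PresheafOfModules.sheafificationAdjunction α).unit.app P
  have hη : Presheaf.IsLocallyInjective (Opens.grothendieckTopology X)
      ((PresheafOfModules.toPresheaf _).map η) := by
    have : (PresheafOfModules.toPresheaf _).map η = CategoryTheory.toSheafify _ P.presheaf :=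
      PresheafOfModules.toPresheaf_map_sheafificationAdjunction_unit_app α P
    rw [this]
    exact Presheaf.isLocallyInjective_toSheafify' _ _
  let v : N ⟶ F := ⟨cokernel.π g.val ≫ η⟩
  have hv : v = 0 := by
    rw [← cancel_epi g, comp_zero]
    apply SheafOfModules.hom_ext
    change g.val ≫ cokernel.π g.val ≫ η = 0
    simp
  have h1 : (cokernel.π g.val ≫ η).app (op U) = 0 := by
    have : v.val = 0 := by rw [hv]; rfl
    have e : (cokernel.π g.val ≫ η) = 0 := this
    rw [e]; rfl
  let y : P.obj (op U) := (cokernel.π g.val).app (op U) s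
  have h2 : ((PresheafOfModules.toPresheaf _).map η).app (op U) y =
      ((PresheafOfModules.toPresheaf _).map η).app (op U) 0 := by
    rw [map_zero]
    exact congr($h1 s)
  have h3 := Presheaf.equalizerSieve_mem (Opens.grothendieckTopology X)
    ((PresheafOfModules.toPresheaf _).map η) (X := op U) y 0 h2
  obtain ⟨V, i, hV, hxV⟩ := h3 x hx
  have h4 : (cokernel.π g.val).app (op V) (N.presheaf.map i.op s) = 0 := by
    have := (congr($((cokernel.π g.val).naturality i.op) s))
    refine this.trans ?_
    refine Eq.trans hV ?_
    exact map_zero _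
  have h5 : (ShortComplex.mk g.val (cokernel.π g.val) (cokernel.condition _)).Exact :=
    ShortComplex.exact_cokernel _
  have h6 := h5.map_of_epi_of_preservesCokernel
    (PresheafOfModules.evaluation X.ringCatSheaf.obj (op V))
    (by dsimp; infer_instance) (by infer_instance)
  obtain ⟨t, ht⟩ := (ShortComplex.moduleCat_exact_iff _).1 h6 (N.presheaf.map i.op s) h4
  exact ⟨V, i, hxV, t, ht⟩
/-- A morphism of sheaves of modules that is bijective on small open subsets is an isomorphism. -/
theorem isIso_of_locally_bijective {M N : X.Modules} (f : M ⟶ N)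
    (h : ∀ x : X, ∃ U : X.Opens, x ∈ U ∧ ∀ V ≤ U, Function.Bijective (f.app V)) : IsIso f := by
  choose B hxB hB using h
  refine isIso_of_bijective f fun U => ?_
  have inj : ∀ U : X.Opens, Function.Injective (f.app U) := by
    intro U s t hst
    refine eq_of_locally_eq M s t fun x hx => ⟨U ⊓ B x, homOfLE inf_le_left, ⟨hx, hxB x⟩, ?_⟩
    refine (hB x _ inf_le_right).1 ?_
    rw [app_map, app_map, hst]
  refine ⟨inj U, fun t => ?_⟩
  choose s hs using fun x : X => (hB x (U ⊓ B x) inf_le_right).2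
    (N.presheaf.map (homOfLE inf_le_left).op t)
  obtain ⟨r, hr⟩ := exists_glue M U (fun x : X => U ⊓ B x) (fun _ => inf_le_left)
    (fun x hx => ⟨x, hx, hxB x⟩) s fun x y => inj _ (by
      rw [app_map, app_map, hs, hs, map_map, map_map]; rfl)
  refine ⟨r, eq_of_locally_eq N _ _ fun x hx =>
    ⟨U ⊓ B x, homOfLE inf_le_left, ⟨hx, hxB x⟩, ?_⟩⟩
  rw [← app_map, hr, hs]

/-- Sections of `E` over `U` that form a basis of the sections over all open subsets of `U`. -/
def IsLocalBasis (E : X.Modules) {U : X.Opens} {r : ℕ} (e : Fin r → Γ(E, U)) : Prop :=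
  ∀ (V : X.Opens) (h : V ≤ U), Function.Bijective fun c : Fin r → Γ(X, V) =>
    ∑ i, c i • E.presheaf.map (homOfLE h).op (e i)

/-- Locally, `E` has a basis of `r` sections. -/
def HasLocalBases (E : X.Modules) (r : ℕ) : Prop :=
  ∀ x : X, ∃ (U : X.Opens) (_ : x ∈ U) (e : Fin r → Γ(E, U)), IsLocalBasis E e

theorem app_bijective_of_isLocalBasis {M N : X.Modules} (f : M ⟶ N) {U : X.Opens} {r : ℕ}
    {e : Fin r → Γ(M, U)} (he : IsLocalBasis M e)
    (hfe : IsLocalBasis N fun i => f.app U (e i)) (V : X.Opens) (h : V ≤ U) :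
    Function.Bijective (f.app V) := by
  have e1 : (f.app V) ∘ (fun c : Fin r → Γ(X, V) =>
      ∑ i, c i • M.presheaf.map (homOfLE h).op (e i)) =
      fun c : Fin r → Γ(X, V) => ∑ i, c i • N.presheaf.map (homOfLE h).op (f.app U (e i)) := by
    funext c
    simp [map_sum, app_map]
  have := hfe V h
  rw [← e1] at this
  exact (Function.Bijective.of_comp_iff _ (he V h)).1 this

theorem coordπ_coordι_app {r : ℕ} (U : X.Opens) (c : Fin r → Γ(structureModule X, U)) (j : Fin r) :
    (coordπ j).app U (∑ i, (coordι i).app U (c i)) = c j := by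
  rw [map_sum, Finset.sum_eq_single j]
  · exact congr(($(coordι_coordπ (X := X) j j)).app U (c j)).trans (by simp)
  · intro i _ hij
    exact congr(($(coordι_coordπ (X := X) i j)).app U (c i)).trans (by simp [hij])
  · simp

theorem sum_coordι_coordπ_app {r : ℕ} (U : X.Opens) (s : Γ(trivialBundle X r, U)) :
    ∑ i, (coordι i).app U ((coordπ i).app U s) = s := by
  have := congr(($(sum_coordπ_coordι (X := X) r)).app U s)
  rw [sum_app] at this
  exact this

/-- The sections of the trivial bundle are the families of regular functions. -/
theorem sum_coordι_bijective {r : ℕ} (U : X.Opens) :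
    Function.Bijective fun c : Fin r → Γ(structureModule X, U) =>
      ∑ i, (coordι i).app U (c i) :=
  Function.bijective_iff_has_inverse.2 ⟨fun s j => (coordπ j).app U s,
    fun c => funext fun j => coordπ_coordι_app U c j, fun s => sum_coordι_coordπ_app U s⟩

/-- The images of the unit vectors under a local trivialization are a local basis. -/
theorem IsVectorBundleOfRank.hasLocalBases {E : X.Modules} {r : ℕ}
    (hE : IsVectorBundleOfRank E r) : HasLocalBases E r := by
  intro x
  obtain ⟨U, hx, ⟨φ⟩⟩ := hE x
  let Y := U.toScheme
  have φ' : trivialBundle Y r ≅ E.restrict U.ι := φ.symm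
  let ψ : trivialBundle Y r ⟶ E.restrict U.ι := φ'.hom
  let e : Fin r → Γ(E, U.ι ''ᵁ ⊤) := fun i =>
    ψ.app ⊤ ((coordι i).app ⊤ (show Γ(structureModule Y, ⊤) from (1 : Γ(Y, ⊤))))
  refine ⟨U.ι ''ᵁ ⊤, by simpa using hx, e, fun V h => ?_⟩
  obtain ⟨W, rfl⟩ : ∃ W : Y.Opens, V = U.ι ''ᵁ W := by
    refine ⟨U.ι ⁻¹ᵁ V, ?_⟩
    rw [Scheme.Hom.image_preimage_eq_opensRange_inf]
    simpa using h
  have h1 : Function.Bijective (ψ.app W) :=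
    (ConcreteCategory.isIso_iff_bijective _).1 inferInstance
  have h3 := h1.comp (sum_coordι_bijective (X := Y) (r := r) W)
  refine (congrArg Function.Bijective (funext fun c => ?_)).mpr h3
  refine Eq.trans ?_ (map_sum (ψ.app W).hom _ _).symm
  refine Finset.sum_congr rfl fun i _ => ?_
  let c' : Γ(Y, W) := c i
  have h4 : ψ.app W ((coordι i).app W (c' • (structureModule Y).presheaf.map
      (homOfLE (le_top : W ≤ ⊤)).op (show Γ(structureModule Y, ⊤) from (1 : Γ(Y, ⊤))))) =
      c' • ψ.app W ((coordι i).app W ((structureModule Y).presheaf.map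
      (homOfLE (le_top : W ≤ ⊤)).op (show Γ(structureModule Y, ⊤) from (1 : Γ(Y, ⊤))))) := by
    simp
  rw [app_map, app_map] at h4
  refine Eq.trans ?_ (h4.symm.trans ?_)
  · have : (U.ι.appIso W).inv c' = c i := by
      rw [Scheme.Opens.ι_appIso]; rfl
    exact congr($(this.symm) • _)
  · refine congr(ψ.app W ((coordι i).app W $(?_)))
    change c' * Y.presheaf.map _ 1 = c i
    rw [map_one]
    exact mul_one c'

section Dual

variable {E : X.Modules}

/-- The value of a section of the dual sheaf on a section of the sheaf. -/
def dualEval {U V : X.Opens} (h : V ≤ U) (φ : Γ(dual E, U)) : Γ(E, V) →ₗ[Γ(X, V)] Γ(X, V) :=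
  (show dualSections E U from φ).1 ⟨V, h⟩

theorem dualEval_map_map {U V W : X.Opens} (h : V ≤ U) (i : W ⟶ V) (φ : Γ(dual E, U))
    (s : Γ(E, V)) : dualEval (i.le.trans h) φ (E.presheaf.map i.op s) =
      X.presheaf.map i.op (dualEval h φ s) :=
  (show dualSections E U from φ).2 ⟨V, h⟩ ⟨W, i.le.trans h⟩ i.le s

theorem dualEval_map {U V W : X.Opens} (i : V ⟶ U) (h : W ≤ V) (φ : Γ(dual E, U)) :
    dualEval h ((dual E).presheaf.map i.op φ) = dualEval (h.trans i.le) φ := rfl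

theorem dualEval_add {U V : X.Opens} (h : V ≤ U) (φ ψ : Γ(dual E, U)) :
    dualEval h (φ + ψ) = dualEval h φ + dualEval h ψ := rfl

theorem dualEval_smul {U V : X.Opens} (h : V ≤ U) (r : Γ(X, U)) (φ : Γ(dual E, U)) :
    dualEval h (r • φ) = X.presheaf.map (homOfLE h).op r • dualEval h φ := rfl

theorem dualEval_sum {U V : X.Opens} (h : V ≤ U) {ι : Type*} (t : Finset ι)
    (φ : ι → Γ(dual E, U)) : dualEval h (∑ i ∈ t, φ i) = ∑ i ∈ t, dualEval h (φ i) := by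
  classical
  induction t using Finset.induction_on with
  | empty => rfl
  | insert i t hi ih => rw [Finset.sum_insert hi, Finset.sum_insert hi, dualEval_add, ih]

theorem dual_ext {U : X.Opens} {φ ψ : Γ(dual E, U)}
    (h : ∀ (V : X.Opens) (h : V ≤ U) (s : Γ(E, V)), dualEval h φ s = dualEval h ψ s) : φ = ψ :=
  Subtype.ext (funext fun V => LinearMap.ext (h V.1 V.2))

/-- The section of the dual sheaf defined by compatible linear maps. -/
def mkDual (U : X.Opens) (f : ∀ (V : X.Opens) (_ : V ≤ U), Γ(E, V) →ₗ[Γ(X, V)] Γ(X, V))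
    (hf : ∀ (V W : X.Opens) (h : V ≤ U) (i : W ⟶ V) (s : Γ(E, V)),
      f W (i.le.trans h) (E.presheaf.map i.op s) = X.presheaf.map i.op (f V h s)) :
    Γ(dual E, U) :=
  (⟨fun V => f V.1 V.2, fun V _ h s => hf V.1 _ V.2 (homOfLE h) s⟩ : dualSections E U)

/-- The dual of a local basis is a local basis of the dual sheaf. -/
theorem isLocalBasis_dual {U : X.Opens} {r : ℕ} {e : Fin r → Γ(E, U)} (he : IsLocalBasis E e)
    {f : Fin r → Γ(dual E, U)}
    (hf : ∀ i j, dualEval le_rfl (f i) (e j) = if i = j then 1 else 0) :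
    IsLocalBasis (dual E) f := by
  intro V h
  have key : ∀ (W : X.Opens) (hW : W ≤ U) i j,
      dualEval hW (f i) (E.presheaf.map (homOfLE hW).op (e j)) = if i = j then 1 else 0 := by
    intro W hW i j
    rw [dualEval_map_map le_rfl, hf]
    split_ifs <;> simp
  have ev : ∀ (c : Fin r → Γ(X, V)) j, dualEval le_rfl
      (∑ i, c i • (dual E).presheaf.map (homOfLE h).op (f i))
      (E.presheaf.map (homOfLE h).op (e j)) = c j := by
    intro c j
    simp only [dualEval_sum, dualEval_smul, dualEval_map, LinearMap.sum_apply,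
      LinearMap.smul_apply, key]
    simp
  refine ⟨fun c c' hc => funext fun j => ?_, fun φ => ⟨fun i => dualEval le_rfl φ
    (E.presheaf.map (homOfLE h).op (e i)), dual_ext fun W hW s => ?_⟩⟩
  · rw [← ev c, ← ev c']
    exact congr(dualEval le_rfl $hc _)
  · obtain ⟨a, rfl⟩ := (he W (hW.trans h)).2 s
    simp only [map_sum, _root_.map_smul, dualEval_sum, dualEval_smul, dualEval_map,
      LinearMap.sum_apply, LinearMap.smul_apply, key]
    refine Finset.sum_congr rfl fun i _ => ?_
    simp only [smul_eq_mul, mul_ite, mul_one, mul_zero, Finset.sum_ite_eq', Finset.mem_univ,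
      if_true]
    rw [← dualEval_map_map le_rfl (homOfLE hW), map_map]
    rfl

theorem exists_dual_basis {U : X.Opens} {r : ℕ} {e : Fin r → Γ(E, U)} (he : IsLocalBasis E e) :
    ∃ f : Fin r → Γ(dual E, U), ∀ i j, dualEval le_rfl (f i) (e j) = if i = j then 1 else 0 := by
  let c (V : X.Opens) (h : V ≤ U) : Γ(E, V) ≃ (Fin r → Γ(X, V)) :=
    (Equiv.ofBijective _ (he V h)).symm
  have hc : ∀ V h s, ∑ i, c V h s i • E.presheaf.map (homOfLE h).op (e i) = s := fun V h s =>
    (Equiv.ofBijective _ (he V h)).apply_symm_apply s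
  have hc' : ∀ V h (a : Fin r → Γ(X, V)) s, ∑ i, a i • E.presheaf.map (homOfLE h).op (e i) = s →
      c V h s = a := fun V h a s has => (Equiv.symm_apply_eq _).2 has.symm
  refine ⟨fun j => mkDual U (fun V h =>
    { toFun := fun s => c V h s j
      map_add' := fun s t => ?_
      map_smul' := fun a s => ?_ }) ?_, fun i j => ?_⟩
  · exact congrFun (hc' V h (c V h s + c V h t) _ (by
      simp [add_smul, Finset.sum_add_distrib, hc])) j
  · exact congrFun (hc' V h (a • c V h s) _ (by simp [mul_smul, ← Finset.smul_sum, hc])) j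
  · intro V W h i s
    refine congrFun (hc' W _ (fun j => X.presheaf.map i.op (c V h s j)) _ ?_) j
    conv_rhs => rw [← hc V h s]
    rw [map_sum]
    refine Finset.sum_congr rfl fun l _ => ?_
    rw [Scheme.Modules.map_smul, map_map]
    rfl
  · refine congrFun (hc' U le_rfl (fun i => if i = j then 1 else 0) (e j) ?_) i
    simp only [ite_smul, one_smul, zero_smul, Finset.sum_ite_eq', Finset.mem_univ, if_true]
    change E.presheaf.map (𝟙 _) _ = _
    simp

theorem map_refl (M : X.Modules) {U : X.Opens} (i : U ⟶ U) (s : Γ(M, U)) :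
    M.presheaf.map i.op s = s := by
  change M.presheaf.map (𝟙 _) s = s
  rw [M.presheaf.map_id]
  rfl

/-- Evaluation of sections of the dual sheaf at a section. -/
def evalSection {V : X.Opens} (s : Γ(E, V)) : Γ(dual E, V) →ₗ[Γ(X, V)] Γ(X, V) where
  toFun φ := dualEval le_rfl φ s
  map_add' φ ψ := by rw [dualEval_add, LinearMap.add_apply]
  map_smul' a φ := by
    rw [dualEval_smul, LinearMap.smul_apply]
    congr 1
    exact congr(($(X.presheaf.map_id (op V))) a)

theorem evalSection_apply {V : X.Opens} (s : Γ(E, V)) (φ : Γ(dual E, V)) :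
    evalSection s φ = dualEval le_rfl φ s := rfl

/-- The section of the double dual defined by a section. -/
def doubleDualSection {U : X.Opens} (s : Γ(E, U)) : Γ(dual (dual E), U) :=
  mkDual U (fun V h => evalSection (E.presheaf.map (homOfLE h).op s)) fun V W h i φ => by
    rw [evalSection_apply, evalSection_apply, ← dualEval_map_map, map_map]
    rfl

theorem dualEval_doubleDualSection {U : X.Opens} (s : Γ(E, U)) {V : X.Opens} (h : V ≤ U)
    (φ : Γ(dual E, V)) : dualEval h (doubleDualSection s) φ =
      dualEval le_rfl φ (E.presheaf.map (homOfLE h).op s) := rfl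

variable (E) in
/-- The evaluation morphism from a sheaf of modules to its double dual. -/
def toDoubleDual : E ⟶ dual (dual E) :=
  mkHom (fun U =>
    { toFun := doubleDualSection
      map_add' := fun s t => dual_ext fun V h φ => by
        simp only [dualEval_add, dualEval_doubleDualSection, map_add, LinearMap.add_apply]
      map_smul' := fun a s => dual_ext fun V h φ => by
        simp only [dualEval_smul, dualEval_doubleDualSection, Scheme.Modules.map_smul,
          _root_.map_smul, RingHom.id_apply, LinearMap.smul_apply] }) fun U V h s =>
    dual_ext fun W hW φ => by
      rw [dualEval_map]
      refine (dualEval_doubleDualSection _ hW φ).trans ?_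
      rw [map_map]
      rfl

theorem dualEval_toDoubleDual {U : X.Opens} (s : Γ(E, U)) {V : X.Opens} (h : V ≤ U)
    (φ : Γ(dual E, V)) : dualEval h ((toDoubleDual E).app U s) φ =
      dualEval le_rfl φ (E.presheaf.map (homOfLE h).op s) := rfl

/-- Vector bundles are reflexive. -/
theorem isIso_toDoubleDual {r : ℕ} (hE : HasLocalBases E r) : IsIso (toDoubleDual E) := by
  refine isIso_of_locally_bijective _ fun x => ?_
  obtain ⟨U, hx, e, he⟩ := hE x
  obtain ⟨f, hf⟩ := exists_dual_basis he
  refine ⟨U, hx, app_bijective_of_isLocalBasis _ he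
    (isLocalBasis_dual (isLocalBasis_dual he hf) fun i j => ?_)⟩
  rw [dualEval_toDoubleDual]
  rw [map_refl, hf]
  exact if_congr eq_comm rfl rfl

/-- The transpose of a morphism. -/
def dualMap {E E' : X.Modules} (f : E ⟶ E') : dual E' ⟶ dual E :=
  mkHom (fun U =>
    { toFun := fun φ => mkDual U (fun V h =>
        { toFun := fun s => dualEval h φ (f.app V s)
          map_add' := fun _ _ => by simp
          map_smul' := fun a s => by simp }) fun V W h i s => by
              simp only [LinearMap.coe_mk, AddHom.coe_mk]
              rw [← dualEval_map_map, app_map]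
      map_add' := fun s t => rfl
      map_smul' := fun a s => rfl }) fun U V h s => rfl

/-- Isomorphic sheaves have isomorphic duals. -/
def dualIso {E E' : X.Modules} (f : E ≅ E') : dual E' ≅ dual E where
  hom := dualMap f.hom
  inv := dualMap f.inv
  hom_inv_id := by
    ext U φ
    refine dual_ext fun V h s => ?_
    exact congr(dualEval h φ (($(f.inv_hom_id)).app V s))
  inv_hom_id := by
    ext U φ
    refine dual_ext fun V h s => ?_
    exact congr(dualEval h φ (($(f.hom_inv_id)).app V s))

/-- Vector bundles with isomorphic duals are isomorphic. -/
theorem nonempty_iso_of_dual {E E' : X.Modules} {r r' : ℕ} (hE : HasLocalBases E r)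
    (hE' : HasLocalBases E' r') (f : dual E ≅ dual E') : Nonempty (E ≅ E') := by
  have := isIso_toDoubleDual hE
  have := isIso_toDoubleDual hE'
  exact ⟨asIso (toDoubleDual E) ≪≫ dualIso f.symm ≪≫ (asIso (toDoubleDual E')).symm⟩

end Dual
end SheavesOfModules

/-! ### Sheaves presented as kernels of matrices of linear forms -/

section Presentation

variable {n : ℕ}

/-- The inclusion of the homogeneous coordinate ring in its field of fractions. -/
abbrev toFrac (n : ℕ) : Pol n →+* Frac n := algebraMap (Pol n) (Frac n)

theorem toFrac_injective : Function.Injective (toFrac n) := IsFractionRing.injective _ _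

/-- `E` is the kernel of the matrix `A`, seen as a map of sheaves: there are coordinate morphisms
`E ⟶ 𝒪` that identify the sections of `E` with the vectors of regular functions annihilated
by `A`. -/
structure Presentation (E : (PSpace n).Modules) {k m : ℕ}
    (A : Matrix (Fin k) (Fin m) (Pol n)) where
  /-- The coordinate morphisms. -/
  hom : Fin m → (E ⟶ structureModule (PSpace n))
  ext' : ∀ (U : (PSpace n).Opens) (s t : Γ(E, U)),
    (∀ i, (hom i).app U s = (hom i).app U t) → s = t
  relation' : ∀ (U : (PSpace n).Opens) (s : Γ(E, U)) (x : U) (j : Fin k),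
    ∑ i, toFrac n (A j i) * ratAt x (unitSection U ((hom i).app U s)) = 0
  exists' : ∀ (U : (PSpace n).Opens) (c : Fin m → Γ(PSpace n, U)),
    (∀ (x : U) (j : Fin k), ∑ i, toFrac n (A j i) * ratAt x (c i) = 0) →
      ∃ s : Γ(E, U), ∀ i, unitSection U ((hom i).app U s) = c i

/-- The matrix has maximal rank at every point of projective space: locally it has a right inverse,
whose entries are homogeneous fractions. -/
def Nondegenerate {k m : ℕ} (A : Matrix (Fin k) (Fin m) (Pol n)) : Prop :=
  ∀ x : PTop n, ∃ (d : ℕ) (B : Matrix (Fin m) (Fin k) (Pol n)) (b : Pol n),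
    (∀ i j, B i j ∈ grading n d) ∧ b ∈ grading n (d + 1) ∧ b ∉ pointIdeal x ∧
      A * B = b • (1 : Matrix (Fin k) (Fin k) (Pol n))

namespace Presentation

variable {E E' : (PSpace n).Modules} {k m : ℕ} {A : Matrix (Fin k) (Fin m) (Pol n)}
  (P : Presentation E A)

/-- The coordinates of a section. -/
def coord (U : (PSpace n).Opens) (i : Fin m) : Γ(E, U) →ₗ[Γ(PSpace n, U)] Γ(PSpace n, U) where
  toFun s := unitSection U ((P.hom i).app U s)
  map_add' s t := by rw [map_add, map_add]
  map_smul' r s := by rw [Scheme.Modules.Hom.app_smul, _root_.map_smul]; rfl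

variable {U V : (PSpace n).Opens}

theorem coord_map (i : V ⟶ U) (s : Γ(E, U)) (j : Fin m) :
    P.coord V j (E.presheaf.map i.op s) = (PSpace n).presheaf.map i.op (P.coord U j s) :=
  congrArg (unitSection V) (app_map (P.hom j) i s)

theorem ext {s t : Γ(E, U)} (h : ∀ i, P.coord U i s = P.coord U i t) : s = t :=
  P.ext' U s t h

theorem relation (s : Γ(E, U)) (x : U) (j : Fin k) :
    ∑ i, toFrac n (A j i) * ratAt x (P.coord U i s) = 0 := P.relation' U s x j

theorem exists_coord (c : Fin m → Γ(PSpace n, U))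
    (h : ∀ (x : U) (j : Fin k), ∑ i, toFrac n (A j i) * ratAt x (c i) = 0) :
    ∃ s : Γ(E, U), ∀ i, P.coord U i s = c i := P.exists' U c h

/-- Elements of the field of fractions that satisfy the relations and are regular on `U` are the
coordinates of a section. -/
theorem exists_ratAt_coord (z : Fin m → Frac n) (hz : ∀ i, ∀ x ∈ U, IsRegularAt 0 x (z i))
    (h : ∀ j, ∑ i, toFrac n (A j i) * z i = 0) :
    ∃ s : Γ(E, U), ∀ i (x : U), ratAt x (P.coord U i s) = z i := by
  choose c hc using fun i => exists_section (U := U) (z := z i) fun x => hz i x.1 x.2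
  obtain ⟨s, hs⟩ := P.exists_coord c fun x j => by simp [hc, h]
  exact ⟨s, fun i x => by rw [hs, hc]⟩

/-- A matrix determines the sheaf that it presents. -/
theorem nonempty_iso (P : Presentation E A) (P' : Presentation E' A) : Nonempty (E ≅ E') := by
  have key : ∀ (U : (PSpace n).Opens) (s : Γ(E, U)), ∃ t : Γ(E', U), ∀ i,
      P'.coord U i t = P.coord U i s := fun U s => P'.exists_coord _ fun x j => P.relation s x j
  choose f hf using key
  let F : E ⟶ E' := mkHom (fun U =>
    { toFun := f U
      map_add' := fun s t => P'.ext fun i => by simp [hf]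
      map_smul' := fun r s => P'.ext fun i => by simp [hf] }) fun U V h s =>
        P'.ext fun i => by
          rw [coord_map]
          change P'.coord V i (f V _) = _
          rw [hf, coord_map]
          exact congrArg _ (hf U s i).symm
  have : IsIso F := isIso_of_bijective F fun U => ⟨fun s t h => P.ext fun i => by
    rw [← hf U s, ← hf U t]
    exact congrArg _ h, fun t => by
      obtain ⟨s, hs⟩ := P.exists_coord _ fun x j => P'.relation t x j
      exact ⟨s, P'.ext fun i => (hf U s i).trans (hs i)⟩⟩
  exact ⟨asIso F⟩

/-- Transport of a presentation along an isomorphism. -/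
def ofIso (e : E' ≅ E) : Presentation E' A where
  hom i := e.hom ≫ P.hom i
  ext' U s t h := by
    have h1 : e.hom.app U s = e.hom.app U t := P.ext' U _ _ h
    have h2 := ((ConcreteCategory.isIso_iff_bijective (e.hom.app U)).1 inferInstance).1
    exact h2 h1
  relation' U s x j := P.relation' U _ x j
  exists' U c hc := by
    obtain ⟨s, hs⟩ := P.exists' U c hc
    obtain ⟨t, rfl⟩ := ((ConcreteCategory.isIso_iff_bijective (e.hom.app U)).1 inferInstance).2 s
    exact ⟨t, hs⟩

end Presentation

end Presentation

section CommonDenominator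

variable {n : ℕ}

/-- Finitely many fractions regular at a point have a common denominator. -/
theorem exists_common_denominator {ι : Type*} [Fintype ι] {d : ℕ} {x : PTop n} {z : ι → Frac n}
    (hz : ∀ i, IsRegularAt d x (z i)) :
    ∃ (e : ℕ) (a : ι → Pol n) (b : Pol n), (∀ i, a i ∈ grading n (e + d)) ∧ b ∈ grading n e ∧
      b ∉ pointIdeal x ∧ ∀ i, z i * toFrac n b = toFrac n (a i) := by
  classical
  choose e a ha b hb hbx h using hz
  refine ⟨∑ i, e i, fun i => a i * ∏ j ∈ Finset.univ.erase i, b j, ∏ i, b i, fun i => ?_,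
    SetLike.prod_mem_graded _ _ _ fun i _ => hb i, fun hm => ?_, fun i => ?_⟩
  · rw [← Finset.add_sum_erase _ _ (Finset.mem_univ i), add_right_comm]
    exact SetLike.mul_mem_graded (ha i) (SetLike.prod_mem_graded _ _ _ fun j _ => hb j)
  · obtain ⟨i, -, hi⟩ := (Ideal.IsPrime.prod_mem_iff (p := pointIdeal x)).1 hm
    exact hbx i hi
  · rw [← Finset.mul_prod_erase _ _ (Finset.mem_univ i), map_mul, map_mul, ← h, mul_assoc]

end CommonDenominator

section Twist

variable {n : ℕ}

/-- The element of the field of fractions defined by a section of `𝒪(1)`. -/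
def twistAt {U : (PSpace n).Opens} (x : U) : Γ(twist n, U) →+ Frac n where
  toFun s := locToFrac x.1 ((show functionSections (twistPredicate_isLinear n) U from s).1 x)
  map_zero' := map_zero (locToFrac x.1)
  map_add' _ _ := map_add (locToFrac x.1) _ _

theorem twistAt_map {U V : (PSpace n).Opens} (i : V ⟶ U) (s : Γ(twist n, U)) (x : V) :
    twistAt x ((twist n).presheaf.map i.op s) = twistAt (i x) s := rfl

theorem twistAt_smul {U : (PSpace n).Opens} (x : U) (r : Γ(PSpace n, U)) (s : Γ(twist n, U)) :
    twistAt x (r • s) = ratAt x r * twistAt x s := by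
  refine Eq.trans ?_ (map_mul (locToFrac x.1)
    (algebraMap (PStalk x.1) (Localization.AtPrime (pointIdeal x.1)) (evalAt r x)) _)
  exact congrArg (locToFrac x.1) (Algebra.smul_def (evalAt r x)
    ((show functionSections (twistPredicate_isLinear n) U from s).1 x))

theorem twist_ext {U : (PSpace n).Opens} {s t : Γ(twist n, U)}
    (h : ∀ x : U, twistAt x s = twistAt x t) : s = t :=
  Subtype.ext (funext fun x => locToFrac_injective x.1 (h x))

theorem exists_twist_fraction {U : (PSpace n).Opens} (s : Γ(twist n, U)) (x : U) :
    ∃ (V : (PSpace n).Opens) (_ : x.1 ∈ V) (i : V ⟶ U) (d : ℕ) (a : grading n (d + 1))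
      (b : grading n d), ∀ y : V, (b : Pol n) ∉ pointIdeal y.1 ∧
        twistAt (i y) s * toFrac n b = toFrac n a := by
  obtain ⟨V, hV, i, d, a, b, h⟩ :=
    (show functionSections (twistPredicate_isLinear n) U from s).2 x
  refine ⟨V, hV, i, d, a, b, fun y => ⟨(h y).1, ?_⟩⟩
  obtain ⟨hb, e⟩ := h y
  exact (congrArg (locToFrac y.1 · * toFrac n b) e).trans (locToFrac_mk y.1 _ ⟨_, hb⟩)

theorem twistAt_isRegularAt {U : (PSpace n).Opens} (s : Γ(twist n, U)) (x : U) :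
    IsRegularAt 1 x.1 (twistAt x s) := by
  obtain ⟨V, hV, i, d, a, b, h⟩ := exists_twist_fraction s x
  exact ⟨d, a, a.2, b, b.2, (h ⟨x, hV⟩).1, (h ⟨x, hV⟩).2⟩

theorem twistAt_eq {U : (PSpace n).Opens} (s : Γ(twist n, U)) (x y : U) :
    twistAt x s = twistAt y s := by
  have key : ∀ x : U, twistAt x s = twistAt ⟨genericPt n, genericPt_mem x.2⟩ s := fun x => by
    obtain ⟨V, hV, i, d, a, b, h⟩ := exists_twist_fraction s x
    have h1 := h ⟨x, hV⟩
    have h2 := h ⟨genericPt n, genericPt_mem hV⟩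
    exact mul_right_cancel₀ (algebraMap_ne_zero_of_notMem h1.1) (h1.2.trans h2.2.symm)
  exact (key x).trans (key y).symm

/-- A linear form is a global section of `𝒪(1)`. -/
def twistOfLinear (f : grading n 1) : Γ(twist n, ⊤) :=
  (⟨fun _ => Localization.mk f.1 1, fun _ => ⟨⊤, trivial, 𝟙 _, 0, f, ⟨1, SetLike.one_mem_graded _⟩,
    fun _ => ⟨(Ideal.ne_top_iff_one _).1 (Ideal.IsPrime.ne_top inferInstance), rfl⟩⟩⟩ :
    functionSections (twistPredicate_isLinear n) ⊤)

theorem twistAt_twistOfLinear (f : grading n 1) (x : (⊤ : (PSpace n).Opens)) :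
    twistAt x (twistOfLinear f) = toFrac n f := by
  have := locToFrac_mk x.1 f.1 1
  simp only [OneMemClass.coe_one, map_one, mul_one] at this
  exact this

end Twist

/-! ### The matrix of a Steiner bundle -/

section Unit

variable {X : Scheme.{0}}

/-- A regular function as a section of the structure sheaf seen as a module. -/
def sectionOfFunction {U : X.Opens} (c : Γ(X, U)) : Γ(structureModule X, U) := c

theorem unit_hom_app {M : X.Modules} (h : structureModule X ⟶ M) (U : X.Opens)
    (c : Γ(structureModule X, U)) : h.app U c = unitSection U c •
      M.presheaf.map (homOfLE (le_top : U ≤ ⊤)).op (h.app ⊤ (sectionOfFunction 1)) := by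
  rw [← app_map, ← Scheme.Modules.Hom.app_smul]
  congr 1
  change c = unitSection U c * X.presheaf.map _ 1
  rw [map_one]
  exact (mul_one (unitSection U c)).symm

end Unit

section Matrix

variable {n k m : ℕ} (g : trivialBundle (PSpace n) m ⟶ ⨁ fun _ : Fin k => twist n)

/-- The entries of a map from a trivial bundle to a sum of copies of `𝒪(1)`, as global sections
of `𝒪(1)`. -/
def entrySection (j : Fin k) (i : Fin m) : Γ(twist n, ⊤) :=
  (coordι i ≫ g ≫ biproduct.π _ j).app ⊤ (sectionOfFunction 1)

theorem twistAt_app {U : (PSpace n).Opens} (x : U)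
    (c : Fin m → Γ(structureModule (PSpace n), U)) (j : Fin k) :
    twistAt x ((biproduct.π (fun _ : Fin k => twist n) j).app U
      (g.app U (∑ i, (coordι i).app U (c i)))) =
      ∑ i, ratAt x (unitSection U (c i)) *
        twistAt (⟨x.1, trivial⟩ : (⊤ : (PSpace n).Opens)) (entrySection g j i) := by
  rw [map_sum, map_sum, map_sum]
  refine Finset.sum_congr rfl fun i _ => ?_
  refine (congrArg (twistAt x) (unit_hom_app (coordι i ≫ g ≫ biproduct.π _ j) U (c i))).trans ?_
  rw [twistAt_smul]
  rfl

theorem biproduct_ext {X : Scheme.{0}} {M : Fin k → X.Modules} {U : X.Opens} {s t : Γ(⨁ M, U)}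
    (h : ∀ j, (biproduct.π M j).app U s = (biproduct.π M j).app U t) : s = t := by
  have key : ∀ s : Γ(⨁ M, U), ∑ j, (biproduct.ι M j).app U ((biproduct.π M j).app U s) = s := by
    intro s
    have := congr(($(biproduct.total (f := M))).app U s)
    rw [sum_app] at this
    exact this
  rw [← key s, ← key t]
  simp [h]

theorem exists_matrix (hn : 1 ≤ n) : ∃ A : Matrix (Fin k) (Fin m) (Pol n),
    (∀ j i, A j i ∈ grading n 1) ∧
    ∀ (j : Fin k) (i : Fin m) (x : (⊤ : (PSpace n).Opens)),
      twistAt x (entrySection g j i) = toFrac n (A j i) := by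
  have key : ∀ (j : Fin k) (i : Fin m), ∃ f ∈ grading n 1, toFrac n f =
      twistAt (⟨genericPt n, trivial⟩ : (⊤ : (PSpace n).Opens)) (entrySection g j i) := fun j i =>
    exists_polynomial_of_isRegularAt hn fun x => by
      rw [twistAt_eq _ _ (⟨x, trivial⟩ : (⊤ : (PSpace n).Opens))]
      exact twistAt_isRegularAt _ (⟨x, trivial⟩ : (⊤ : (PSpace n).Opens))
  choose A hA h using key
  exact ⟨A, hA, fun j i x => (twistAt_eq _ _ _).trans (h j i).symm⟩

/-- An epimorphism to a sum of copies of `𝒪(1)` has a matrix of maximal rank. -/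
theorem nondegenerate_of_epi [Epi g] {A : Matrix (Fin k) (Fin m) (Pol n)}
    (hA : ∀ (j : Fin k) (i : Fin m) (x : (⊤ : (PSpace n).Opens)),
      twistAt x (entrySection g j i) = toFrac n (A j i)) : Nondegenerate A := by
  intro x
  obtain ⟨i₀, hi₀⟩ := exists_X_notMem x
  have hX : (MvPolynomial.X i₀ : Pol n) ∈ grading n 1 := MvPolynomial.isHomogeneous_X ℂ i₀
  -- near `x`, the vectors `X i₀ • e j` are in the image of `g`
  have key : ∀ j : Fin k, ∃ z : Fin m → Frac n, (∀ i, IsRegularAt 0 x (z i)) ∧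
      ∀ j', ∑ i, toFrac n (A j' i) * z i = if j = j' then toFrac n (MvPolynomial.X i₀) else 0 := by
    intro j
    obtain ⟨V, i, hxV, t, ht⟩ := exists_preimage_of_epi g ⊤
      ((biproduct.ι (fun _ : Fin k => twist n) j).app ⊤ (twistOfLinear ⟨_, hX⟩)) x trivial
    refine ⟨fun l => ratAt ⟨x, hxV⟩ (unitSection V ((coordπ l).app V t)),
      fun l => ratAt_isRegularAt (⟨x, hxV⟩ : V) _, fun j' => ?_⟩
    have h1 := twistAt_app g ⟨x, hxV⟩ (fun l => (coordπ l).app V t) j'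
    rw [sum_coordι_coordπ_app, ht, app_map, twistAt_map] at h1
    simp_rw [hA] at h1
    simp_rw [mul_comm (toFrac n (A j' _))]
    rw [← h1]
    by_cases hj : j = j'
    · subst hj
      rw [if_pos rfl, ← twistAt_twistOfLinear ⟨_, hX⟩ (i ⟨x, hxV⟩)]
      exact congr(twistAt _ (($(biproduct.ι_π_self (fun _ : Fin k => twist n) j)).app ⊤ _))
    · rw [if_neg hj]
      exact (congr(twistAt (i ⟨x, hxV⟩) (($(biproduct.ι_π_ne (fun _ : Fin k => twist n) hj)).app ⊤
        (twistOfLinear ⟨_, hX⟩)))).trans (map_zero _)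
  choose z hz h using key
  obtain ⟨d, a, b, ha, hb, hbx, hab⟩ := exists_common_denominator
    (z := fun p : Fin m × Fin k => z p.2 p.1) fun p => hz p.2 p.1
  refine ⟨d, Matrix.of fun i j => a (i, j), b * MvPolynomial.X i₀, fun i j => ha (i, j),
    SetLike.mul_mem_graded hb hX, mul_notMem hbx hi₀, ?_⟩
  ext1 j' j
  refine toFrac_injective ?_
  rw [Matrix.mul_apply, map_sum, Matrix.smul_apply, Matrix.one_apply]
  simp_rw [Matrix.of_apply, map_mul, ← hab, ← mul_assoc]
  rw [← Finset.sum_mul, h]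
  by_cases hj : j' = j
  · simp [hj, mul_comm]
  · simp [hj, Ne.symm hj]

/-- The kernel of a map from a trivial bundle to a sum of copies of `𝒪(1)` is presented by the
matrix of the map. -/
def presentationOfExact {E : (PSpace n).Modules} (f : E ⟶ trivialBundle (PSpace n) m)
    (w : f ≫ g = 0) (hfg : (ShortComplex.mk f g w).ShortExact)
    {A : Matrix (Fin k) (Fin m) (Pol n)}
    (hA : ∀ (j : Fin k) (i : Fin m) (x : (⊤ : (PSpace n).Opens)),
      twistAt x (entrySection g j i) = toFrac n (A j i)) : Presentation E A where
  hom i := f ≫ coordπ i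
  ext' U s t h := by
    have := hfg.mono_f
    refine app_injective_of_mono f U ?_
    rw [← sum_coordι_coordπ_app U (f.app U s), ← sum_coordι_coordπ_app U (f.app U t)]
    exact Finset.sum_congr rfl fun i _ => congrArg _ (h i)
  relation' U s x j := by
    have h1 := twistAt_app g x (fun l => (coordπ l).app U (f.app U s)) j
    rw [sum_coordι_coordπ_app] at h1
    have h2 : g.app U (f.app U s) = 0 := congr(($w).app U s)
    rw [h2, map_zero, map_zero] at h1
    rw [h1]
    refine Finset.sum_congr rfl fun i _ => ?_
    rw [hA, mul_comm]
    rfl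
  exists' U c h := by
    obtain ⟨t, ht⟩ := exists_of_exact f g w hfg U
      (∑ i, (coordι i).app U (sectionOfFunction (c i))) (biproduct_ext fun j =>
        twist_ext fun x => by
          rw [twistAt_app, map_zero, map_zero, ← h x j]
          refine Finset.sum_congr rfl fun i _ => ?_
          rw [hA, mul_comm]
          rfl)
    refine ⟨t, fun i => ?_⟩
    change unitSection U ((coordπ i).app U (f.app U t)) = c i
    rw [ht, coordπ_coordι_app]
    rfl

end Matrix

/-- The dual of a Steiner bundle is the kernel of a matrix of linear forms, of maximal rank at every
point. -/
theorem IsSteiner.exists_presentation {n k : ℕ} (hn : 1 ≤ n) {S : (PSpace n).Modules}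
    (hS : IsSteiner k S) : ∃ A : Matrix (Fin k) (Fin (n + k)) (Pol n),
      (∀ j i, A j i ∈ grading n 1) ∧ Nondegenerate A ∧ Nonempty (Presentation (dual S) A) := by
  obtain ⟨f, g, w, h⟩ := hS.exact
  obtain ⟨A, hA, hgA⟩ := exists_matrix g hn
  have := h.epi_g
  exact ⟨A, hA, nondegenerate_of_epi g hgA, ⟨presentationOfExact g f w h hgA⟩⟩

/-! ### Closed points and the pencil of a matrix of linear forms -/

section ClosedPoints

variable {n : ℕ}

/-- Restriction of polynomials to the line through the origin and `p`. -/
def restrictLine (p : Fin (n + 1) → ℂ) : Pol n →ₐ[ℂ] Polynomial ℂ :=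
  MvPolynomial.aeval fun i => Polynomial.C (p i) * Polynomial.X

theorem restrictLine_of_mem (p : Fin (n + 1) → ℂ) {d : ℕ} {f : Pol n} (hf : f ∈ grading n d) :
    restrictLine p f = Polynomial.C (MvPolynomial.eval p f) * Polynomial.X ^ d := by
  rw [restrictLine, MvPolynomial.aeval_def, MvPolynomial.eval₂_eq, MvPolynomial.eval_eq, map_sum,
    Finset.sum_mul]
  refine Finset.sum_congr rfl fun m hm => ?_
  have hd : ∑ i ∈ m.support, m i = d := by
    have := hf (MvPolynomial.mem_support_iff.1 hm)
    rw [Finsupp.weight_apply, Finsupp.sum] at this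
    simpa using this
  rw [map_mul, map_prod, mul_assoc, ← hd, ← Finset.prod_pow_eq_pow_sum, ← Finset.prod_mul_distrib]
  simp_rw [mul_pow, map_pow]
  rfl

/-- The polynomials vanishing on a line through the origin form a homogeneous ideal. -/
theorem ker_restrictLine_isHomogeneous (p : Fin (n + 1) → ℂ) :
    (RingHom.ker (restrictLine p)).IsHomogeneous (grading n) := by
  intro d f hf
  have h1 : restrictLine p f = 0 := hf
  rw [RingHom.mem_ker]
  have h2 : f = ∑ i ∈ Finset.range (f.totalDegree + 1), MvPolynomial.homogeneousComponent i f :=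
    (MvPolynomial.sum_homogeneousComponent f).symm
  have h3 : ∀ i, restrictLine p (MvPolynomial.homogeneousComponent i f) =
      Polynomial.C (MvPolynomial.eval p (MvPolynomial.homogeneousComponent i f)) *
        Polynomial.X ^ i := fun i =>
    restrictLine_of_mem p (MvPolynomial.homogeneousComponent_isHomogeneous i f)
  have h4 : ((DirectSum.decompose (grading n) f d : grading n d) : Pol n) =
      MvPolynomial.homogeneousComponent d f :=
    MvPolynomial.decomposition.decompose'_apply f d
  rw [h4, h3]
  by_cases hd : d ∈ Finset.range (f.totalDegree + 1)
  · have h5 : (restrictLine p f).coeff d =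
        MvPolynomial.eval p (MvPolynomial.homogeneousComponent d f) := by
      conv_lhs => rw [h2]
      rw [map_sum, Polynomial.finsetSum_coeff]
      simp_rw [h3, Polynomial.coeff_C_mul_X_pow]
      simp at hd ⊢
      omega
    rw [← h5, h1]
    simp
  · rw [MvPolynomial.homogeneousComponent_eq_zero _ _ (by simpa using hd)]
    simp

theorem exists_coord_ne_zero {p : Fin (n + 1) → ℂ} (hp : p ≠ 0) : ∃ i, p i ≠ 0 := by
  by_contra! h
  exact hp (funext h)

/-- The closed point with homogeneous coordinates `p`. -/
def closedPt (p : Fin (n + 1) → ℂ) (hp : p ≠ 0) : PTop n :=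
  pointOfIdeal (RingHom.ker (restrictLine p)) (ker_restrictLine_isHomogeneous p)
    (RingHom.ker_isPrime _) (exists_coord_ne_zero hp).choose (by
      rw [RingHom.mem_ker, restrictLine, MvPolynomial.aeval_X]
      simpa using (exists_coord_ne_zero hp).choose_spec)

theorem mem_pointIdeal_closedPt {p : Fin (n + 1) → ℂ} {hp : p ≠ 0} {d : ℕ} {f : Pol n}
    (hf : f ∈ grading n d) :
    f ∈ pointIdeal (closedPt p hp) ↔ MvPolynomial.eval p f = 0 := by
  rw [closedPt, pointIdeal_pointOfIdeal, RingHom.mem_ker, restrictLine_of_mem p hf]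
  simp

theorem mem_span_X {f : Pol n} (hf : f ∈ grading n 1) :
    f ∈ Submodule.span ℂ (Set.range (MvPolynomial.X : Fin (n + 1) → Pol n)) := by
  rw [← MvPolynomial.homogeneousSubmodule_one_eq_span_X]
  exact hf

/-- A linear form as a linear functional. -/
def evalLinear (n : ℕ) : grading n 1 →ₗ[ℂ] Module.Dual ℂ (Fin (n + 1) → ℂ) where
  toFun f :=
    { toFun := fun p => MvPolynomial.eval p f.1
      map_add' := fun p q => by
        have hf := mem_span_X f.2
        generalize f.1 = f at hf
        induction hf using Submodule.span_induction with
        | mem f hf => obtain ⟨i, rfl⟩ := hf; simp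
        | zero => simp
        | add f g _ _ hf hg => simp only [map_add, hf, hg]; ring
        | smul c f _ hf => simp only [MvPolynomial.smul_eval, hf]; ring
      map_smul' := fun a p => by
        have hf := mem_span_X f.2
        generalize f.1 = f at hf
        induction hf using Submodule.span_induction with
        | mem f hf => obtain ⟨i, rfl⟩ := hf; simp
        | zero => simp
        | add f g _ _ hf hg => simp only [map_add, hf, hg, smul_add]
        | smul c f _ hf =>
          simp only [MvPolynomial.smul_eval, hf, smul_eq_mul, RingHom.id_apply]; ring }
  map_add' f g := by ext; simp
  map_smul' c f := by ext; simp

theorem evalLinear_apply (f : grading n 1) (p : Fin (n + 1) → ℂ) :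
    evalLinear n f p = MvPolynomial.eval p f.1 := rfl

theorem evalLinear_injective : Function.Injective (evalLinear n) := by
  intro f g h
  exact Subtype.ext (MvPolynomial.funext fun p => congr($h p))

theorem evalLinear_surjective : Function.Surjective (evalLinear n) := by
  intro φ
  refine ⟨∑ i, φ (Pi.single i 1) • ⟨MvPolynomial.X i, MvPolynomial.isHomogeneous_X ℂ i⟩, ?_⟩
  rw [map_sum]
  refine LinearMap.pi_ext' fun j => LinearMap.ext_ring ?_
  simp [evalLinear_apply, Pi.single_apply]

/-- Linear forms are the linear functionals. -/
def evalLinearEquiv (n : ℕ) : grading n 1 ≃ₗ[ℂ] Module.Dual ℂ (Fin (n + 1) → ℂ) :=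
  LinearEquiv.ofBijective (evalLinear n) ⟨evalLinear_injective, evalLinear_surjective⟩

end ClosedPoints

section Pencil

open Module

variable {n k m : ℕ} (A : Matrix (Fin k) (Fin m) (Pol n)) (hA : ∀ j i, A j i ∈ grading n 1)

/-- The values of a matrix of linear forms, as a bilinear map. -/
def pencil : (Fin (n + 1) → ℂ) →ₗ[ℂ] (Fin m → ℂ) →ₗ[ℂ] (Fin k → ℂ) :=
  LinearMap.mk₂ ℂ (fun p v j => ∑ i, evalLinear n ⟨A j i, hA j i⟩ p * v i)
    (fun p q v => funext fun j => by simp [add_mul, Finset.sum_add_distrib])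
    (fun c p v => funext fun j => by simp [Finset.mul_sum, mul_assoc])
    (fun p v w => funext fun j => by simp [mul_add, Finset.sum_add_distrib])
    (fun c p v => funext fun j => by
      simp only [Pi.smul_apply, smul_eq_mul, Finset.mul_sum]
      exact Finset.sum_congr rfl fun i _ => by ring)

theorem pencil_apply (p : Fin (n + 1) → ℂ) (v : Fin m → ℂ) (j : Fin k) :
    pencil A hA p v j = ∑ i, MvPolynomial.eval p (A j i) * v i := rfl

theorem pencil_surjective (hB : Nondegenerate A) (p : Fin (n + 1) → ℂ) (hp : p ≠ 0) :
    Function.Surjective (pencil A hA p) := by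
  intro w
  obtain ⟨d, B, b, hBd, hb, hbx, hAB⟩ := hB (closedPt p hp)
  have hb0 : MvPolynomial.eval p b ≠ 0 := fun h => hbx ((mem_pointIdeal_closedPt hb).2 h)
  refine ⟨fun i => (MvPolynomial.eval p b)⁻¹ * ∑ j, MvPolynomial.eval p (B i j) * w j,
    funext fun j => ?_⟩
  have h1 : ∀ j', ∑ i, MvPolynomial.eval p (A j i) * MvPolynomial.eval p (B i j') =
      if j = j' then MvPolynomial.eval p b else 0 := by
    intro j'
    have := congr(MvPolynomial.eval p ($hAB j j'))
    rw [Matrix.mul_apply, map_sum, Matrix.smul_apply, Matrix.one_apply] at this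
    simp_rw [map_mul] at this
    rw [this]
    split_ifs <;> simp
  rw [pencil_apply]
  calc ∑ i, MvPolynomial.eval p (A j i) *
        ((MvPolynomial.eval p b)⁻¹ * ∑ j, MvPolynomial.eval p (B i j) * w j)
      = (MvPolynomial.eval p b)⁻¹ * ∑ i, ∑ j', (MvPolynomial.eval p (A j i) *
          MvPolynomial.eval p (B i j')) * w j' := by
        rw [Finset.mul_sum]
        refine Finset.sum_congr rfl fun i _ => ?_
        rw [Finset.mul_sum, Finset.mul_sum, Finset.mul_sum]
        exact Finset.sum_congr rfl fun j' _ => by ring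
    _ = w j := by
        rw [Finset.sum_comm]
        simp_rw [← Finset.sum_mul, h1]
        simp [hb0]

/-- The kernel of a matrix of linear forms of maximal rank has no global sections, since these have
constant coordinates. -/
theorem eq_zero_of_forall_pencil (hk : 1 ≤ k) (hm : m = n + k) (hB : Nondegenerate A)
    {v : Fin m → ℂ}
    (hv : ∀ p, pencil A hA p v = 0) : v = 0 := by
  have : Nonempty (Fin k) := ⟨⟨0, hk⟩⟩
  exact eq_zero_of_forall_apply_eq_zero (pencil A hA) (pencil_surjective A hA hB)
    (by simp only [finrank_fin_fun, hm]; ring) hv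

end Pencil

section Rank

open Module

variable {n : ℕ}

instance (d : ℕ) : Module.Finite ℂ (grading n d) :=
  Module.Finite.iff_fg.2 (MvPolynomial.homogeneousSubmodule_fg (Fin (n + 1)) ℂ d)

/-- The Hilbert function of projective space of positive dimension increases strictly. -/
theorem finrank_grading_lt (hn : 1 ≤ n) (d : ℕ) :
    finrank ℂ (grading n d) < finrank ℂ (grading n (d + 1)) := by
  let L : grading n d →ₗ[ℂ] grading n (d + 1) :=
    { toFun := fun f => ⟨f.1 * MvPolynomial.X 0,
        SetLike.mul_mem_graded (A := grading n) f.2 (MvPolynomial.isHomogeneous_X ℂ 0)⟩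
      map_add' := fun f g => Subtype.ext (add_mul _ _ _)
      map_smul' := fun c f => Subtype.ext (smul_mul_assoc _ _ _) }
  have hL : Function.Injective L := fun f g h => Subtype.ext
    (mul_right_cancel₀ (MvPolynomial.X_ne_zero _) congr(($h).1))
  have h1 : LinearMap.range L ≠ ⊤ := by
    intro h
    let i₁ : Fin (n + 1) := ⟨1, by omega⟩
    have hX : (MvPolynomial.X i₁ : Pol n) ^ (d + 1) ∈ grading n (d + 1) := by
      simpa using (MvPolynomial.isHomogeneous_X ℂ i₁).pow (d + 1)
    obtain ⟨f, hf⟩ := LinearMap.range_eq_top.1 h ⟨_, hX⟩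
    have h2 : f.1 * MvPolynomial.X 0 = (MvPolynomial.X i₁ : Pol n) ^ (d + 1) :=
      congr(($hf).1)
    have h3 := (MvPolynomial.X_prime (R := ℂ) (i := (0 : Fin (n + 1)))).dvd_of_dvd_pow
      (Dvd.intro_left _ h2)
    rw [MvPolynomial.X_dvd_X] at h3
    simp [Fin.ext_iff, i₁] at h3
  rw [← LinearMap.finrank_range_of_inj hL]
  exact Submodule.finrank_lt h1

variable {k m : ℕ} (A : Matrix (Fin k) (Fin m) (Pol n)) (hA : ∀ j i, A j i ∈ grading n 1)

/-- Multiplication by a matrix of linear forms on vectors of forms of degree `t`. -/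
def mulForms (t : ℕ) : (Fin m → grading n t) →ₗ[ℂ] (Fin k → grading n (t + 1)) where
  toFun f j := ⟨∑ i, A j i * (f i).1, Submodule.sum_mem _ fun i _ => by
    exact add_comm 1 t ▸ SetLike.mul_mem_graded (hA j i) (f i).2⟩
  map_add' f g := funext fun j => Subtype.ext (by simp [mul_add, Finset.sum_add_distrib])
  map_smul' c f := funext fun j => Subtype.ext (by simp [Finset.smul_sum])

theorem mulForms_apply (t : ℕ) (f : Fin m → grading n t) (j : Fin k) :
    (mulForms A hA t f j : Pol n) = ∑ i, A j i * (f i).1 := rfl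

/-- A matrix of maximal rank is surjective on forms of large degree. -/
theorem exists_mulForms_surjective (hB : Nondegenerate A) :
    ∃ t, Function.Surjective (mulForms A hA t) := by
  let I (j : Fin k) : Ideal (Pol n) :=
    { carrier := {b | ∃ f : Fin m → Pol n, ∀ j', ∑ i, A j' i * f i = if j' = j then b else 0}
      zero_mem' := ⟨0, by simp⟩
      add_mem' := by
        rintro b b' ⟨f, hf⟩ ⟨f', hf'⟩
        refine ⟨f + f', fun j' => ?_⟩
        simp only [Pi.add_apply, mul_add, Finset.sum_add_distrib, hf, hf']
        split_ifs <;> simp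
      smul_mem' := by
        rintro c b ⟨f, hf⟩
        refine ⟨c • f, fun j' => ?_⟩
        simp only [Pi.smul_apply, smul_eq_mul, mul_left_comm _ c, ← Finset.mul_sum, hf]
        split_ifs <;> simp }
  have hI : ∀ j, ∃ N, ∀ d, N ≤ d → ∀ f ∈ grading n d, f ∈ I j := fun j =>
    exists_forall_grading_le (I j) fun x => by
      obtain ⟨d, B, b, -, hb, hbx, hAB⟩ := hB x
      refine ⟨d + 1, b, hb, ⟨fun i => B i j, fun j' => ?_⟩, hbx⟩
      have := congr($hAB j' j)
      rw [Matrix.mul_apply, Matrix.smul_apply, Matrix.one_apply] at this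
      simpa using this
  choose N hN using hI
  obtain ⟨t, ht⟩ : ∃ t, ∀ j, N j ≤ t :=
    ⟨Finset.univ.sup N, fun j => Finset.le_sup (Finset.mem_univ j)⟩
  refine ⟨t, fun h => ?_⟩
  have h1 : ∀ j, ∃ f : Fin m → Pol n, ∀ j',
      ∑ i, A j' i * f i = if j' = j then (h j : Pol n) else 0 :=
    fun j => hN j (t + 1) ((ht j).trans (Nat.le_succ _)) _ (h j).2
  choose f hf using h1
  refine ⟨fun i => ∑ j, DirectSum.decompose (grading n) (f j i) t, funext fun j' => Subtype.ext ?_⟩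
  rw [mulForms_apply]
  have h2 : ∀ j i, A j' i * (DirectSum.decompose (grading n) (f j i) t : Pol n) =
      DirectSum.decompose (grading n) (A j' i * f j i) (1 + t) := fun j i =>
    (DirectSum.coe_decompose_mul_add_of_left_mem (grading n) (hA j' i)).symm
  have h3 : ∀ j, ∑ i, A j' i * (DirectSum.decompose (grading n) (f j i) t : Pol n) =
      if j' = j then (h j : Pol n) else 0 := by
    intro j
    simp_rw [h2]
    rw [← AddSubmonoidClass.coe_finsetSum, ← DFinsupp.finsetSum_apply,
      ← DirectSum.decompose_sum, hf]
    have : ∀ e, e = t + 1 → (h j : Pol n) ∈ grading n e := by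
      rintro _ rfl
      exact (h j).2
    split_ifs
    · exact DirectSum.decompose_of_mem_same (grading n) (this _ (add_comm 1 t))
    · simp
  simp only [AddSubmonoidClass.coe_finsetSum, Finset.mul_sum]
  rw [Finset.sum_comm]
  simp [h3]

end Rank

/-! ### Comparison of two presentations of one sheaf -/

namespace Presentation

open Module

variable {n k k' m m' : ℕ} {E : (PSpace n).Modules} {A : Matrix (Fin k) (Fin m) (Pol n)}
  {A' : Matrix (Fin k') (Fin m') (Pol n)} (P : Presentation E A) (P' : Presentation E A')

/-- Two vectors in the field of fractions correspond if they are the coordinates of one section of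
`E`, over some open subset, in the two presentations. -/
def Corr (z : Fin m → Frac n) (z' : Fin m' → Frac n) : Prop :=
  ∃ (U : (PSpace n).Opens) (x : U) (s : Γ(E, U)),
    (∀ i, ratAt x (P.coord U i s) = z i) ∧ ∀ i, ratAt x (P'.coord U i s) = z' i

variable {P P'}

theorem ratAt_coord_map {U V : (PSpace n).Opens} (i : V ⟶ U) (s : Γ(E, U)) (j : Fin m) (x : V)
    (y : U) : ratAt x (P.coord V j (E.presheaf.map i.op s)) = ratAt y (P.coord U j s) := by
  rw [coord_map, ratAt_map, ratAt_eq]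

theorem Corr.symm {z : Fin m → Frac n} {z' : Fin m' → Frac n} (h : Corr P P' z z') :
    Corr P' P z' z := by
  obtain ⟨U, x, s, h1, h2⟩ := h
  exact ⟨U, x, s, h2, h1⟩

theorem Corr.add {z w : Fin m → Frac n} {z' w' : Fin m' → Frac n} (h : Corr P P' z z')
    (h' : Corr P P' w w') : Corr P P' (z + w) (z' + w') := by
  obtain ⟨U, x, s, h1, h2⟩ := h
  obtain ⟨V, y, t, h1', h2'⟩ := h'
  refine ⟨U ⊓ V, ⟨genericPt n, genericPt_mem x.2, genericPt_mem y.2⟩,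
    E.presheaf.map (homOfLE inf_le_left).op s + E.presheaf.map (homOfLE inf_le_right).op t,
    fun i => ?_, fun i => ?_⟩
  · rw [map_add, map_add, ratAt_coord_map _ s i _ x, ratAt_coord_map _ t i _ y, h1, h1']; rfl
  · rw [map_add, map_add, ratAt_coord_map _ s i _ x, ratAt_coord_map _ t i _ y, h2, h2']; rfl

/-- Correspondence is compatible with multiplication by rational functions. -/
theorem Corr.smul {z : Fin m → Frac n} {z' : Fin m' → Frac n} (h : Corr P P' z z') {c : Frac n}
    (hc : IsRegularAt 0 (genericPt n) c) : Corr P P' (c • z) (c • z') := by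
  obtain ⟨U, x, s, h1, h2⟩ := h
  obtain ⟨V, hV, e, a, ha, b, hb, hab⟩ := hc.exists_open
  obtain ⟨r, hr⟩ := exists_section (U := U ⊓ V) (z := c) fun y =>
    ⟨e, a, ha, b, hb, (hab y.1 y.2.2).1, (hab y.1 y.2.2).2⟩
  refine ⟨U ⊓ V, ⟨genericPt n, genericPt_mem x.2, hV⟩,
    r • E.presheaf.map (homOfLE inf_le_left).op s, fun i => ?_, fun i => ?_⟩
  · rw [_root_.map_smul, smul_eq_mul, map_mul, hr, ratAt_coord_map _ s i _ x, h1]; rfl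
  · rw [_root_.map_smul, smul_eq_mul, map_mul, hr, ratAt_coord_map _ s i _ x, h2]; rfl

theorem Corr.eq_zero {z' : Fin m' → Frac n} (h : Corr P P' 0 z') : z' = 0 := by
  obtain ⟨U, x, s, h1, h2⟩ := h
  have h3 : s = 0 := P.ext fun i => ratAt_injective x (by rw [h1, map_zero, map_zero]; rfl)
  funext i
  rw [← h2, h3, map_zero, map_zero]
  rfl

theorem isRegularAt_neg_one (x : PTop n) : IsRegularAt 0 x (-1 : Frac n) := by
  have := isRegularAt_of_mem (n := n) (d := 0) (a := -1)
    (neg_mem (SetLike.one_mem_graded (grading n))) x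
  simpa using this

theorem Corr.unique {z : Fin m → Frac n} {z' w' : Fin m' → Frac n} (h : Corr P P' z z')
    (h' : Corr P P' z w') : z' = w' := by
  have h1 := h.add (h'.smul (isRegularAt_neg_one _))
  have h2 := Corr.eq_zero (z' := z' + (-1 : Frac n) • w') (by simpa using h1)
  have h3 : z' - w' = 0 := by simpa [sub_eq_add_neg] using h2
  exact sub_eq_zero.1 h3

/-- Vectors of forms of degree `t` annihilated by one matrix are transported to vectors of forms of
degree `t` annihilated by the other: both are the sections of `E(t)`. -/
theorem exists_corr_forms (hn : 1 ≤ n) (P : Presentation E A) (P' : Presentation E A') (t : ℕ)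
    (f : Fin m → Pol n) (hf : ∀ i, f i ∈ grading n t) (hAf : ∀ j, ∑ i, A j i * f i = 0) :
    ∃ f' : Fin m' → Pol n, (∀ i, f' i ∈ grading n t) ∧ (∀ j, ∑ i, A' j i * f' i = 0) ∧
      Corr P P' (fun i => toFrac n (f i) / toFrac n (MvPolynomial.X 0 ^ t))
        (fun i => toFrac n (f' i) / toFrac n (MvPolynomial.X 0 ^ t)) := by
  have hX : ∀ l : Fin (n + 1), (MvPolynomial.X l : Pol n) ^ t ∈ grading n t := fun l => by
    simpa using (MvPolynomial.isHomogeneous_X ℂ l).pow t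
  have hX0 : ∀ l : Fin (n + 1), toFrac n (MvPolynomial.X l ^ t) ≠ 0 := fun l =>
    (map_ne_zero_iff _ toFrac_injective).2 (pow_ne_zero _ (MvPolynomial.X_ne_zero _))
  have hmem : ∀ (l : Fin (n + 1)) (x : PTop n), x ∈ basicOpen (MvPolynomial.X l : Pol n) →
      (MvPolynomial.X l : Pol n) ^ t ∉ pointIdeal x := fun l x hx h =>
    hx ((inferInstance : (pointIdeal x).IsPrime).mem_of_pow_mem t h)
  -- on `X l ≠ 0`, the vector `f / X l ^ t` is the vector of coordinates of a section
  have key : ∀ l : Fin (n + 1), ∃ s : Γ(E, basicOpen (MvPolynomial.X l : Pol n)),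
      ∀ i x, ratAt x (P.coord _ i s) = toFrac n (f i) / toFrac n (MvPolynomial.X l ^ t) := by
    intro l
    refine P.exists_ratAt_coord _ (fun i x hx => ?_) fun j => ?_
    · refine isRegularAt_div (e := t) (by simpa using hf i) (hX l) (hmem l x hx)
    · simp_rw [← mul_div_assoc, ← Finset.sum_div, ← map_mul, ← map_sum, hAf]
      simp
  choose s hs using key
  have hgen : ∀ l : Fin (n + 1), genericPt n ∈ basicOpen (MvPolynomial.X l : Pol n) := fun l h =>
    MvPolynomial.X_ne_zero l h
  let z (l : Fin (n + 1)) (i : Fin m') : Frac n := ratAt ⟨_, hgen l⟩ (P'.coord _ i (s l))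
  have hz : ∀ l, Corr P P' (fun i => toFrac n (f i) / toFrac n (MvPolynomial.X l ^ t)) (z l) :=
    fun l => ⟨_, ⟨_, hgen l⟩, s l, fun i => hs l i _, fun i => rfl⟩
  have hz0 : ∀ l i, z l i * toFrac n (MvPolynomial.X l ^ t) =
      z 0 i * toFrac n (MvPolynomial.X 0 ^ t) := by
    intro l i
    have h1 := (hz l).smul (c := toFrac n (MvPolynomial.X l ^ t) / toFrac n (MvPolynomial.X 0 ^ t))
      (isRegularAt_div (e := t) (by simpa using hX l) (hX 0) (hmem 0 _ (hgen 0)))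
    have h2 : ((toFrac n (MvPolynomial.X l ^ t) / toFrac n (MvPolynomial.X 0 ^ t)) •
        fun i => toFrac n (f i) / toFrac n (MvPolynomial.X l ^ t)) =
        fun i => toFrac n (f i) / toFrac n (MvPolynomial.X 0 ^ t) := by
      funext i
      have := hX0 l
      simp only [Pi.smul_apply, smul_eq_mul]
      field_simp
    rw [h2] at h1
    rw [← congrFun (h1.unique (hz 0)) i]
    have := hX0 0
    simp only [Pi.smul_apply, smul_eq_mul]
    field_simp
  -- its coordinates in the other presentation, multiplied by `X l ^ t`, do not depend on `l`, so
  -- they are regular of degree `t` at all points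
  have h1 : ∀ i, ∃ f' ∈ grading n t, toFrac n f' = z 0 i * toFrac n (MvPolynomial.X 0 ^ t) :=
    fun i => exists_polynomial_of_isRegularAt hn fun x => by
      obtain ⟨l, hl⟩ := exists_X_notMem x
      rw [← hz0 l, show z l i = _ from ratAt_eq _ _ ⟨x, hl⟩]
      simpa using (ratAt_isRegularAt (⟨x, hl⟩ : basicOpen (MvPolynomial.X l : Pol n)) _).mul
        (isRegularAt_of_mem (hX l) x)
  choose f' hf' hff using h1
  refine ⟨f', hf', fun j => toFrac_injective ?_, ?_⟩
  · have := P'.relation (s 0) ⟨_, hgen 0⟩ j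
    rw [map_sum, map_zero]
    simp_rw [map_mul, hff, ← mul_assoc]
    rw [← Finset.sum_mul]
    exact mul_eq_zero_of_left this _
  · have h2 : (fun i => toFrac n (f' i) / toFrac n (MvPolynomial.X 0 ^ t)) = z 0 :=
      funext fun i => by rw [hff, mul_div_cancel_right₀ _ (hX0 0)]
    rw [h2]
    exact hz 0

/-- A presentation by a matrix of maximal rank has at most as many relations as any other one of the
same rank. The Hilbert functions of the two kernels agree, the first is known for large degrees, and
the second is bounded from below. -/
theorem le_of_nondegenerate (hn : 1 ≤ n) (P : Presentation E A) (P' : Presentation E A')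
    (hA : ∀ j i, A j i ∈ grading n 1) (hA' : ∀ j i, A' j i ∈ grading n 1) (hB : Nondegenerate A)
    (hm : m = n + k) (hm' : m' = n + k') : k ≤ k' := by
  obtain ⟨t, ht⟩ := exists_mulForms_surjective A hA hB
  have key : ∀ f : LinearMap.ker (mulForms A' hA' t), ∃ g : LinearMap.ker (mulForms A hA t),
      Corr P' P (fun i => toFrac n (f.1 i) / toFrac n (MvPolynomial.X 0 ^ t))
        (fun i => toFrac n (g.1 i) / toFrac n (MvPolynomial.X 0 ^ t)) := by
    intro f
    obtain ⟨g, hg, hAg, h⟩ := exists_corr_forms hn P' P t (fun i => (f.1 i : Pol n))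
      (fun i => (f.1 i).2) fun j => congr(($(f.2) j : Pol n))
    exact ⟨⟨fun i => ⟨g i, hg i⟩, funext fun j => Subtype.ext (hAg j)⟩, h⟩
  choose G hG using key
  have hX0 : toFrac n (MvPolynomial.X 0 ^ t) ≠ 0 :=
    (map_ne_zero_iff _ toFrac_injective).2 (pow_ne_zero _ (MvPolynomial.X_ne_zero _))
  have uniq : ∀ (z : Fin m' → Frac n) (g g' : LinearMap.ker (mulForms A hA t)),
      Corr P' P z (fun i => toFrac n (g.1 i) / toFrac n (MvPolynomial.X 0 ^ t)) →
      Corr P' P z (fun i => toFrac n (g'.1 i) / toFrac n (MvPolynomial.X 0 ^ t)) → g = g' := by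
    intro z g g' h h'
    refine Subtype.ext (funext fun i => Subtype.ext (toFrac_injective ?_))
    have := congrFun (h.unique h') i
    exact (div_left_inj' hX0).1 this
  let L : LinearMap.ker (mulForms A' hA' t) →ₗ[ℂ] LinearMap.ker (mulForms A hA t) :=
    { toFun := G
      map_add' := fun f g => uniq _ _ _ (hG (f + g)) (by
        convert (hG f).add (hG g) using 1
        · funext i; simp [add_div]
        · funext i; simp [add_div])
      map_smul' := fun c f => uniq _ _ _ (hG (c • f)) (by
        have hc : toFrac n (MvPolynomial.C c) = algebraMap ℂ (Frac n) c :=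
          (IsScalarTower.algebraMap_apply ℂ (Pol n) (Frac n) c).symm
        convert (hG f).smul (isRegularAt_of_mem (MvPolynomial.isHomogeneous_C _ c) _) using 1
        · funext i
          simp [MvPolynomial.smul_eq_C_mul, mul_div_assoc]
        · funext i
          simp [MvPolynomial.smul_eq_C_mul, mul_div_assoc]) }
  have hL : Function.Injective L := by
    intro f g h
    have h1 : G f = G g := h
    have h2 := (hG f).symm
    rw [h1] at h2
    have h3 := h2.unique (hG g).symm
    refine Subtype.ext (funext fun i => Subtype.ext (toFrac_injective ?_))
    exact (div_left_inj' hX0).1 (congrFun h3 i)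
  have h1 := LinearMap.finrank_le_finrank_of_injective hL
  have h2 := LinearMap.finrank_range_add_finrank_ker (mulForms A hA t)
  have h3 := LinearMap.finrank_range_add_finrank_ker (mulForms A' hA' t)
  have h4 := (LinearMap.range (mulForms A' hA' t)).finrank_le
  rw [LinearMap.range_eq_top.2 ht, finrank_top] at h2
  simp only [Module.finrank_pi_fintype, Finset.sum_const, Finset.card_univ, Fintype.card_fin,
    smul_eq_mul] at h2 h3 h4
  have h5 := finrank_grading_lt hn t
  set r := finrank ℂ (grading n t)
  set r' := finrank ℂ (grading n (t + 1))
  subst hm hm'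
  by_contra! hlt
  obtain ⟨δ, rfl⟩ := Nat.exists_eq_add_of_lt hlt
  obtain ⟨ε, hε⟩ := Nat.exists_eq_add_of_lt h5
  -- the kernels have dimension `n r - k (r' - r)` and at least `n r - k' (r' - r)`
  rw [hε] at h2 h4
  nlinarith [Nat.zero_le (δ * ε)]

end Presentation

/-! ### The geometry of a hyperplane -/

section VanishingIdeal

theorem isReduced_quotient_vanishingIdeal {R : Type*} [CommRing R] (s : Set (PrimeSpectrum R)) :
    _root_.IsReduced (R ⧸ PrimeSpectrum.vanishingIdeal s) :=
  (Ideal.isRadical_iff_quotient_reduced _).1 (PrimeSpectrum.isRadical_vanishingIdeal s)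

instance isReduced_subscheme_vanishingIdeal {X : Scheme.{0}} (Z : Closeds X) :
    IsReduced (Scheme.IdealSheafData.vanishingIdeal Z).subscheme := by
  have key : ∀ U : X.affineOpens, IsReduced (Spec (.of (Γ(X, U.1) ⧸
      (Scheme.IdealSheafData.vanishingIdeal Z).ideal U))) := by
    intro U
    have : _root_.IsReduced (Γ(X, U.1) ⧸ (Scheme.IdealSheafData.vanishingIdeal Z).ideal U) := by
      rw [Scheme.IdealSheafData.vanishingIdeal_ideal]
      exact isReduced_quotient_vanishingIdeal _
    infer_instance
  have : ∀ i, IsReduced ((Scheme.IdealSheafData.vanishingIdeal Z).subschemeCover.openCover.X i) :=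
    fun U => key U
  exact IsReduced.of_openCover _ (Scheme.IdealSheafData.vanishingIdeal Z).subschemeCover.openCover

end VanishingIdeal

section Hyperplane

variable {n : ℕ} (H : Hyperplane n)

/-- An equation of the hyperplane. -/
abbrev Hyperplane.eqn : Pol n := (H.rep : Pol n)

theorem Hyperplane.eqn_ne_zero : H.eqn ≠ 0 := fun h => H.rep_nonzero (Subtype.ext h)

theorem Hyperplane.eqn_mem : H.eqn ∈ grading n 1 := H.rep.2

/-- Nonzero linear forms are prime. -/
theorem prime_of_linear {l : Pol n} (hl : l ∈ grading n 1) (h0 : l ≠ 0) : Prime l := by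
  refine Irreducible.prime (MvPolynomial.irreducible_of_totalDegree_eq_one
    (MvPolynomial.IsHomogeneous.totalDegree hl h0) fun c hc => ?_)
  obtain ⟨m, hm⟩ := MvPolynomial.ne_zero_iff.1 h0
  exact (ne_zero_of_dvd_ne_zero hm (hc m)).isUnit

theorem Hyperplane.eqn_prime : Prime H.eqn := prime_of_linear H.eqn_mem H.eqn_ne_zero

/-- In positive dimension a linear form does not divide all coordinates. -/
theorem exists_X_notMem_span (hn : 1 ≤ n) {l : Pol n} (hl : l ∈ grading n 1) (h0 : l ≠ 0) :
    ∃ i, (MvPolynomial.X i : Pol n) ∉ Ideal.span {l} := by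
  by_contra! h
  have h1 : ∀ i, Associated l (MvPolynomial.X i : Pol n) := fun i =>
    (prime_of_linear hl h0).irreducible.associated_of_dvd
      (MvPolynomial.X_prime (R := ℂ)).irreducible (Ideal.mem_span_singleton.1 (h i))
  have h2 := ((h1 0).symm.trans (h1 ⟨1, by omega⟩)).dvd
  rw [MvPolynomial.X_dvd_X] at h2
  simp [Fin.ext_iff] at h2

/-- The generic point of the hyperplane. -/
def Hyperplane.genericPt (hn : 1 ≤ n) : PTop n :=
  pointOfIdeal (Ideal.span {H.eqn})
    (Ideal.homogeneous_span _ _ (by rintro _ rfl; exact ⟨1, H.eqn_mem⟩))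
    ((Ideal.span_singleton_prime H.eqn_ne_zero).2 H.eqn_prime)
    (exists_X_notMem_span hn H.eqn_mem H.eqn_ne_zero).choose
    (exists_X_notMem_span hn H.eqn_mem H.eqn_ne_zero).choose_spec

theorem Hyperplane.mem_genericPt (hn : 1 ≤ n) {f : Pol n} :
    f ∈ pointIdeal (H.genericPt hn) ↔ H.eqn ∣ f := Ideal.mem_span_singleton

theorem Hyperplane.support_eq_closure (hn : 1 ≤ n) :
    (H.support : Set (PSpace n)) = closure {H.genericPt hn} := by
  ext x
  refine Iff.trans ?_ (ProjectiveSpectrum.le_iff_mem_closure (𝒜 := grading n) (H.genericPt hn) x)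
  refine ⟨fun h => ?_, fun h => h (Ideal.mem_span_singleton_self _)⟩
  exact (Ideal.span_singleton_le_iff_mem (I := pointIdeal x)).2 h

instance : IsReduced H.subscheme := isReduced_subscheme_vanishingIdeal H.support

instance : IsClosedImmersion H.ι :=
  inferInstanceAs (IsClosedImmersion (Scheme.IdealSheafData.vanishingIdeal H.support).subschemeι)

theorem Hyperplane.range_ι : Set.range H.ι = (H.support : Set (PSpace n)) := by
  refine (Scheme.IdealSheafData.range_subschemeι _).trans ?_
  exact Scheme.IdealSheafData.coe_support_vanishingIdeal _

theorem Hyperplane.isIntegral (hn : 1 ≤ n) : IsIntegral H.subscheme := by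
  have h1 : H.genericPt hn ∈ Set.range H.ι := by
    rw [H.range_ι, H.support_eq_closure hn]
    exact subset_closure rfl
  obtain ⟨y, hy⟩ := h1
  have h2 : closure {y} = (Set.univ : Set H.subscheme) := by
    rw [H.ι.isClosedEmbedding.isEmbedding.isInducing.closure_eq_preimage_closure_image,
      Set.image_singleton, hy, ← H.support_eq_closure hn, ← H.range_ι, Set.preimage_range]
  have h3 : IsIrreducible (Set.univ : Set H.subscheme) := h2 ▸ isIrreducible_singleton.closure
  have h4 : IrreducibleSpace H.subscheme :=
    { isPreirreducible_univ := h3.2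
      toNonempty := ⟨y⟩ }
  exact isIntegral_of_irreducibleSpace_of_isReduced _

/-- A regular function vanishes on the hyperplane if and only if the hyperplane does not meet the
open subset where the function is invertible. -/
theorem Hyperplane.app_eq_zero_iff {U : (PSpace n).Opens} (s : Γ(PSpace n, U)) :
    H.ι.app U s = 0 ↔ ∀ x ∈ H.support, x ∉ (PSpace n).basicOpen s := by
  rw [← basicOpen_eq_bot_iff, ← Scheme.preimage_basicOpen]
  constructor
  · intro h x hx hxs
    obtain ⟨y, rfl⟩ := (Set.ext_iff.1 H.range_ι x).2 hx
    have : y ∈ H.ι ⁻¹ᵁ (PSpace n).basicOpen s := hxs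
    rw [h] at this
    exact this
  · intro h
    ext y
    refine iff_of_false (fun hy => h _ ?_ hy) (by simp)
    exact (Set.ext_iff.1 H.range_ι _).1 ⟨y, rfl⟩

/-- Where a quotient of forms is invertible. -/
theorem mem_basicOpen_iff {U : (PSpace n).Opens} (s : Γ(PSpace n, U)) (x : U) {d : ℕ} {a b : Pol n}
    (ha : a ∈ grading n d) (hb : b ∈ grading n d) (hbx : b ∉ pointIdeal x.1)
    (h : ratAt x s * toFrac n b = toFrac n a) :
    x.1 ∈ (PSpace n).basicOpen s ↔ a ∉ pointIdeal x.1 := by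
  have h1 : evalAt s x = HomogeneousLocalization.mk ⟨d, ⟨a, ha⟩, ⟨b, hb⟩, hbx⟩ := by
    refine stalkToFrac_injective x.1 (mul_right_cancel₀ (algebraMap_ne_zero_of_notMem hbx) ?_)
    exact h.trans (stalkToFrac_mk x.1 ⟨a, ha⟩ ⟨b, hb⟩ hbx).symm
  have h2 : IsUnit ((PSpace n).presheaf.germ U x.1 x.2 s) ↔ IsUnit (evalAt s x) := by
    refine (MulEquiv.isUnit_map (Proj.stalkIso' (grading n) x.1)).symm.trans ?_
    exact iff_of_eq (congrArg _ (Proj.stalkIso'_germ (grading n) U x.1 x.2 s))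
  rw [Scheme.mem_basicOpen (hx := x.2), h2, h1, ← HomogeneousLocalization.isUnit_iff_isUnit_val,
    HomogeneousLocalization.val_mk, Localization.mk_eq_mk']
  exact IsLocalization.AtPrime.isUnit_mk'_iff _ _ _ _

/-- Global regular functions on projective space are constant. -/
theorem exists_ratAt_eq_const (hn : 1 ≤ n) (s : Γ(PSpace n, ⊤)) :
    ∃ c : ℂ, ∀ x, ratAt x s = toFrac n (MvPolynomial.C c) := by
  obtain ⟨f, hf, h⟩ := exists_polynomial_of_isRegularAt hn (d := 0)

    (z := ratAt (⟨SteinerLog.genericPt n, trivial⟩ : (⊤ : (PSpace n).Opens)) s) fun x => by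
      rw [ratAt_eq s _ (⟨x, trivial⟩ : (⊤ : (PSpace n).Opens))]
      exact ratAt_isRegularAt (⟨x, trivial⟩ : (⊤ : (PSpace n).Opens)) s
  refine ⟨f.coeff 0, fun x => ?_⟩
  rw [← MvPolynomial.totalDegree_eq_zero_iff_eq_C.1
    (Nat.le_zero.1 (MvPolynomial.IsHomogeneous.totalDegree_le hf)), h]
  exact ratAt_eq _ _ _

/-- Constant regular functions. -/
theorem exists_const (c : ℂ) (U : (PSpace n).Opens) :
    ∃ s : Γ(PSpace n, U), ∀ x, ratAt x s = toFrac n (MvPolynomial.C c) :=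
  exists_section fun _ => isRegularAt_of_mem (MvPolynomial.isHomogeneous_C _ c) _

instance (n : ℕ) : Algebra.FiniteType (grading n 0) (Pol n) :=
  have : IsScalarTower ℂ (grading n 0) (Pol n) :=
    ⟨fun c a f => smul_mul_assoc c a.1 f⟩
  Algebra.FiniteType.of_restrictScalars_finiteType ℂ (grading n 0) (Pol n)

/-- The forms of degree `0` are the scalars. -/
theorem bijective_algebraMap_grading_zero : Function.Bijective (algebraMap ℂ (grading n 0)) := by
  refine ⟨fun a b h => MvPolynomial.C_injective _ _ congr(($h : Pol n)), fun f => ?_⟩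
  refine ⟨f.1.coeff 0, Subtype.ext ?_⟩
  exact (MvPolynomial.totalDegree_eq_zero_iff_eq_C.1
    (Nat.le_zero.1 (MvPolynomial.IsHomogeneous.totalDegree_le f.2))).symm

/-- A hyperplane is proper and integral over an algebraically closed field, so all its global
regular functions are restrictions of global regular functions. -/
theorem Hyperplane.app_top_surjective (hn : 1 ≤ n) : Function.Surjective (H.ι.app ⊤) := by
  have := H.isIntegral hn
  let e : ℂ ≃+* grading n 0 := RingEquiv.ofBijective (algebraMap ℂ (grading n 0))
    bijective_algebraMap_grading_zero
  have he : IsIso (CommRingCat.ofHom (e : ℂ →+* grading n 0)) :=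
    (ConcreteCategory.isIso_iff_bijective _).2 e.bijective
  let f : H.subscheme ⟶ Spec (.of ℂ) := H.ι ≫ Proj.toSpecZero (grading n) ≫
    Spec.map (CommRingCat.ofHom (e : ℂ →+* grading n 0))
  let := (isField_of_universallyClosed ℂ f).toField
  have hf := finite_appTop_of_universallyClosed ℂ f
  let g : ℂ →+* Γ(H.subscheme, ⊤) :=
    f.appTop.hom.comp (Scheme.ΓSpecIso (.of ℂ)).inv.hom
  have hg : g.Finite := hf.comp (RingHom.Finite.of_surjective _
    ((ConcreteCategory.isIso_iff_bijective (Scheme.ΓSpecIso (.of ℂ)).inv).1 inferInstance).2)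
  algebraize [g]
  have h1 := IsAlgClosed.algebraMap_bijective_of_isIntegral (k := ℂ) (K := Γ(H.subscheme, ⊤))
  intro h
  obtain ⟨c, hc⟩ := h1.2 h
  refine ⟨(Proj.toSpecZero (grading n) ≫
    Spec.map (CommRingCat.ofHom (e : ℂ →+* grading n 0))).appTop
      ((Scheme.ΓSpecIso (.of ℂ)).inv c), Eq.trans ?_ hc⟩
  change _ = f.appTop _
  rw [Scheme.Hom.comp_appTop]
  rfl

end Hyperplane

/-! ### Sections of inverse images -/

section Pullback

variable {X Y : Scheme.{0}} (f : Y ⟶ X) (E : X.Modules)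

/-- The inverse image of a section. -/
def pullSection (U : X.Opens) : Γ(E, U) →+ Γ((Scheme.Modules.pullback f).obj E, f ⁻¹ᵁ U) :=
  (((Scheme.Modules.pullbackPushforwardAdjunction f).unit.app E).app U).hom

theorem pullSection_smul {U : X.Opens} (r : Γ(X, U)) (s : Γ(E, U)) :
    pullSection f E U (r • s) = f.app U r • pullSection f E U s :=
  Scheme.Modules.Hom.app_smul _ r s

theorem pullSection_map {U V : X.Opens} (i : V ⟶ U) (s : Γ(E, U)) :
    pullSection f E V (E.presheaf.map i.op s) =
      ((Scheme.Modules.pullback f).obj E).presheaf.map ((Opens.map f.base).map i).op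
        (pullSection f E U s) :=
  app_map ((Scheme.Modules.pullbackPushforwardAdjunction f).unit.app E) i s

variable {E}

/-- The morphism from the inverse image defined by a morphism to the direct image. -/
def pullDesc {G : Y.Modules} (h : E ⟶ (Scheme.Modules.pushforward f).obj G) :
    (Scheme.Modules.pullback f).obj E ⟶ G :=
  ((Scheme.Modules.pullbackPushforwardAdjunction f).homEquiv E G).symm h

theorem pullDesc_pullSection {G : Y.Modules} (h : E ⟶ (Scheme.Modules.pushforward f).obj G)
    (U : X.Opens) (s : Γ(E, U)) :
    (pullDesc f h).app (f ⁻¹ᵁ U) (pullSection f E U s) = h.app U s := by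
  have h1 := ((Scheme.Modules.pullbackPushforwardAdjunction f).homEquiv E G).apply_symm_apply h
  rw [Adjunction.homEquiv_unit] at h1
  exact congr(($h1).app U s)

/-- Morphisms from an inverse image that agree on the inverse images of sections are equal. -/
theorem pull_hom_ext {G : Y.Modules} {g h : (Scheme.Modules.pullback f).obj E ⟶ G}
    (H : ∀ (U : X.Opens) (s : Γ(E, U)), g.app (f ⁻¹ᵁ U) (pullSection f E U s) =
      h.app (f ⁻¹ᵁ U) (pullSection f E U s)) : g = h := by
  refine ((Scheme.Modules.pullbackPushforwardAdjunction f).homEquiv E G).injective ?_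
  rw [Adjunction.homEquiv_unit, Adjunction.homEquiv_unit]
  ext U s
  exact H U s

/-- The restriction of functions as a morphism of sheaves of modules. -/
def functionsToPushforward :
    structureModule X ⟶ (Scheme.Modules.pushforward f).obj (structureModule Y) :=
  mkHom (fun U =>
    { toFun := fun s => sectionOfFunction (f.app U (unitSection U s))
      map_add' := fun s t => by rw [map_add, map_add]; rfl
      map_smul' := fun r s => by rw [_root_.map_smul, smul_eq_mul, map_mul]; rfl })
    fun U V h s => congr(($(f.naturality (homOfLE h).op)) (unitSection U s))

/-- The linear function on the inverse image defined by a linear function. -/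
def pullFunctional (φ : E ⟶ structureModule X) :
    (Scheme.Modules.pullback f).obj E ⟶ structureModule Y :=
  pullDesc f (φ ≫ functionsToPushforward f)

theorem pullFunctional_pullSection (φ : E ⟶ structureModule X) (U : X.Opens) (s : Γ(E, U)) :
    unitSection _ ((pullFunctional f φ).app (f ⁻¹ᵁ U) (pullSection f E U s)) =
      f.app U (unitSection U (φ.app U s)) :=
  congrArg (unitSection _) (pullDesc_pullSection f (φ ≫ functionsToPushforward f) U s)

end Pullback

section DualFamily

variable {X Y : Scheme.{0}} (f : Y ⟶ X) {E : X.Modules} {m : ℕ}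

/-- The morphism from the structure sheaf defined by a global section. -/
def unitHom {M : X.Modules} (ρ : Γ(M, ⊤)) : structureModule X ⟶ M :=
  mkHom (fun U =>
    { toFun := fun c => unitSection U c • M.presheaf.map (homOfLE (le_top : U ≤ ⊤)).op ρ
      map_add' := fun s t => by rw [map_add, add_smul]
      map_smul' := fun r s => by rw [_root_.map_smul, smul_eq_mul, mul_smul]; rfl })
    fun U V h s => by
      refine Eq.trans ?_ (Scheme.Modules.map_smul M (homOfLE h) (unitSection U s) _).symm
      rw [map_map]
      rfl

theorem unitHom_app {M : X.Modules} (ρ : Γ(M, ⊤)) (U : X.Opens) (c : Γ(structureModule X, U)) :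
    (unitHom ρ).app U c = unitSection U c • M.presheaf.map (homOfLE (le_top : U ≤ ⊤)).op ρ := rfl

/-- The sections of a sheaf of modules over the intersections with an open subset, as a sheaf of
modules. -/
def onOpen (U : Y.Opens) (F : Y.Modules) : Y.Modules :=
  (Scheme.Modules.pushforward U.ι).obj (F.restrict U.ι)

/-- A section of `onOpen U F` over `V` is a section of `F` over `V ∩ U`. -/
def onOpenSection (U : Y.Opens) (F : Y.Modules) (V : Y.Opens) :
    Γ(onOpen U F, V) →+ Γ(F, U.ι ''ᵁ U.ι ⁻¹ᵁ V) := AddMonoidHom.id _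

theorem onOpenSection_injective (U : Y.Opens) (F : Y.Modules) (V : Y.Opens) :
    Function.Injective (onOpenSection U F V) := fun _ _ h => h

theorem onOpenSection_smul (U : Y.Opens) (F : Y.Modules) (V : Y.Opens) (r : Γ(Y, V))
    (s : Γ(onOpen U F, V)) : onOpenSection U F V (r • s) =
      Y.presheaf.map (homOfLE (U.ι.image_preimage_le V)).op r • onOpenSection U F V s := by
  change (U.ι.appIso _).inv (U.ι.app V r) • onOpenSection U F V s = _
  rw [Scheme.Opens.ι_appIso]
  rfl

/-- The restriction morphism. -/
def toOnOpen (U : Y.Opens) (F : Y.Modules) : F ⟶ onOpen U F :=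
  (Scheme.Modules.restrictAdjunction U.ι).unit.app F

theorem onOpenSection_toOnOpen (U : Y.Opens) (F : Y.Modules) (V : Y.Opens) (s : Γ(F, V)) :
    onOpenSection U F V ((toOnOpen U F).app V s) =
      F.presheaf.map (homOfLE (U.ι.image_preimage_le V)).op s := rfl

/-- If, over `U`, the sections `s` of `E` satisfy `s = ∑ φ j (s) • r j`, the same holds for the
sections of the inverse image of `E`. Both sides define morphisms from the inverse image, so it is
enough to compare them on inverse images of sections. -/
theorem pull_eq_sum {U : X.Opens} (φ : Fin m → (E ⟶ structureModule X)) (r : Fin m → Γ(E, U))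
    (h : ∀ (V : X.Opens) (i : V ⟶ U) (s : Γ(E, V)),
      s = ∑ j, unitSection V ((φ j).app V s) • E.presheaf.map i.op (r j))
    {V : Y.Opens} (i : V ⟶ f ⁻¹ᵁ U) (t : Γ((Scheme.Modules.pullback f).obj E, V)) :
    t = ∑ j, unitSection V ((pullFunctional f (φ j)).app V t) •
      ((Scheme.Modules.pullback f).obj E).presheaf.map i.op (pullSection f E U (r j)) := by
  let F := (Scheme.Modules.pullback f).obj E
  let U' := f ⁻¹ᵁ U
  have hle : ∀ W : Y.Opens, U'.ι ''ᵁ U'.ι ⁻¹ᵁ W ≤ U' := fun W => by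
    rw [Scheme.Hom.image_preimage_eq_opensRange_inf]
    simp
  let ρ (j : Fin m) : Γ(onOpen U' F, ⊤) :=
    F.presheaf.map (homOfLE (hle ⊤)).op (pullSection f E U (r j))
  have key : toOnOpen U' F = ∑ j, pullFunctional f (φ j) ≫ unitHom (ρ j) := by
    refine pull_hom_ext f fun W s => onOpenSection_injective _ _ _ ?_
    rw [onOpenSection_toOnOpen, sum_app, map_sum]
    have h1 : ∀ j, onOpenSection U' F (f ⁻¹ᵁ W)
        ((pullFunctional f (φ j) ≫ unitHom (ρ j)).app (f ⁻¹ᵁ W) (pullSection f E W s)) =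
        Y.presheaf.map (homOfLE (U'.ι.image_preimage_le _)).op
          (f.app W (unitSection W ((φ j).app W s))) •
        F.presheaf.map (homOfLE (hle _)).op (pullSection f E U (r j)) := by
      intro j
      refine (congrArg (onOpenSection U' F (f ⁻¹ᵁ W)) (unitHom_app (ρ j) _ _)).trans ?_
      refine (onOpenSection_smul _ _ _ _ _).trans ?_
      exact congrArg₂ (· • ·) (congrArg _ (pullFunctional_pullSection f (φ j) W s))
        (map_map F _ _ _)
    refine Eq.trans ?_ (Finset.sum_congr rfl fun j _ => (h1 j).symm)
    -- both sides are restricted from `f ⁻¹ᵁ (W ⊓ U)`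
    have h2 := congrArg (pullSection f E (W ⊓ U)) (h (W ⊓ U) (homOfLE inf_le_right)
      (E.presheaf.map (homOfLE inf_le_left).op s))
    have h3 : U'.ι ''ᵁ U'.ι ⁻¹ᵁ (f ⁻¹ᵁ W) ≤ f ⁻¹ᵁ (W ⊓ U) :=
      le_inf (U'.ι.image_preimage_le _) (hle _)
    rw [map_sum, pullSection_map] at h2
    have h4 := congrArg (F.presheaf.map (homOfLE h3).op) h2
    rw [map_map, map_sum] at h4
    refine h4.trans (Finset.sum_congr rfl fun j _ => ?_)
    rw [pullSection_smul, Scheme.Modules.map_smul, pullSection_map, map_map]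
    refine congrArg₂ (· • ·) ?_ rfl
    rw [app_map]
    have h5 := congr(($(f.naturality (homOfLE (inf_le_left : W ⊓ U ≤ W)).op))
      (unitSection W ((φ j).app W s)))
    refine (congrArg (Y.presheaf.map (homOfLE h3).op) h5).trans ?_
    refine (ConcreteCategory.comp_apply _ _ _).symm.trans ?_
    rw [Category.assoc, ← Functor.map_comp]
    rfl
  have hV : V ≤ U'.ι ''ᵁ U'.ι ⁻¹ᵁ V := by
    rw [Scheme.Hom.image_preimage_eq_opensRange_inf]
    exact le_inf (by simpa using i.le) le_rfl
  have h1 := congr(F.presheaf.map (homOfLE hV).op (onOpenSection U' F V (($key).app V t)))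
  rw [onOpenSection_toOnOpen, map_map, map_refl, sum_app, map_sum, map_sum] at h1
  refine h1.trans (Finset.sum_congr rfl fun j _ => ?_)
  refine (congrArg (F.presheaf.map (homOfLE hV).op) ((congrArg (onOpenSection U' F V)
    (unitHom_app (ρ j) _ _)).trans (onOpenSection_smul _ _ _ _ _))).trans ?_
  rw [Scheme.Modules.map_smul]
  refine congrArg₂ (· • ·) ?_ ((congrArg _ (map_map F _ _ _)).trans (map_map F _ _ _))
  refine (ConcreteCategory.comp_apply _ _ _).symm.trans ?_
  rw [← Functor.map_comp]
  exact congr(($(Y.presheaf.map_id _)) _)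

end DualFamily

/-! ### Unstable hyperplanes of a presented sheaf -/

section Unstable

variable {n k m : ℕ} {E : (PSpace n).Modules} {A : Matrix (Fin k) (Fin m) (Pol n)}

/-- The vector of linear forms `A c`. -/
def mulConst (A : Matrix (Fin k) (Fin m) (Pol n)) (c : Fin m → ℂ) (j : Fin k) : Pol n :=
  ∑ i, A j i * MvPolynomial.C (c i)

namespace Presentation

variable (P : Presentation E A)

/-- Sections `r` of a presented sheaf over `U` whose coordinates are the columns of the projection
`1 - b⁻¹ B A` to the kernel of `A`, where `A B = b` and `b` is invertible on `U`. -/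
structure Frame (U : (PSpace n).Opens) where
  /-- The spanning sections. -/
  r : Fin m → Γ(E, U)
  /-- The degree of the entries of `B`. -/
  d : ℕ
  /-- A right inverse of `A` up to the factor `b`. -/
  B : Matrix (Fin m) (Fin k) (Pol n)
  /-- The denominator. -/
  b : Pol n
  hB : ∀ i j, B i j ∈ grading n d
  hb : b ∈ grading n (d + 1)
  hbU : ∀ x ∈ U, b ∉ pointIdeal x
  hAB : A * B = b • (1 : Matrix (Fin k) (Fin k) (Pol n))
  coord_r : ∀ (l i : Fin m) (x : U), ratAt x (P.coord U l (r i)) * toFrac n b =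
    toFrac n ((if l = i then b else 0) - ∑ j, B l j * A j i)

/-- Frames exist locally, by the nondegeneracy of `A`. -/
theorem exists_frame (hA : ∀ j i, A j i ∈ grading n 1) (hA' : Nondegenerate A) (x : PTop n) :
    ∃ U : (PSpace n).Opens, x ∈ U ∧ Nonempty (P.Frame U) := by
  obtain ⟨d, B, b, hB, hb, hbx, hAB⟩ := hA' x
  have hdeg : ∀ l i, (if l = i then b else 0) - ∑ j, B l j * A j i ∈ grading n (d + 1) := by
    intro l i
    refine sub_mem ?_ (Submodule.sum_mem _ fun j _ => SetLike.mul_mem_graded (hB l j) (hA j i))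
    split_ifs
    · exact hb
    · exact zero_mem _
  have hAB' : ∀ j j', ∑ l, A j l * B l j' = if j = j' then b else 0 := fun j j' => by
    have := congrFun (congrFun hAB j) j'
    rw [Matrix.mul_apply] at this
    rw [this, Matrix.smul_apply, Matrix.one_apply]
    split_ifs <;> simp
  have key : ∀ i, ∃ s : Γ(E, basicOpen b), ∀ l (y : basicOpen b),
      ratAt y (P.coord (basicOpen b) l s) =
        toFrac n ((if l = i then b else 0) - ∑ j, B l j * A j i) / toFrac n b := by
    intro i
    refine P.exists_ratAt_coord _ (fun l y hy => isRegularAt_div (d := 0) (hdeg l i) hb hy)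
      fun j => ?_
    simp only [mul_div_assoc', ← map_mul]
    rw [← Finset.sum_div, ← map_sum]
    simp only [mul_sub, mul_ite, mul_zero, Finset.sum_sub_distrib, Finset.sum_ite_eq',
      Finset.mem_univ, if_true]
    simp only [Finset.mul_sum]
    rw [Finset.sum_comm]
    simp only [← mul_assoc, ← Finset.sum_mul, hAB', ite_mul, zero_mul, Finset.sum_ite_eq,
      Finset.mem_univ, if_true]
    rw [mul_comm b, sub_self, map_zero, zero_div]
  choose r hr using key
  refine ⟨basicOpen b, hbx, ⟨⟨r, d, B, b, hB, hb, fun _ h => h, hAB, fun l i y => ?_⟩⟩⟩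
  rw [hr, div_mul_cancel₀ _ (algebraMap_ne_zero_of_notMem y.2)]

namespace Frame

variable {P} {U : (PSpace n).Opens} (Φ : P.Frame U)

/-- The projection to the kernel of `A` fixes the kernel, so the coordinates of a section are also
its coefficients with respect to the frame. -/
theorem eq_sum (V : (PSpace n).Opens) (i : V ⟶ U) (s : Γ(E, V)) :
    s = ∑ j, P.coord V j s • E.presheaf.map i.op (Φ.r j) := by
  refine P.ext fun l => section_ext fun x => ?_
  refine mul_right_cancel₀ (algebraMap_ne_zero_of_notMem (Φ.hbU x.1 (i.le x.2))) ?_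
  change _ * toFrac n Φ.b = _ * toFrac n Φ.b
  simp only [map_sum, _root_.map_smul, smul_eq_mul, map_mul, P.ratAt_coord_map i _ l x (i x)]
  simp only [Finset.sum_mul, mul_assoc, Φ.coord_r, map_sub, mul_sub, Finset.sum_sub_distrib,
    map_sum, map_mul, Finset.mul_sum]
  rw [Finset.sum_comm, Finset.sum_eq_single l (fun j _ hj => by simp [hj.symm]) (by simp),
    if_pos rfl]
  refine (sub_eq_self.2 (Finset.sum_eq_zero fun j _ => ?_)).symm
  have := P.relation s x j
  rw [← mul_zero (toFrac n (Φ.B l j)), ← this, Finset.mul_sum]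
  exact Finset.sum_congr rfl fun i _ => by ring

/-- The difference of a constant vector `c` and of its projection to the kernel of `A` is
`b⁻¹ B A c`. -/
theorem ratAt_coord_sum_sub {c : Fin m → ℂ} {κ : Fin m → Γ(PSpace n, U)}
    (hκ : ∀ i x, ratAt x (κ i) = toFrac n (MvPolynomial.C (c i))) (l : Fin m) (x : U) :
    ratAt x (κ l - P.coord U l (∑ i, κ i • Φ.r i)) * toFrac n Φ.b =
      toFrac n (∑ j, Φ.B l j * mulConst A c j) := by
  simp only [map_sub, map_sum, _root_.map_smul, smul_eq_mul, map_mul, hκ, sub_mul, Finset.sum_mul,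
    mul_assoc, Φ.coord_r, mul_sub, Finset.sum_sub_distrib, mulConst, Finset.mul_sum]
  rw [Finset.sum_eq_single l (fun j _ hj => by simp [hj.symm]) (by simp), if_pos rfl,
    sub_sub_cancel, Finset.sum_comm]
  exact Finset.sum_congr rfl fun i _ => Finset.sum_congr rfl fun i _ => by ring

theorem sum_mem (hA : ∀ j i, A j i ∈ grading n 1) (c : Fin m → ℂ) (l : Fin m) :
    ∑ j, Φ.B l j * mulConst A c j ∈ grading n (Φ.d + 1) := by
  refine Submodule.sum_mem _ fun j _ => SetLike.mul_mem_graded (Φ.hB l j) ?_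
  refine Submodule.sum_mem _ fun i _ => ?_
  rw [mul_comm, ← MvPolynomial.smul_eq_C_mul]
  exact Submodule.smul_mem _ _ (hA j i)

variable (H : Hyperplane n)

theorem pull_eq_sum {V : H.subscheme.Opens} (i : V ⟶ H.ι ⁻¹ᵁ U)
    (t : Γ((Scheme.Modules.pullback H.ι).obj E, V)) :
    t = ∑ j, unitSection V ((pullFunctional H.ι (P.hom j)).app V t) •
      ((Scheme.Modules.pullback H.ι).obj E).presheaf.map i.op (pullSection H.ι E U (Φ.r j)) :=
  SteinerLog.pull_eq_sum H.ι P.hom Φ.r Φ.eq_sum i t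

theorem pull_ext (Φ : P.Frame U) {V : H.subscheme.Opens} (i : V ⟶ H.ι ⁻¹ᵁ U)
    {t t' : Γ((Scheme.Modules.pullback H.ι).obj E, V)}
    (h : ∀ j, (pullFunctional H.ι (P.hom j)).app V t = (pullFunctional H.ι (P.hom j)).app V t') :
    t = t' := by
  rw [Φ.pull_eq_sum H i t, Φ.pull_eq_sum H i t']
  simp only [h]

theorem pullFunctional_sum (κ : Fin m → Γ(PSpace n, U)) (l : Fin m) :
    unitSection _ ((pullFunctional H.ι (P.hom l)).app (H.ι ⁻¹ᵁ U)
      (pullSection H.ι E U (∑ i, κ i • Φ.r i))) =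
      H.ι.app U (P.coord U l (∑ i, κ i • Φ.r i)) := pullFunctional_pullSection _ _ _ _

end Frame

variable (H : Hyperplane n)

/-- A vector `c` with `A c = ℓ w`, where `ℓ` is the equation of the hyperplane, is the vector of
coordinates of a section of the restriction to the hyperplane: `c` and its projection to the kernel
of `A` differ by a multiple of `A c`, hence agree on the hyperplane. -/
theorem nontrivial_of_mulConst (P : Presentation E A) (hn : 1 ≤ n) (hA : ∀ j i, A j i ∈ grading n 1)
    (hA' : Nondegenerate A) {c : Fin m → ℂ} (hc : c ≠ 0) {w : Fin k → ℂ}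
    (hw : ∀ j, mulConst A c j = MvPolynomial.C (w j) * H.eqn) :
    Nontrivial Γ((Scheme.Modules.pullback H.ι).obj E, ⊤) := by
  choose K hK using fun i => exists_const (n := n) (c i) ⊤
  choose U hxU Φ using P.exists_frame hA hA'
  replace Φ := fun x => (Φ x).some
  let κ (x : PTop n) (i : Fin m) : Γ(PSpace n, U x) :=
    (PSpace n).presheaf.map (homOfLE (le_top : U x ≤ ⊤)).op (K i)
  have hκ : ∀ x i y, ratAt y (κ x i) = toFrac n (MvPolynomial.C (c i)) := fun x i y =>
    (ratAt_map _ _ _).trans (hK _ _)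
  let t (x : PTop n) : Γ((Scheme.Modules.pullback H.ι).obj E, H.ι ⁻¹ᵁ U x) :=
    pullSection H.ι E (U x) (∑ i, κ x i • (Φ x).r i)
  have ht : ∀ x l, unitSection _ ((pullFunctional H.ι (P.hom l)).app _ (t x)) =
      H.subscheme.presheaf.map (homOfLE (le_top : H.ι ⁻¹ᵁ U x ≤ ⊤)).op (H.ι.app ⊤ (K l)) := by
    intro x l
    have h2 : H.ι.app (U x) (κ x l - P.coord (U x) l (∑ i, κ x i • (Φ x).r i)) = 0 := by
      rw [H.app_eq_zero_iff]
      intro y hy hy'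
      have hyU := Scheme.basicOpen_le _ _ hy'
      refine (mem_basicOpen_iff _ ⟨y, hyU⟩ ((Φ x).sum_mem hA c l) (Φ x).hb ((Φ x).hbU y hyU)
        ((Φ x).ratAt_coord_sum_sub (hκ x) l _)).1 hy' (Ideal.sum_mem _ fun j _ => ?_)
      rw [hw, ← mul_assoc]
      exact Ideal.mul_mem_left _ _ hy
    rw [map_sub, sub_eq_zero] at h2
    refine ((Φ x).pullFunctional_sum H (κ x) l).trans (h2.symm.trans ?_)
    exact congr(($(H.ι.naturality (homOfLE (le_top : U x ≤ ⊤)).op)) (K l))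
  obtain ⟨t₀, ht₀⟩ := exists_glue ((Scheme.Modules.pullback H.ι).obj E) ⊤ (fun x => H.ι ⁻¹ᵁ U x)
    (fun _ => le_top) (fun y _ => ⟨H.ι y, hxU _⟩) t fun x y => by
      refine (Φ x).pull_ext H (homOfLE inf_le_left) fun l => ?_
      rw [app_map, app_map]
      have h1 := congrArg (H.subscheme.presheaf.map
        (homOfLE (inf_le_left : H.ι ⁻¹ᵁ U x ⊓ H.ι ⁻¹ᵁ U y ≤ _)).op) (ht x l)
      have h2 := congrArg (H.subscheme.presheaf.map
        (homOfLE (inf_le_right : H.ι ⁻¹ᵁ U x ⊓ H.ι ⁻¹ᵁ U y ≤ _)).op) (ht y l)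
      refine h1.trans (Eq.trans ?_ h2.symm)
      exact (map_map (structureModule H.subscheme) _ _ _).trans
        (map_map (structureModule H.subscheme) (homOfLE le_top) (homOfLE inf_le_right)
          (H.ι.app ⊤ (K l))).symm
  -- a nonzero coordinate of the glued section is a nonzero constant at the generic point of `H`
  refine ⟨t₀, 0, fun h0 => ?_⟩
  obtain ⟨l, hl⟩ : ∃ l, c l ≠ 0 := by
    by_contra! h
    exact hc (funext h)
  let x := H.genericPt hn
  have h1 := ht₀ x
  rw [h0, map_zero] at h1
  have h2 := ht x l
  rw [← h1, map_zero, map_zero] at h2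
  have h3 : H.ι.app (U x) (κ x l) = 0 :=
    (congr(($(H.ι.naturality (homOfLE (le_top : U x ≤ ⊤)).op)) (K l))).trans h2.symm
  refine (H.app_eq_zero_iff _).1 h3 x (Ideal.mem_span_singleton_self _) ?_
  refine (mem_basicOpen_iff (d := 0) (b := 1) _ ⟨x, hxU x⟩ (MvPolynomial.isHomogeneous_C _ (c l))
    (SetLike.one_mem_graded _) ((Ideal.ne_top_iff_one _).1 (Ideal.IsPrime.ne_top inferInstance))
    (by rw [hκ, map_one, mul_one])).2 fun h => ?_
  refine Ideal.IsPrime.ne_top (I := pointIdeal x) inferInstance (Ideal.eq_top_of_isUnit_mem _ h ?_)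
  exact (isUnit_iff_ne_zero.2 hl).map MvPolynomial.C

/-- The coordinates of a section of the restriction to a hyperplane are constants `c`, and on the
hyperplane `A c` vanishes. -/
theorem exists_mulConst_of_nontrivial (P : Presentation E A) (hn : 1 ≤ n)
    (hA : ∀ j i, A j i ∈ grading n 1)
    (hA' : Nondegenerate A) (hH : Nontrivial Γ((Scheme.Modules.pullback H.ι).obj E, ⊤)) :
    ∃ (c : Fin m → ℂ) (w : Fin k → ℂ), c ≠ 0 ∧
      ∀ j, mulConst A c j = MvPolynomial.C (w j) * H.eqn := by
  obtain ⟨t, ht⟩ := exists_ne (0 : Γ((Scheme.Modules.pullback H.ι).obj E, ⊤))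
  choose K hK using fun l => H.app_top_surjective hn
    (unitSection ⊤ ((pullFunctional H.ι (P.hom l)).app ⊤ t))
  choose c hc using fun l => exists_ratAt_eq_const hn (K l)
  have hloc : ∀ (U : (PSpace n).Opens) (Φ : P.Frame U),
      ((Scheme.Modules.pullback H.ι).obj E).presheaf.map (homOfLE (le_top : H.ι ⁻¹ᵁ U ≤ ⊤)).op t =
        pullSection H.ι E U (∑ i, (PSpace n).presheaf.map (homOfLE (le_top : U ≤ ⊤)).op (K i) •
          Φ.r i) := by
    intro U Φ
    rw [map_sum]
    refine (Φ.pull_eq_sum H (𝟙 _) _).trans (Finset.sum_congr rfl fun j _ => ?_)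
    rw [pullSection_smul]
    refine congrArg₂ (· • ·) ?_ (map_refl _ _ _)
    refine Eq.trans ?_ congr(($(H.ι.naturality (homOfLE (le_top : U ≤ ⊤)).op)) (K j)).symm
    refine Eq.trans ?_ (congrArg (H.subscheme.presheaf.map _) (hK j).symm)
    exact congrArg (unitSection _) (app_map _ _ _)
  have hc0 : c ≠ 0 := by
    rintro rfl
    refine ht (eq_of_locally_eq _ _ _ fun y _ => ?_)
    obtain ⟨U, hxU, ⟨Φ⟩⟩ := P.exists_frame hA hA' (H.ι y)
    refine ⟨H.ι ⁻¹ᵁ U, homOfLE le_top, hxU, ?_⟩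
    rw [hloc U Φ, map_zero, Finset.sum_eq_zero, map_zero]
    intro i _
    rw [show K i = 0 from section_ext fun x => by rw [hc]; simp, map_zero, zero_smul]
  obtain ⟨U, hxU, ⟨Φ⟩⟩ := P.exists_frame hA hA' (H.genericPt hn)
  set κ : Fin m → Γ(PSpace n, U) := fun i =>
    (PSpace n).presheaf.map (homOfLE (le_top : U ≤ ⊤)).op (K i) with hκ_def
  have hκ : ∀ i y, ratAt y (κ i) = toFrac n (MvPolynomial.C (c i)) := fun i y =>
    (ratAt_map _ _ _).trans (hc _ _)
  -- `c` equals its projection to the kernel on the hyperplane, so `B A c` vanishes there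
  have h1 : ∀ l, H.eqn ∣ ∑ j, Φ.B l j * mulConst A c j := by
    intro l
    have h2 : H.ι.app U (κ l - P.coord U l (∑ i, κ i • Φ.r i)) = 0 := by
      rw [map_sub, sub_eq_zero, ← Φ.pullFunctional_sum, ← hloc U Φ, app_map]
      refine (congr(($(H.ι.naturality (homOfLE (le_top : U ≤ ⊤)).op)) (K l))).trans ?_
      exact congrArg (H.subscheme.presheaf.map _) (hK l)
    rw [H.app_eq_zero_iff] at h2
    have h3 := h2 (H.genericPt hn) (Ideal.mem_span_singleton_self _)
    rw [mem_basicOpen_iff _ ⟨_, hxU⟩ (Φ.sum_mem hA c l) Φ.hb (Φ.hbU _ hxU)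
      (Φ.ratAt_coord_sum_sub hκ l _), not_not] at h3
    exact (H.mem_genericPt hn).1 h3
  -- multiply by `A` and cancel the denominator `b`
  have h2 : ∀ j, H.eqn ∣ mulConst A c j := by
    intro j
    have h3 : H.eqn ∣ Φ.b * mulConst A c j := by
      have h4 : Φ.b * mulConst A c j = ∑ l, A j l * ∑ j', Φ.B l j' * mulConst A c j' := by
        simp only [Finset.mul_sum]
        rw [Finset.sum_comm]
        have h5 : ∀ j', ∑ l, A j l * Φ.B l j' = if j = j' then Φ.b else 0 := fun j' => by
          have := congrFun (congrFun Φ.hAB j) j'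
          rw [Matrix.mul_apply] at this
          rw [this, Matrix.smul_apply, Matrix.one_apply]
          split_ifs <;> simp
        simp only [← mul_assoc, ← Finset.sum_mul, h5, ite_mul, zero_mul, Finset.sum_ite_eq,
          Finset.mem_univ, if_true]
      rw [h4]
      exact Finset.dvd_sum fun l _ => (h1 l).mul_left _
    refine (H.eqn_prime.dvd_or_dvd h3).resolve_left fun h4 => ?_
    exact Φ.hbU _ hxU ((H.mem_genericPt hn).2 h4)
  choose g hg using h2
  -- by degree, the quotient is a constant
  refine ⟨c, fun j => (g j).coeff 0, hc0, fun j => ?_⟩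
  by_cases hgj : g j = 0
  · simp [hg, hgj]
  have h3 : mulConst A c j ∈ grading n 1 := by
    refine Submodule.sum_mem _ fun i _ => ?_
    rw [mul_comm, ← MvPolynomial.smul_eq_C_mul]
    exact Submodule.smul_mem _ _ (hA j i)
  have h4 := MvPolynomial.IsHomogeneous.totalDegree h3 (by
    rw [hg]; exact mul_ne_zero H.eqn_ne_zero hgj)
  rw [hg, MvPolynomial.totalDegree_mul_of_isDomain H.eqn_ne_zero hgj,
    MvPolynomial.IsHomogeneous.totalDegree H.eqn_mem H.eqn_ne_zero] at h4
  rw [← MvPolynomial.totalDegree_eq_zero_iff_eq_C.1 (show (g j).totalDegree = 0 by omega), hg,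
    mul_comm]

end Presentation

end Unstable

/-! ### Differential forms on projective space -/

section FunctionField

open KaehlerDifferential

variable {n : ℕ}

/-- The inclusion of the rational functions in the field of fractions of the polynomial ring. -/
def fieldToFrac (n : ℕ) : FunctionField n →+* Frac n := stalkToFrac (genericPt n)

theorem fieldToFrac_injective : Function.Injective (fieldToFrac n) :=
  stalkToFrac_injective (genericPt n)

theorem toFrac_ne_zero {f : Pol n} (hf : f ≠ 0) : toFrac n f ≠ 0 :=
  (map_ne_zero_iff _ toFrac_injective).2 hf

theorem coe_ne_zero {d : ℕ} {b : grading n d} (hb : b ≠ 0) : (b : Pol n) ≠ 0 :=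
  fun h => hb (Subtype.ext h)

theorem fieldToFrac_ofFraction {d : ℕ} (a b : grading n d) (hb : b ≠ 0) :
    fieldToFrac n (FunctionField.ofFraction a b hb) = toFrac n a / toFrac n b := by
  rw [eq_div_iff (toFrac_ne_zero (coe_ne_zero hb))]
  exact stalkToFrac_mk (genericPt n) a b fun h => hb (Subtype.ext h)

theorem fieldToFrac_stalk (x : PTop n) (s : PStalk x) :
    fieldToFrac n (stalkToFunctionField x s) = stalkToFrac x s := by
  obtain ⟨⟨d, a, b, hb⟩, rfl⟩ := HomogeneousLocalization.mk_surjective s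
  refine mul_right_cancel₀ (algebraMap_ne_zero_of_notMem hb) ?_
  refine Eq.trans ?_ (stalkToFrac_mk x a b hb).symm
  exact stalkToFrac_mk (genericPt n) a b fun h => hb ((bot_le : ⊥ ≤ pointIdeal x) h)

theorem fieldToFrac_algebraMap (c : ℂ) :
    fieldToFrac n (algebraMap ℂ (FunctionField n) c) = toFrac n (MvPolynomial.C c) := by
  have := stalkToFrac_mk (genericPt n) (algebraMap ℂ (grading n 0) c) 1
    ((Ideal.ne_top_iff_one _).1 (Ideal.IsPrime.ne_top inferInstance))
  refine Eq.trans ?_ this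
  refine Eq.trans ?_ (congrArg (_ * ·) (map_one (algebraMap (Pol n) (Frac n))).symm)
  rw [mul_one]
  rfl

instance : Algebra (FunctionField n) (Frac n) := (fieldToFrac n).toAlgebra

theorem algebraMap_functionField (z : FunctionField n) :
    algebraMap (FunctionField n) (Frac n) z = fieldToFrac n z := rfl

instance : IsScalarTower ℂ (FunctionField n) (Frac n) :=
  IsScalarTower.of_algebraMap_eq fun c => (fieldToFrac_algebraMap c).symm

instance : Nontrivial (FunctionField n) := (fieldToFrac n).domain_nontrivial

theorem ofFraction_mul_ofFraction {d : ℕ} {a b : grading n d} (ha : a ≠ 0) (hb : b ≠ 0) :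
    FunctionField.ofFraction a b hb * FunctionField.ofFraction b a ha = 1 := by
  refine fieldToFrac_injective ?_
  have h1 := toFrac_ne_zero (coe_ne_zero ha)
  have h2 := toFrac_ne_zero (coe_ne_zero hb)
  rw [map_mul, fieldToFrac_ofFraction, fieldToFrac_ofFraction, map_one]
  field_simp

theorem ofFraction_mul {d : ℕ} (a : grading n d) {b c : grading n d} (hb : b ≠ 0) (hc : c ≠ 0) :
    FunctionField.ofFraction a b hb * FunctionField.ofFraction b c hc =
      FunctionField.ofFraction a c hc := by
  refine fieldToFrac_injective ?_
  have h1 := toFrac_ne_zero (coe_ne_zero hb)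
  have h2 := toFrac_ne_zero (coe_ne_zero hc)
  rw [map_mul, fieldToFrac_ofFraction, fieldToFrac_ofFraction, fieldToFrac_ofFraction]
  field_simp

theorem exists_stalk_ofFraction (x : PTop n) {d : ℕ} (a b : grading n d)
    (hb : (b : Pol n) ∉ pointIdeal x) : ∃ s : PStalk x,
      stalkToFunctionField x s = FunctionField.ofFraction a b (ne_zero_of_notMem hb) :=
  ⟨HomogeneousLocalization.mk ⟨d, a, b, hb⟩, rfl⟩

theorem isRegularAt_fieldToFrac_iff {x : PTop n} {z : FunctionField n} :
    IsRegularAt 0 x (fieldToFrac n z) ↔ z ∈ (stalkToFunctionField x).range := by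
  constructor
  · intro h
    obtain ⟨s, hs⟩ := h.exists_stalk
    exact ⟨s, fieldToFrac_injective (by rw [fieldToFrac_stalk, hs])⟩
  · rintro ⟨s, rfl⟩
    rw [fieldToFrac_stalk]
    exact stalkToFrac_isRegularAt x s

/-! ### Logarithmic derivatives of linear forms -/

theorem ofFraction_smul_dlog {l m : grading n 1} (hl : l ≠ 0) (hm : m ≠ 0) :
    FunctionField.ofFraction l m hm • dlog l m hl hm =
      D ℂ (FunctionField n) (FunctionField.ofFraction l m hm) := by
  rw [dlog, smul_smul, ofFraction_mul_ofFraction, one_smul]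

theorem dlog_add {l p m : grading n 1} (hl : l ≠ 0) (hp : p ≠ 0) (hm : m ≠ 0) :
    dlog l p hl hp + dlog p m hp hm = dlog l m hl hm := by
  simp only [dlog]
  rw [← ofFraction_mul l hp hm, ← ofFraction_mul m hp hl, Derivation.leibniz, smul_add, smul_smul,
    smul_smul]
  have h1 := ofFraction_mul_ofFraction hl hp
  have h2 := ofFraction_mul_ofFraction hm hp
  rw [add_comm]
  congr 2
  · rw [mul_assoc, mul_comm (FunctionField.ofFraction p l hl), h1, mul_one]
  · rw [mul_right_comm, h2, one_mul]

theorem dlog_self {l : grading n 1} (hl : l ≠ 0) : dlog l l hl hl = 0 := by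
  have h := dlog_add hl hl hl
  simpa using h

/-- A homogeneous coordinate as a linear form. -/
def coordForm (i : Fin (n + 1)) : grading n 1 :=
  ⟨MvPolynomial.X i, MvPolynomial.isHomogeneous_X ℂ i⟩

/-- Dehomogenization of a form of degree `d` with respect to a linear form `t`. -/
theorem aeval_ofFraction {t : grading n 1} (ht : t ≠ 0) {d : ℕ} (a : grading n d) :
    fieldToFrac n (MvPolynomial.aeval (fun i => FunctionField.ofFraction
      (coordForm i) t ht) a.1) =
      toFrac n a / toFrac n t ^ d := by
  have ht0 := toFrac_ne_zero (coe_ne_zero ht)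
  rw [eq_div_iff (pow_ne_zero _ ht0), MvPolynomial.aeval_def, MvPolynomial.eval₂_eq, map_sum,
    Finset.sum_mul]
  conv_rhs => rw [a.1.as_sum, map_sum]
  refine Finset.sum_congr rfl fun m hm => ?_
  have hd : ∑ i ∈ m.support, m i = d := by
    have := a.2 (MvPolynomial.mem_support_iff.1 hm)
    rw [Finsupp.weight_apply, Finsupp.sum] at this
    simpa using this
  have ht1 : toFrac n t ^ d = ∏ i ∈ m.support, toFrac n t ^ m i := by
    rw [Finset.prod_pow_eq_pow_sum, hd]
  rw [ht1, MvPolynomial.monomial_eq, map_mul, map_mul, fieldToFrac_algebraMap, mul_assoc,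
    Finsupp.prod, map_prod, map_prod, ← Finset.prod_mul_distrib]
  congr 1
  refine Finset.prod_congr rfl fun i _ => ?_
  rw [map_pow, fieldToFrac_ofFraction, ← mul_pow, div_mul_cancel₀ _ ht0, map_pow]
  rfl

theorem smul_form_mem {x : PTop n} {N : Submodule (PStalk x) (RationalForm x)}
    {z : FunctionField n} (hz : z ∈ (stalkToFunctionField x).range) {η : Ω[FunctionField n⁄ℂ]}
    (hη : η ∈ N) : z • η ∈ N := by
  obtain ⟨s, rfl⟩ := hz
  exact N.smul_mem s hη

/-- If a module of rational forms contains the differentials of the quotients `X i / t`, where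
`t(x) ≠ 0`, then it contains the differentials of all regular functions at `x`. -/
theorem D_mem_of_coordinates {x : PTop n} (N : Submodule (PStalk x) (RationalForm x))
    {t : grading n 1} (ht : (t : Pol n) ∉ pointIdeal x)
    (hN : ∀ i, D ℂ (FunctionField n) (FunctionField.ofFraction
      (coordForm i) t (ne_zero_of_notMem ht)) ∈ N)
    (f : PStalk x) : D ℂ (FunctionField n) (stalkToFunctionField x f) ∈ N := by
  have ht' := ne_zero_of_notMem ht
  let R : Subalgebra ℂ (FunctionField n) :=
    { carrier := {z | z ∈ (stalkToFunctionField x).range ∧ D ℂ (FunctionField n) z ∈ N}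
      add_mem' := fun {a b} ha hb => ⟨add_mem ha.1 hb.1, by
        rw [map_add]; exact N.add_mem ha.2 hb.2⟩
      mul_mem' := fun {a b} ha hb => ⟨mul_mem ha.1 hb.1, by
        rw [Derivation.leibniz]
        exact N.add_mem (smul_form_mem ha.1 hb.2) (smul_form_mem hb.1 ha.2)⟩
      algebraMap_mem' := fun c => ⟨by
        rw [← isRegularAt_fieldToFrac_iff, fieldToFrac_algebraMap]
        exact isRegularAt_of_mem (MvPolynomial.isHomogeneous_C _ c) x, by
        rw [Derivation.map_algebraMap]; exact N.zero_mem⟩ }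
  have hR : ∀ p : Pol n, MvPolynomial.aeval (fun i => FunctionField.ofFraction
      (coordForm i) t ht') p ∈ R := by
    intro p
    have h1 : (MvPolynomial.aeval (fun i => FunctionField.ofFraction
      (coordForm i) t ht')).range ≤ R := by
      rw [MvPolynomial.aeval_range]
      refine Algebra.adjoin_le ?_
      rintro _ ⟨i, rfl⟩
      exact ⟨exists_stalk_ofFraction x (coordForm i) t ht, hN i⟩
    exact h1 ⟨p, rfl⟩
  obtain ⟨⟨d, a, b, hb⟩, rfl⟩ := HomogeneousLocalization.mk_surjective f
  have ht0 := toFrac_ne_zero (coe_ne_zero ht')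
  have hb0 := algebraMap_ne_zero_of_notMem hb
  -- the fraction is `f₁ g` with `f₁ = a / t ^ d`, `f₂ = b / t ^ d` and `f₂ g = 1`
  set f₁ := MvPolynomial.aeval (fun i => FunctionField.ofFraction
      (coordForm i) t ht') a.1
  set f₂ := MvPolynomial.aeval (fun i => FunctionField.ofFraction
      (coordForm i) t ht') b.1
  have hg : IsRegularAt 0 x (toFrac n t ^ d / toFrac n b) := by
    rw [← map_pow]
    exact isRegularAt_div (d := 0) (by simpa using SetLike.pow_mem_graded d t.2) b.2 hb
  obtain ⟨g, hg⟩ := hg.exists_stalk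
  have h1 : stalkToFunctionField x g * f₂ = 1 := fieldToFrac_injective (by
    rw [map_mul, aeval_ofFraction ht' b, fieldToFrac_stalk, hg, map_one]
    field_simp)
  have h2 : stalkToFunctionField x (HomogeneousLocalization.mk ⟨d, a, b, hb⟩) =
      f₁ * stalkToFunctionField x g := fieldToFrac_injective (by
    rw [map_mul, aeval_ofFraction ht' a, fieldToFrac_stalk, fieldToFrac_stalk, hg]
    refine mul_right_cancel₀ hb0 ((stalkToFrac_mk x a b hb).trans ?_)
    change toFrac n a = _ * toFrac n b
    have : toFrac n b ≠ 0 := hb0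
    field_simp)
  have h3 : D ℂ (FunctionField n) (stalkToFunctionField x g) ∈ N := by
    rw [Derivation.leibniz_of_mul_eq_one _ h1]
    refine smul_form_mem (neg_mem (pow_mem (RingHom.mem_range_self _ g) 2)) (hR b.1).2
  rw [h2, Derivation.leibniz]
  exact N.add_mem (smul_form_mem (hR a.1).1 h3) (smul_form_mem ⟨g, rfl⟩ (hR a.1).2)

end FunctionField

/-! ### Bases of logarithmic forms -/

section Derivations

open KaehlerDifferential

variable {n : ℕ}

/-- Derivations of the polynomial ring extend to its field of fractions. -/
theorem exists_derivation_extension (d : Derivation ℂ (Pol n) (Frac n)) :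
    ∃ d' : Derivation ℂ (Frac n) (Frac n), ∀ f, d' (toFrac n f) = d f := by
  let M := nonZeroDivisors (Pol n)
  let g := KaehlerDifferential.map ℂ ℂ (Pol n) (Frac n)
  have h : ∀ x : M, IsUnit (algebraMap (Pol n) (Module.End (Pol n) (Frac n)) x) :=
    fun x => IsLocalizedModule.map_units (S := M) (Algebra.linearMap (Pol n) (Frac n)) x
  let L : Ω[Frac n⁄ℂ] →ₗ[Pol n] Frac n := IsLocalizedModule.lift M g d.liftKaehlerDifferential h
  let L' : Ω[Frac n⁄ℂ] →ₗ[Frac n] Frac n := L.extendScalarsOfIsLocalization M (Frac n)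
  refine ⟨L'.compDer (D ℂ (Frac n)), fun f => ?_⟩
  have h1 : L (g (D ℂ (Pol n) f)) = d.liftKaehlerDifferential (D ℂ (Pol n) f) :=
    IsLocalizedModule.lift_apply M g _ h _
  rw [KaehlerDifferential.map_D, Derivation.liftKaehlerDifferential_comp_D] at h1
  exact h1

/-- The linear function on forms defined by the vector field `t ∂/∂p`, where `t` is a linear form
and `p` a vector. -/
theorem exists_contraction (p : Fin (n + 1) → ℂ) (t : Pol n) :
    ∃ L : Ω[FunctionField n⁄ℂ] →ₗ[FunctionField n] Frac n, ∀ (l m : grading n 1) (hl : l ≠ 0)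
      (hm : m ≠ 0), L (dlog l m hl hm) =
        toFrac n (MvPolynomial.C (evalLinear n l p)) * toFrac n t / toFrac n l -
        toFrac n (MvPolynomial.C (evalLinear n m p)) * toFrac n t / toFrac n m := by
  let d : Derivation ℂ (Pol n) (Frac n) := MvPolynomial.mkDerivation ℂ fun i =>
    toFrac n (MvPolynomial.C (p i) * t)
  have hd : ∀ l : grading n 1, d l.1 =
      toFrac n (MvPolynomial.C (evalLinear n l p)) * toFrac n t := by
    intro l
    rw [evalLinear_apply]
    have hl := mem_span_X l.2
    generalize l.1 = f at hl
    induction hl using Submodule.span_induction with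
    | mem f hf =>
      obtain ⟨i, rfl⟩ := hf
      rw [MvPolynomial.eval_X, ← map_mul]
      exact MvPolynomial.mkDerivation_X _ _ _
    | zero => simp
    | add f g _ _ hf hg => rw [map_add, hf, hg]; simp [add_mul]
    | smul c f _ hf =>
      rw [Derivation.map_smul, hf, MvPolynomial.smul_eval, map_mul, map_mul, mul_assoc,
        Algebra.smul_def]
      rfl
  obtain ⟨d', hd'⟩ := exists_derivation_extension d
  let δ : Derivation ℂ (FunctionField n) (Frac n) := d'.compAlgebraMap (FunctionField n)
  refine ⟨δ.liftKaehlerDifferential, fun l m hl hm => ?_⟩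
  have h1 : δ (FunctionField.ofFraction l m hm) = d' (toFrac n l / toFrac n m) :=
    congrArg d' (fieldToFrac_ofFraction l m hm)
  rw [dlog, _root_.map_smul, Derivation.liftKaehlerDifferential_comp_D, h1, Derivation.leibniz_div,
    hd', hd', hd, hd, Algebra.smul_def, algebraMap_functionField, fieldToFrac_ofFraction]
  have h1 := toFrac_ne_zero (coe_ne_zero hl)
  have h2 := toFrac_ne_zero (coe_ne_zero hm)
  simp only [smul_eq_mul]
  field_simp

end Derivations

section LogBasis

open KaehlerDifferential Module

variable {n : ℕ} (b : Basis (Fin (n + 1)) ℂ (grading n 1))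

/-- The forms `d(b (j + 1) / b 0) / (b (j + 1) / b 0)`. -/
def logVec (j : Fin n) : Ω[FunctionField n⁄ℂ] :=
  dlog (b j.succ) (b 0) (b.ne_zero _) (b.ne_zero _)

theorem exists_dual_point (j : Fin (n + 1)) : ∃ p : Fin (n + 1) → ℂ, ∀ i,
    evalLinear n (b i) p = if i = j then 1 else 0 := by
  obtain ⟨p, hp⟩ := (evalEquiv ℂ (Fin (n + 1) → ℂ)).surjective
    ((b.coord j).comp (evalLinearEquiv n).symm.toLinearMap)
  refine ⟨p, fun i => ?_⟩
  have h1 := congr($hp (evalLinear n (b i)))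
  rw [Module.evalEquiv_apply] at h1
  refine h1.trans ?_
  have h2 : (evalLinearEquiv n).symm (evalLinear n (b i)) = b i :=
    (evalLinearEquiv n).symm_apply_apply (b i)
  simp only [LinearMap.comp_apply, LinearEquiv.coe_coe, h2, Basis.coord_apply, Basis.repr_self,
    Finsupp.single_apply]

theorem linearIndependent_logVec : LinearIndependent (FunctionField n) (logVec b) := by
  rw [Fintype.linearIndependent_iff]
  intro g hg j
  obtain ⟨p, hp⟩ := exists_dual_point b j.succ
  obtain ⟨L, hL⟩ := exists_contraction p (b j.succ)
  have h1 := congrArg L hg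
  have h2 : ∀ i, L (logVec b i) = if i = j then 1 else 0 := by
    intro i
    rw [logVec, hL, hp, hp, if_neg (Fin.succ_ne_zero j).symm]
    simp only [Fin.succ_inj]
    split_ifs with h
    · subst h
      simp [div_self (toFrac_ne_zero (coe_ne_zero (b.ne_zero i.succ)))]
    · simp
  rw [map_sum, map_zero] at h1
  simp only [_root_.map_smul, h2, smul_ite, smul_zero, Finset.sum_ite_eq', Finset.mem_univ,
    if_true] at h1
  refine fieldToFrac_injective ?_
  rw [map_zero, ← h1, Algebra.smul_def, mul_one]
  rfl

theorem ofFraction_eq_sum (l : grading n 1) : FunctionField.ofFraction l (b 0) (b.ne_zero 0) =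
    ∑ i, algebraMap ℂ (FunctionField n) (b.repr l i) *
      FunctionField.ofFraction (b i) (b 0) (b.ne_zero 0) := by
  refine fieldToFrac_injective ?_
  rw [map_sum, fieldToFrac_ofFraction]
  conv_lhs => rw [← b.sum_repr l]
  simp only [map_mul, fieldToFrac_algebraMap, fieldToFrac_ofFraction, mul_div_assoc']
  rw [← Finset.sum_div, AddSubmonoidClass.coe_finsetSum, map_sum]
  simp [MvPolynomial.smul_eq_C_mul]

theorem D_ofFraction (l : grading n 1) :
    D ℂ (FunctionField n) (FunctionField.ofFraction l (b 0) (b.ne_zero 0)) =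
      ∑ j : Fin n, (algebraMap ℂ (FunctionField n) (b.repr l j.succ) *
        FunctionField.ofFraction (b j.succ) (b 0) (b.ne_zero 0)) • logVec b j := by
  have h0 : FunctionField.ofFraction (b 0) (b 0) (b.ne_zero 0) = 1 := fieldToFrac_injective (by
    rw [fieldToFrac_ofFraction, map_one, div_self (toFrac_ne_zero (coe_ne_zero (b.ne_zero 0)))])
  rw [ofFraction_eq_sum, map_sum, Fin.sum_univ_succ, h0, mul_one, Derivation.map_algebraMap,
    zero_add]
  refine Finset.sum_congr rfl fun j _ => ?_
  rw [Derivation.leibniz, Derivation.map_algebraMap, smul_zero, add_zero, logVec, mul_smul,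
    ofFraction_smul_dlog]

theorem dlog_eq_sum (l : grading n 1) (hl : l ≠ 0) :
    dlog l (b 0) hl (b.ne_zero 0) =
      ∑ j : Fin n, (FunctionField.ofFraction (b 0) l hl * (algebraMap ℂ (FunctionField n)
        (b.repr l j.succ) * FunctionField.ofFraction (b j.succ) (b 0) (b.ne_zero 0))) •
          logVec b j := by
  rw [dlog, D_ofFraction, Finset.smul_sum]
  exact Finset.sum_congr rfl fun j _ => smul_smul _ _ _

/-- The module generated by the forms `logVec b j` over the local ring at `x`. -/
def logSpan (x : PTop n) : Submodule (PStalk x) (RationalForm x) :=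
  Submodule.span (PStalk x) (Set.range fun j => (logVec b j : RationalForm x))

theorem D_mem_logSpan {x : PTop n} (hb : (b 0 : Pol n) ∉ pointIdeal x) (f : PStalk x) :
    D ℂ (FunctionField n) (stalkToFunctionField x f) ∈ logSpan b x := by
  refine D_mem_of_coordinates _ hb (fun i => ?_) f
  have := D_ofFraction b (coordForm i)
  rw [this]
  refine (logSpan b x).sum_mem fun j _ => ?_
  refine smul_form_mem (mul_mem ?_ ?_) (Submodule.subset_span ⟨j, rfl⟩)
  · rw [← isRegularAt_fieldToFrac_iff, fieldToFrac_algebraMap]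
    exact isRegularAt_of_mem (MvPolynomial.isHomogeneous_C _ _) x
  · exact exists_stalk_ofFraction x _ _ hb

theorem dlog_mem_logSpan {x : PTop n} (hb : (b 0 : Pol n) ∉ pointIdeal x) {l m : grading n 1}
    (hl : (l : Pol n) ∉ pointIdeal x) (hm : (m : Pol n) ∉ pointIdeal x) :
    dlog l m (ne_zero_of_notMem hl) (ne_zero_of_notMem hm) ∈ logSpan b x := by
  obtain ⟨s, hs⟩ := exists_stalk_ofFraction x l m hm
  obtain ⟨t, ht⟩ := exists_stalk_ofFraction x m l hl
  have h1 := D_mem_logSpan b hb s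
  rw [hs] at h1
  exact smul_form_mem ⟨t, ht⟩ h1

/-- A basis of the linear forms is adapted to a finite set of hyperplanes at `x` if its first member
does not vanish at `x` and the other ones include the equations of the hyperplanes through `x`. -/
structure IsAdapted (𝓗 : Finset (Hyperplane n)) (x : PTop n) : Prop where
  notMem : (b 0 : Pol n) ∉ pointIdeal x
  exists_eq : ∀ H ∈ 𝓗, H.eqn ∈ pointIdeal x → ∃ j : Fin n, b j.succ = H.rep

variable {b}

theorem IsAdapted.logStalk_le {𝓗 : Finset (Hyperplane n)} {x : PTop n} (h : IsAdapted b 𝓗 x) :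
    logStalk 𝓗 x ≤ logSpan b x := by
  refine Submodule.span_le.2 ?_
  rintro η (⟨f, rfl⟩ | ⟨H, hH, m, hm, rfl⟩)
  · exact D_mem_logSpan b h.notMem f
  · by_cases hHx : H.eqn ∈ pointIdeal x
    · obtain ⟨j, hj⟩ := h.exists_eq H hH hHx
      have h1 := dlog_add H.rep_nonzero (b.ne_zero 0) (ne_zero_of_notMem hm)
      rw [← h1]
      refine (logSpan b x).add_mem (Submodule.subset_span ⟨j, ?_⟩)
        (dlog_mem_logSpan b h.notMem h.notMem hm)
      simp only [logVec, hj]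
      rfl
    · exact dlog_mem_logSpan b h.notMem hHx hm

theorem logVec_mem_logStalk {𝓗 : Finset (Hyperplane n)} {x : PTop n}
    (h : (b 0 : Pol n) ∉ pointIdeal x) {j : Fin n}
    (hj : (∃ H ∈ 𝓗, H.rep = b j.succ) ∨ (b j.succ : Pol n) ∉ pointIdeal x) :
    logVec b j ∈ logStalk 𝓗 x := by
  rcases hj with ⟨H, hH, hj⟩ | hj
  · refine Submodule.subset_span (Or.inr ⟨H, hH, b 0, h, ?_⟩)
    simp only [logVec, hj]
    rfl
  · obtain ⟨s, hs⟩ := exists_stalk_ofFraction x (b j.succ) (b 0) h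
    obtain ⟨t, ht⟩ := exists_stalk_ofFraction x (b 0) (b j.succ) hj
    refine smul_form_mem ⟨t, ht⟩ (Submodule.subset_span (Or.inl ⟨s, ?_⟩))
    rw [hs]

variable (b)

/-- The forms `logVec b j` as a basis of the rational forms. -/
def logBasis : Basis (Fin n) (FunctionField n) Ω[FunctionField n⁄ℂ] :=
  Basis.mk (linearIndependent_logVec b) (by
    rw [← KaehlerDifferential.span_range_derivation, Submodule.span_le]
    rintro _ ⟨f, rfl⟩
    have hb : (b 0 : Pol n) ∉ pointIdeal (genericPt n) := coe_ne_zero (b.ne_zero 0)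
    have h1 := D_mem_logSpan b hb (show PStalk (genericPt n) from f)
    have h2 : stalkToFunctionField (genericPt n) (show PStalk (genericPt n) from f) = f :=
      fieldToFrac_injective (fieldToFrac_stalk _ _)
    rw [h2] at h1
    have h3 : ∀ η : RationalForm (genericPt n), η ∈ logSpan b (genericPt n) →
        (show Ω[FunctionField n⁄ℂ] from η) ∈
          Submodule.span (FunctionField n) (Set.range (logVec b)) := by
      intro η hη
      induction hη using Submodule.span_induction with
      | mem η hη => exact Submodule.subset_span hη
      | zero => exact zero_mem _
      | add η η' _ _ h h' => exact add_mem h h'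
      | smul c η _ h => exact Submodule.smul_mem _ _ h
    exact h3 _ h1)

theorem logBasis_apply (j : Fin n) : logBasis b j = logVec b j := Basis.mk_apply _ _ _

theorem mem_logSpan_iff {x : PTop n} {η : Ω[FunctionField n⁄ℂ]} :
    η ∈ logSpan b x ↔ ∀ j, (logBasis b).repr η j ∈ (stalkToFunctionField x).range := by
  constructor
  · let N : Submodule (PStalk x) (RationalForm x) :=
      { carrier := {η | ∀ j, (logBasis b).repr (show Ω[FunctionField n⁄ℂ] from η) j ∈
          (stalkToFunctionField x).range}
        zero_mem' := fun j => by
          change (logBasis b).repr (0 : Ω[FunctionField n⁄ℂ]) j ∈ _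
          rw [map_zero]
          exact zero_mem _
        add_mem' := fun {η η'} h h' j => by
          change (logBasis b).repr ((show Ω[FunctionField n⁄ℂ] from η) +
            (show Ω[FunctionField n⁄ℂ] from η')) j ∈ _
          rw [map_add]
          exact add_mem (h j) (h' j)
        smul_mem' := fun c η h j => by
          change (logBasis b).repr (stalkToFunctionField x c •
            (show Ω[FunctionField n⁄ℂ] from η)) j ∈ _
          rw [_root_.map_smul]
          exact mul_mem ⟨c, rfl⟩ (h j) }
    have hN : logSpan b x ≤ N := by
      refine Submodule.span_le.2 ?_
      rintro _ ⟨i, rfl⟩ j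
      change (logBasis b).repr (logVec b i) j ∈ _
      rw [← logBasis_apply, Basis.repr_self, Finsupp.single_apply]
      split_ifs
      · exact one_mem _
      · exact zero_mem _
    exact fun h => hN h
  · intro h
    rw [← (logBasis b).sum_repr η]
    refine (logSpan b x).sum_mem fun j _ => smul_form_mem (h j) (Submodule.subset_span ⟨j, ?_⟩)
    exact (logBasis_apply b j).symm

end LogBasis

/-! ### Sections of the sheaf of logarithmic forms -/

section LogSections

open KaehlerDifferential Module

variable {n : ℕ} {U V : (PSpace n).Opens}

/-- The rational function defined by a regular function on a neighbourhood of `x`. -/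
def funAt (x : U) : Γ(PSpace n, U) →+* FunctionField n where
  toFun s := stalkToFunctionField x.1 (evalAt s x)
  map_one' := map_one (stalkToFunctionField x.1)
  map_zero' := map_zero (stalkToFunctionField x.1)
  map_mul' s t := map_mul (stalkToFunctionField x.1) (evalAt s x) (evalAt t x)
  map_add' s t := map_add (stalkToFunctionField x.1) (evalAt s x) (evalAt t x)

theorem fieldToFrac_funAt (x : U) (s : Γ(PSpace n, U)) : fieldToFrac n (funAt x s) = ratAt x s :=
  fieldToFrac_stalk _ _

theorem funAt_eq (s : Γ(PSpace n, U)) (x y : U) : funAt x s = funAt y s :=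
  fieldToFrac_injective (by rw [fieldToFrac_funAt, fieldToFrac_funAt, ratAt_eq])

theorem funAt_mem (s : Γ(PSpace n, U)) (x y : U) :
    funAt x s ∈ (stalkToFunctionField y.1).range := by
  rw [funAt_eq s x y]
  exact ⟨_, rfl⟩

theorem funAt_map (i : V ⟶ U) (s : Γ(PSpace n, U)) (x : V) :
    funAt x ((PSpace n).presheaf.map i.op s) = funAt (i x) s := rfl

theorem funAt_injective (x : U) : Function.Injective (funAt x) := fun s t h =>
  ratAt_injective x (by rw [← fieldToFrac_funAt, ← fieldToFrac_funAt, h])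

theorem exists_funAt {z : FunctionField n} (hz : ∀ x ∈ U, z ∈ (stalkToFunctionField x).range) :
    ∃ s : Γ(PSpace n, U), ∀ x : U, funAt x s = z := by
  obtain ⟨s, hs⟩ := exists_section (U := U) (z := fieldToFrac n z) fun x =>
    isRegularAt_fieldToFrac_iff.2 (hz x.1 x.2)
  exact ⟨s, fun x => fieldToFrac_injective (by rw [fieldToFrac_funAt, hs])⟩

variable {𝓗 : Finset (Hyperplane n)}

/-- The rational form defined by a section on a neighbourhood of `x`. -/
def formAt (x : U) : Γ(logForms 𝓗, U) →+ Ω[FunctionField n⁄ℂ] where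
  toFun s := (show functionSections (logPredicate_isLinear 𝓗) U from s).1 x
  map_zero' := rfl
  map_add' _ _ := rfl

theorem formAt_map (i : V ⟶ U) (s : Γ(logForms 𝓗, U)) (x : V) :
    formAt x ((logForms 𝓗).presheaf.map i.op s) = formAt (i x) s := rfl

theorem formAt_smul (x : U) (r : Γ(PSpace n, U)) (s : Γ(logForms 𝓗, U)) :
    formAt x (r • s) = funAt x r • formAt x s := rfl

theorem exists_constant_form (s : Γ(logForms 𝓗, U)) (x : U) :
    ∃ (V : (PSpace n).Opens) (_ : x.1 ∈ V) (i : V ⟶ U) (η : Ω[FunctionField n⁄ℂ]),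
      ∀ y : V, formAt (i y) s = η ∧ η ∈ logStalk 𝓗 y.1 := by
  obtain ⟨V, hV, i, η, h⟩ := (show functionSections (logPredicate_isLinear 𝓗) U from s).2 x
  refine ⟨V, hV, i, η, fun y => ⟨(h y).1, ?_⟩⟩
  have h1 := (h y).2
  rw [(h y).1] at h1
  exact h1

theorem formAt_mem (s : Γ(logForms 𝓗, U)) (x : U) : formAt x s ∈ logStalk 𝓗 x.1 := by
  obtain ⟨V, hV, i, η, h⟩ := exists_constant_form s x
  have h1 := h ⟨x.1, hV⟩
  have h2 : formAt x s = η := h1.1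
  rw [h2]
  exact h1.2

theorem formAt_eq (s : Γ(logForms 𝓗, U)) (x y : U) : formAt x s = formAt y s := by
  have key : ∀ x : U, formAt x s = formAt ⟨genericPt n, genericPt_mem x.2⟩ s := fun x => by
    obtain ⟨V, hV, i, η, h⟩ := exists_constant_form s x
    exact (h ⟨x.1, hV⟩).1.trans (h ⟨genericPt n, genericPt_mem hV⟩).1.symm
  exact (key x).trans (key y).symm

theorem form_ext {s t : Γ(logForms 𝓗, U)} (h : ∀ x : U, formAt x s = formAt x t) : s = t :=
  Subtype.ext (funext h)

theorem exists_formAt {η : Ω[FunctionField n⁄ℂ]} (h : ∀ x ∈ U, η ∈ logStalk 𝓗 x) :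
    ∃ s : Γ(logForms 𝓗, U), ∀ x : U, formAt x s = η :=
  ⟨⟨fun _ => η, fun x => ⟨U, x.2, 𝟙 U, η, fun y => ⟨rfl, h y.1 y.2⟩⟩⟩, fun _ => rfl⟩

theorem IsAdapted.exists_open {b : Basis (Fin (n + 1)) ℂ (grading n 1)} {x : PTop n}
    (h : IsAdapted b 𝓗 x) : ∃ U : (PSpace n).Opens, x ∈ U ∧ ∀ y ∈ U, IsAdapted b 𝓗 y := by
  classical
  refine ⟨basicOpen ((b 0 : Pol n) * ∏ H ∈ 𝓗 with H.eqn ∉ pointIdeal x, H.eqn), ?_, fun y hy => ?_⟩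
  · refine mul_notMem h.notMem fun hm => ?_
    obtain ⟨H, hH, hHx⟩ := (Ideal.IsPrime.prod_mem_iff (p := pointIdeal x)).1 hm
    exact (Finset.mem_filter.1 hH).2 hHx
  · rw [mem_basicOpen] at hy
    refine ⟨fun hm => hy (Ideal.mul_mem_right _ _ hm), fun H hH hHy => h.exists_eq H hH ?_⟩
    by_contra hHx
    exact hy (Ideal.mul_mem_left _ _ (Ideal.prod_mem _ (Finset.mem_filter.2 ⟨hH, hHx⟩) hHy))

/-- Near a point where a basis of linear forms taken from `𝓗` is adapted to `𝓗`, it defines a basis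
of the logarithmic forms. -/
theorem isLocalBasis_logForms {b : Basis (Fin (n + 1)) ℂ (grading n 1)}
    (hU : ∀ x ∈ U, IsAdapted b 𝓗 x) {e : Fin n → Γ(logForms 𝓗, U)}
    (he : ∀ j x, formAt x (e j) = logVec b j) : IsLocalBasis (logForms 𝓗) e := by
  intro V h
  have key : ∀ (c : Fin n → Γ(PSpace n, V)) (x : V),
      formAt x (∑ i, c i • (logForms 𝓗).presheaf.map (homOfLE h).op (e i)) =
        ∑ i, funAt x (c i) • logBasis b i := by
    intro c x
    rw [map_sum]
    refine Finset.sum_congr rfl fun i _ => ?_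
    rw [formAt_smul, formAt_map, he, logBasis_apply]
  constructor
  · intro c c' hc
    funext j
    refine section_ext fun x => ?_
    have h1 := congrArg (formAt x) hc
    simp only [key] at h1
    have h2 := congr((logBasis b).repr $h1 j)
    rw [Basis.repr_sum_self, Basis.repr_sum_self] at h2
    rw [← fieldToFrac_funAt, h2, fieldToFrac_funAt]
  · intro s
    rcases isEmpty_or_nonempty V with hV | ⟨⟨x₀⟩⟩
    · exact ⟨0, form_ext fun x => hV.elim x⟩
    · have h1 : ∀ j, ∃ c : Γ(PSpace n, V), ∀ x, funAt x c =
          (logBasis b).repr (formAt x₀ s) j := fun j => exists_funAt fun x hx => by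
        refine (mem_logSpan_iff b).1 ?_ j
        rw [formAt_eq s x₀ ⟨x, hx⟩]
        exact (hU x (h hx)).logStalk_le (formAt_mem s ⟨x, hx⟩)
      choose c hc using h1
      refine ⟨c, form_ext fun x => ?_⟩
      dsimp only
      rw [key, formAt_eq s x x₀, ← (logBasis b).sum_repr (formAt x₀ s)]
      simp only [hc]

/-- A basis of the linear forms that is adapted to `𝓗` and taken from `𝓗` yields a local basis of
the sheaf of logarithmic forms. -/
theorem IsAdapted.exists_localBasis {b : Basis (Fin (n + 1)) ℂ (grading n 1)} {x : PTop n}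
    (h : IsAdapted b 𝓗 x) (hb : ∀ j : Fin n, ∃ H ∈ 𝓗, H.rep = b j.succ) :
    ∃ (U : (PSpace n).Opens) (_ : x ∈ U) (e : Fin n → Γ(logForms 𝓗, U)),
      (∀ j x, formAt x (e j) = logVec b j) ∧ IsLocalBasis (logForms 𝓗) e := by
  obtain ⟨U, hxU, hU⟩ := h.exists_open
  choose e he using fun j => exists_formAt (U := U) (𝓗 := 𝓗) (η := logVec b j) fun x hx =>
    logVec_mem_logStalk (hU x hx).notMem (Or.inl (hb j))
  exact ⟨U, hxU, e, he, isLocalBasis_logForms hU he⟩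

/-! ### Sections of the dual of the sheaf of logarithmic forms -/

/-- A linear function on the rational forms that takes regular values on logarithmic forms is a
section of the dual sheaf. -/
theorem exists_dual_section (Ψ : Ω[FunctionField n⁄ℂ] →ₗ[FunctionField n] FunctionField n)
    (hΨ : ∀ x ∈ U, ∀ η ∈ logStalk 𝓗 x, Ψ η ∈ (stalkToFunctionField x).range) :
    ∃ φ : Γ(dual (logForms 𝓗), U), ∀ (V : (PSpace n).Opens) (h : V ≤ U) (s : Γ(logForms 𝓗, V))
      (x : V), funAt x (dualEval h φ s) = Ψ (formAt x s) := by
  have key : ∀ (V : (PSpace n).Opens) (_ : V ≤ U) (s : Γ(logForms 𝓗, V)),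
      ∃ c : Γ(PSpace n, V), ∀ x, funAt x c = Ψ (formAt x s) := by
    intro V h s
    rcases isEmpty_or_nonempty V with hV | ⟨⟨x₀⟩⟩
    · exact ⟨0, fun x => hV.elim x⟩
    · obtain ⟨c, hc⟩ := exists_funAt (U := V) (z := Ψ (formAt x₀ s)) fun x hx => by
        rw [formAt_eq s x₀ ⟨x, hx⟩]
        exact hΨ x (h hx) _ (formAt_mem s ⟨x, hx⟩)
      exact ⟨c, fun x => by rw [hc, formAt_eq s x₀ x]⟩
  choose f hf using key
  have hext : ∀ {V : (PSpace n).Opens} {s t : Γ(PSpace n, V)}, (∀ x, funAt x s = funAt x t) →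
      s = t := fun h => section_ext fun x => by
    rw [← fieldToFrac_funAt, h, fieldToFrac_funAt]
  refine ⟨mkDual U (fun V h =>
    { toFun := f V h
      map_add' := fun s t => hext fun x => by rw [map_add, hf, hf, hf, map_add, map_add]
      map_smul' := fun r s => hext fun x => by
        rw [hf, formAt_smul, _root_.map_smul, RingHom.id_apply, smul_eq_mul, smul_eq_mul, map_mul,
          hf] }) ?_, hf⟩
  intro V W h i s
  refine hext fun x => (hf _ _ _ _).trans ?_
  rw [funAt_map]
  exact (hf V h s _).symm

end LogSections

/-! ### Arrangements with normal crossing -/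

section Arrangements

open Module

variable {n : ℕ} {𝓗 : Finset (Hyperplane n)}

theorem finrank_grading_one (n : ℕ) : finrank ℂ (grading n 1) = n + 1 := by
  rw [(evalLinearEquiv n).finrank_eq, Subspace.dual_finrank_eq, finrank_fin_fun]

/-- The members of a proper subspace of the linear forms have a common zero. -/
theorem exists_common_zero (W : Submodule ℂ (grading n 1)) (hW : W ≠ ⊤) :
    ∃ p : Fin (n + 1) → ℂ, p ≠ 0 ∧ ∀ f ∈ W, MvPolynomial.eval p f.1 = 0 := by
  obtain ⟨φ, hφ, hφW⟩ := Submodule.exists_le_ker_of_lt_top W hW.lt_top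
  obtain ⟨p, hp⟩ := (evalEquiv ℂ (Fin (n + 1) → ℂ)).surjective
    (φ.comp (evalLinearEquiv n).symm.toLinearMap)
  have key : ∀ f : grading n 1, MvPolynomial.eval p f.1 = φ f := by
    intro f
    have h1 := congr($hp (evalLinear n f))
    rw [Module.evalEquiv_apply] at h1
    refine h1.trans (congrArg φ ?_)
    exact (evalLinearEquiv n).symm_apply_apply f
  refine ⟨p, ?_, fun f hf => (key f).trans (hφW hf)⟩
  rintro rfl
  refine hφ (LinearMap.ext fun f => ?_)
  rw [← key, ← evalLinear_apply, map_zero]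
  rfl

theorem NormalCrossing.linearIndepOn_of_span_ne_top (h𝓗 : NormalCrossing 𝓗)
    {s : Finset (Hyperplane n)} (hs : s ⊆ 𝓗)
    (hspan : Submodule.span ℂ (Projectivization.rep '' (s : Set (Hyperplane n))) ≠ ⊤) :
    LinearIndepOn ℂ Projectivization.rep (s : Set (Hyperplane n)) := by
  obtain ⟨p, hp, h⟩ := exists_common_zero _ hspan
  exact (h𝓗 p hp).comp (fun H : s => ⟨H.1, hs H.2,
    h _ (Submodule.subset_span ⟨H.1, H.2, rfl⟩)⟩) fun H H' e =>
      Subtype.ext (congrArg (fun K => K.1) e)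

theorem NormalCrossing.linearIndepOn_of_card (h𝓗 : NormalCrossing 𝓗)
    {s : Finset (Hyperplane n)} (hs : s ⊆ 𝓗) (hcard : s.card = n + 1) :
    LinearIndepOn ℂ Projectivization.rep (s : Set (Hyperplane n)) := by
  by_cases hspan : Submodule.span ℂ (Projectivization.rep '' (s : Set (Hyperplane n))) = ⊤
  · refine linearIndependent_of_top_le_span_of_card_eq_finrank (ι := s) ?_ ?_
    · rw [← hspan, Set.image_eq_range]
    · rw [finrank_grading_one]
      simpa using hcard
  · exact h𝓗.linearIndepOn_of_span_ne_top hs hspan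

theorem NormalCrossing.linearIndepOn_of_mem_pointIdeal (h𝓗 : NormalCrossing 𝓗) (x : PTop n)
    {s : Finset (Hyperplane n)} (hs : s ⊆ 𝓗) (hx : ∀ H ∈ s, H.eqn ∈ pointIdeal x) :
    LinearIndepOn ℂ Projectivization.rep (s : Set (Hyperplane n)) := by
  refine h𝓗.linearIndepOn_of_span_ne_top hs fun htop => ?_
  let W : Submodule ℂ (grading n 1) :=
    ((pointIdeal x).restrictScalars ℂ).comap (grading n 1).subtype
  have hW : W = ⊤ := by
    rw [← top_le_iff, ← htop, Submodule.span_le]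
    rintro _ ⟨H, hH, rfl⟩
    exact hx H hH
  obtain ⟨i, hi⟩ := exists_X_notMem x
  exact hi ((hW ▸ Submodule.mem_top : coordForm i ∈ W))

/-- At each point, a normal crossing arrangement of more than `n` hyperplanes contains an adapted
basis of the linear forms. -/
theorem NormalCrossing.exists_isAdapted (h𝓗 : NormalCrossing 𝓗) (hcard : n + 1 ≤ 𝓗.card)
    (x : PTop n) : ∃ b : Basis (Fin (n + 1)) ℂ (grading n 1), IsAdapted b 𝓗 x ∧
      ∀ j, ∃ H ∈ 𝓗, H.rep = b j := by
  classical
  let s := 𝓗.filter fun H => H.eqn ∈ pointIdeal x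
  have hs : s ⊆ 𝓗 := Finset.filter_subset _ _
  have hsx : ∀ t ⊆ 𝓗, (∀ H ∈ t, H.eqn ∈ pointIdeal x) → t.card ≤ n := by
    intro t ht htx
    by_contra! hlt
    obtain ⟨t', ht', hc⟩ := Finset.exists_subset_card_eq (Nat.succ_le_of_lt hlt)
    have h1 := h𝓗.linearIndepOn_of_mem_pointIdeal x (ht'.trans ht) fun H hH => htx H (ht' hH)
    refine absurd (h1.span_eq_top_of_card_eq_finrank' (by
      rw [finrank_grading_one]; simpa using hc)) fun htop => ?_
    let W : Submodule ℂ (grading n 1) :=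
      ((pointIdeal x).restrictScalars ℂ).comap (grading n 1).subtype
    have hW : W = ⊤ := by
      rw [← top_le_iff, ← htop, Submodule.span_le]
      rintro _ ⟨H, rfl⟩
      exact htx _ (ht' H.2)
    obtain ⟨i, hi⟩ := exists_X_notMem x
    exact hi ((hW ▸ Submodule.mem_top : coordForm i ∈ W))
  obtain ⟨J, hsJ, hJ, hJc⟩ := Finset.exists_subsuperset_card_eq hs
    ((hsx s hs fun H hH => (Finset.mem_filter.1 hH).2).trans (Nat.le_succ n)) hcard
  have hJx : ∃ H₀ ∈ J, H₀.eqn ∉ pointIdeal x := by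
    by_contra! h
    have := hsx J hJ h
    omega
  obtain ⟨H₀, hH₀, hH₀x⟩ := hJx
  have hli := h𝓗.linearIndepOn_of_card hJ hJc
  let e : J ≃ Fin (n + 1) := (J.equivFinOfCardEq hJc).trans
    (Equiv.swap (J.equivFinOfCardEq hJc ⟨H₀, hH₀⟩) 0)
  have he : e ⟨H₀, hH₀⟩ = 0 := by simp [e]
  have : Nonempty J := ⟨⟨H₀, hH₀⟩⟩
  let b₀ : Basis J ℂ (grading n 1) := basisOfLinearIndependentOfCardEqFinrank
    (b := fun H : J => H.1.rep) hli (by rw [finrank_grading_one]; simpa using hJc)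
  have hb₀ : ∀ H, b₀ H = H.1.rep := fun H =>
    congrFun (coe_basisOfLinearIndependentOfCardEqFinrank hli _) H
  refine ⟨b₀.reindex e, ⟨?_, fun H hH hHx => ?_⟩, fun j => ⟨(e.symm j).1, hJ (e.symm j).2, ?_⟩⟩
  · rw [Basis.reindex_apply, ← he, Equiv.symm_apply_apply, hb₀]
    exact hH₀x
  · have hHJ : H ∈ J := hsJ (Finset.mem_filter.2 ⟨hH, hHx⟩)
    have h0 : e ⟨H, hHJ⟩ ≠ 0 := fun h => by
      rw [← he] at h
      have h2 : H = H₀ := congrArg Subtype.val (e.injective h)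
      exact hH₀x (h2 ▸ hHx)
    obtain ⟨j, hj⟩ := Fin.exists_succ_eq.2 h0
    exact ⟨j, by rw [Basis.reindex_apply, hj, Equiv.symm_apply_apply, hb₀]⟩
  · rw [Basis.reindex_apply, hb₀]

/-- The equations of at most `n` hyperplanes with normal crossing are part of a basis of the linear
forms. -/
theorem NormalCrossing.exists_basis_of_card_le (h𝓗 : NormalCrossing 𝓗) (hcard : 𝓗.card ≤ n) :
    ∃ b : Basis (Fin (n + 1)) ℂ (grading n 1), ∀ H ∈ 𝓗, ∃ j, b j = H.rep := by
  classical
  have hspan : Submodule.span ℂ (Projectivization.rep '' (𝓗 : Set (Hyperplane n))) ≠ ⊤ := by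
    intro h
    have h1 := finrank_span_finset_le_card (R := ℂ) (𝓗.image Projectivization.rep)
    rw [Finset.coe_image, Set.finrank, h, finrank_top, finrank_grading_one] at h1
    have h2 := Finset.card_image_le (s := 𝓗) (f := (Projectivization.rep : Hyperplane n → _))
    omega
  have hli := (h𝓗.linearIndepOn_of_span_ne_top subset_rfl hspan).id_image
  let b₀ := Basis.extend hli
  have hfin := FiniteDimensional.fintypeBasisIndex b₀
  let e : hli.extend (Set.subset_univ _) ≃ Fin (n + 1) := Fintype.equivFinOfCardEq (by
    rw [← finrank_eq_card_basis b₀, finrank_grading_one])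
  refine ⟨b₀.reindex e, fun H hH => ⟨e ⟨H.rep, hli.subset_extend _ ⟨H, hH, rfl⟩⟩, ?_⟩⟩
  rw [Basis.reindex_apply, Equiv.symm_apply_apply, Basis.extend_apply_self]

end Arrangements

section Functional

open Module

variable {n : ℕ}

/-- Linear functions on the rational forms with prescribed values on the logarithmic derivatives of
quotients of linear forms; the condition on the values is necessary because of the linear relations
among the forms. -/
theorem exists_functional (b : Basis (Fin (n + 1)) ℂ (grading n 1)) {ι : Type*}
    {l : ι → grading n 1} (hl : ∀ i, l i ≠ 0) (y : Fin (n + 1) → FunctionField n)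
    (z : ι → FunctionField n)
    (hz : ∀ i, toFrac n (l i) * fieldToFrac n (z i) =
      ∑ j, toFrac n (MvPolynomial.C (b.repr (l i) j) * (b j).1) * fieldToFrac n (y j)) :
    ∃ Ψ : Ω[FunctionField n⁄ℂ] →ₗ[FunctionField n] FunctionField n, ∀ i i',
      Ψ (dlog (l i) (l i') (hl i) (hl i')) = z i - z i' := by
  let Ψ := (logBasis b).constr (FunctionField n) fun j => y j.succ - y 0
  have hΨ : ∀ j, Ψ (logVec b j) = y j.succ - y 0 := fun j => by
    rw [← logBasis_apply]
    exact Basis.constr_basis _ _ _ _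
  have h0 := toFrac_ne_zero (coe_ne_zero (b.ne_zero 0))
  have key : ∀ i, Ψ (dlog (l i) (b 0) (hl i) (b.ne_zero 0)) = z i - y 0 := by
    intro i
    have hi := toFrac_ne_zero (coe_ne_zero (hl i))
    rw [dlog_eq_sum, map_sum]
    simp only [_root_.map_smul, hΨ, smul_eq_mul]
    refine fieldToFrac_injective (mul_left_cancel₀ hi ?_)
    have h1 : toFrac n (l i) = ∑ j, toFrac n (MvPolynomial.C (b.repr (l i) j) * (b j).1) := by
      conv_lhs => rw [← b.sum_repr (l i)]
      rw [AddSubmonoidClass.coe_finsetSum, map_sum]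
      simp [MvPolynomial.smul_eq_C_mul]
    rw [map_sub, mul_sub, hz i]
    conv_rhs => rw [h1, Finset.sum_mul, ← Finset.sum_sub_distrib, Fin.sum_univ_succ, sub_self,
      zero_add]
    rw [map_sum, Finset.mul_sum]
    refine Finset.sum_congr rfl fun j _ => ?_
    simp only [map_mul, map_sub, fieldToFrac_ofFraction, fieldToFrac_algebraMap]
    field_simp
  refine ⟨Ψ, fun i i' => ?_⟩
  have h1 := dlog_add (hl i') (b.ne_zero 0) (hl i')
  rw [dlog_self] at h1
  have h2 : Ψ (dlog (b 0) (l i') (b.ne_zero 0) (hl i')) = -(z i' - y 0) := by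
    rw [← key i', ← map_neg]
    exact congrArg Ψ (eq_neg_of_add_eq_zero_right h1)
  rw [← dlog_add (hl i) (b.ne_zero 0) (hl i'), map_add, key, h2]
  ring

theorem functional_mem {b : Basis (Fin (n + 1)) ℂ (grading n 1)} {x : PTop n}
    {Ψ : Ω[FunctionField n⁄ℂ] →ₗ[FunctionField n] FunctionField n}
    (hΨ : ∀ j, Ψ (logVec b j) ∈ (stalkToFunctionField x).range) {η : Ω[FunctionField n⁄ℂ]}
    (hη : η ∈ logSpan b x) : Ψ η ∈ (stalkToFunctionField x).range := by
  rw [← (logBasis b).sum_repr η, map_sum]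
  refine sum_mem fun j _ => ?_
  rw [_root_.map_smul, logBasis_apply]
  exact mul_mem ((mem_logSpan_iff b).1 hη j) (hΨ j)

end Functional

/-! ### The presentation of the dual of the sheaf of logarithmic forms -/

section EvalHom

variable {X : Scheme.{0}} {E : X.Modules}

/-- Evaluation at a global section, as a linear function on the dual sheaf. -/
def evalHom (s : Γ(E, ⊤)) : dual E ⟶ structureModule X :=
  mkHom (fun U =>
    { toFun := fun φ => sectionOfFunction
        (evalSection (E.presheaf.map (homOfLE (le_top : U ≤ ⊤)).op s) φ)
      map_add' := fun φ ψ => congrArg sectionOfFunction (map_add _ φ ψ)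
      map_smul' := fun r φ => congrArg sectionOfFunction (_root_.map_smul _ r φ) })
    fun U V h φ => by
      change dualEval le_rfl ((dual E).presheaf.map (homOfLE h).op φ) _ =
        X.presheaf.map (homOfLE h).op (dualEval le_rfl φ _)
      rw [dualEval_map, ← dualEval_map_map le_rfl (homOfLE h), map_map]
      rfl

end EvalHom

theorem sum_single_sub_smul {ι ι' M : Type*} [Fintype ι] [DecidableEq ι] [Fintype ι']
    [AddCommGroup M] [Module ℂ M] (v : ι → M) (i : ι) (τ : ι' → ι) (a : ι' → ℂ) :
    ∑ i', (Pi.single i 1 - ∑ j, Pi.single (τ j) (a j) : ι → ℂ) i' • v i' =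
      v i - ∑ j, a j • v (τ j) := by
  rw [← Fintype.linearCombination_apply ℂ v, map_sub, map_sum]
  simp only [Fintype.linearCombination_apply_single, one_smul]

section LogPresentation

open KaehlerDifferential Module

variable {n k m : ℕ} {𝓗 : Finset (Hyperplane n)} (H : Fin (m + 1) → Hyperplane n)

/-- The matrix of linear forms defined by linear relations `ρ j` among the equations of
hyperplanes. The column of the last hyperplane is left out, since the coordinates are the values of
a section of the dual of the logarithmic forms on `dlog (H i / H last)`, which vanish for the last
one. -/
def logMatrix (ρ : Fin k → Fin (m + 1) → ℂ) : Matrix (Fin k) (Fin m) (Pol n) :=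
  Matrix.of fun j i => MvPolynomial.C (ρ j i.castSucc) * (H i.castSucc).eqn

theorem logMatrix_mem (ρ : Fin k → Fin (m + 1) → ℂ) (j : Fin k) (i : Fin m) :
    logMatrix H ρ j i ∈ grading n 1 := by
  rw [logMatrix, Matrix.of_apply, ← MvPolynomial.smul_eq_C_mul]
  exact Submodule.smul_mem _ _ (Hyperplane.eqn_mem _)

variable {H}

theorem dlog_mem_logStalk {K K' : Hyperplane n} (hK : K ∈ 𝓗) (hK' : K' ∈ 𝓗) (x : PTop n) :
    dlog K.rep K'.rep K.rep_nonzero K'.rep_nonzero ∈ logStalk 𝓗 x := by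
  obtain ⟨i, hi⟩ := exists_X_notMem x
  have hi' : (coordForm i : Pol n) ∉ pointIdeal x := hi
  have h1 := dlog_add K.rep_nonzero (ne_zero_of_notMem hi') K.rep_nonzero
  have h2 := dlog_add K.rep_nonzero (ne_zero_of_notMem hi') K'.rep_nonzero
  have h3 := dlog_add K'.rep_nonzero (ne_zero_of_notMem hi') K'.rep_nonzero
  rw [dlog_self] at h3
  rw [← h2, eq_neg_of_add_eq_zero_right h3]
  exact (logStalk 𝓗 x).add_mem (Submodule.subset_span (Or.inr ⟨K, hK, coordForm i, hi', rfl⟩))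
    ((logStalk 𝓗 x).neg_mem (Submodule.subset_span (Or.inr ⟨K', hK', coordForm i, hi', rfl⟩)))

/-- An adapted basis taken from an indexed arrangement. -/
theorem NormalCrossing.exists_index (h𝓗 : NormalCrossing 𝓗) (hcard : n + 1 ≤ 𝓗.card)
    (hH' : ∀ K ∈ 𝓗, ∃ i, H i = K) (x : PTop n) :
    ∃ b : Basis (Fin (n + 1)) ℂ (grading n 1), IsAdapted b 𝓗 x ∧
      ∃ τ : Fin (n + 1) → Fin (m + 1), ∀ j, (H (τ j)).rep = b j := by
  obtain ⟨b, hb, hb𝓗⟩ := h𝓗.exists_isAdapted hcard x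
  have hb' : ∀ j, ∃ i, (H i).rep = b j := fun j => by
    obtain ⟨K, hK, hKb⟩ := hb𝓗 j
    obtain ⟨i, rfl⟩ := hH' K hK
    exact ⟨i, hKb⟩
  choose τ hτ using hb'
  exact ⟨b, hb, τ, hτ⟩

theorem exists_global_form (hH : ∀ i, H i ∈ 𝓗) : ∃ η : Fin (m + 1) → Γ(logForms 𝓗, ⊤), ∀ i x,
    formAt x (η i) = dlog (H i).rep (H (Fin.last m)).rep (H i).rep_nonzero
      (H (Fin.last m)).rep_nonzero := by
  choose η hη using fun i => exists_formAt (U := ⊤) fun x _ =>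
    dlog_mem_logStalk (hH i) (hH (Fin.last m)) x
  exact ⟨η, hη⟩

variable {η : Fin (m + 1) → Γ(logForms 𝓗, ⊤)}

/-- Restriction of a global form. -/
abbrev resForm (η : Γ(logForms 𝓗, ⊤)) (U : (PSpace n).Opens) : Γ(logForms 𝓗, U) :=
  (logForms 𝓗).presheaf.map (homOfLE (le_top : U ≤ ⊤)).op η

theorem resForm_last (hη : ∀ i x, formAt x (η i) = dlog (H i).rep (H (Fin.last m)).rep
    (H i).rep_nonzero (H (Fin.last m)).rep_nonzero)
    (U : (PSpace n).Opens) : resForm (η (Fin.last m)) U = 0 :=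
  form_ext fun x => by
    rw [formAt_map, hη, dlog_self, map_zero]

/-- A section of the dual is determined by its values on the logarithmic derivatives of the
quotients of the equations. -/
theorem dual_logForms_ext (hη : ∀ i x, formAt x (η i) = dlog (H i).rep (H (Fin.last m)).rep
    (H i).rep_nonzero (H (Fin.last m)).rep_nonzero)
    (hH' : ∀ K ∈ 𝓗, ∃ i, H i = K)
    (h𝓗 : NormalCrossing 𝓗) (hcard : n + 1 ≤ 𝓗.card) {U : (PSpace n).Opens}
    {φ ψ : Γ(dual (logForms 𝓗), U)} (h : ∀ i : Fin m,
      dualEval le_rfl φ (resForm (η i.castSucc) U) =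
        dualEval le_rfl ψ (resForm (η i.castSucc) U)) : φ = ψ := by
  have h1 : ∀ i, dualEval le_rfl φ (resForm (η i) U) = dualEval le_rfl ψ (resForm (η i) U) := by
    intro i
    induction i using Fin.lastCases with
    | last => rw [resForm_last hη, map_zero, map_zero]
    | cast i => exact h i
  have h2 : ∀ (W : (PSpace n).Opens) (hW : W ≤ U) i, dualEval hW φ (resForm (η i) W) =
      dualEval hW ψ (resForm (η i) W) := by
    intro W hW i
    have e := map_map (logForms 𝓗) (homOfLE (le_top : U ≤ ⊤)) (homOfLE hW) (η i)
    have e1 := dualEval_map_map le_rfl (homOfLE hW) φ (resForm (η i) U)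
    have e2 := dualEval_map_map le_rfl (homOfLE hW) ψ (resForm (η i) U)
    rw [e] at e1 e2
    exact e1.trans ((congrArg _ (h1 i)).trans e2.symm)
  refine dual_ext fun V hV s => section_ext fun x => ?_
  obtain ⟨b, hb, hb𝓗⟩ := h𝓗.exists_isAdapted hcard x.1
  obtain ⟨U', hxU', e, he, hbas⟩ := hb.exists_localBasis fun j => hb𝓗 j.succ
  have hb' : ∀ j, ∃ i, (H i).rep = b j := fun j => by
    obtain ⟨K, hK, hKb⟩ := hb𝓗 j
    obtain ⟨i, rfl⟩ := hH' K hK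
    exact ⟨i, hKb⟩
  choose τ hτ using hb'
  -- the members of an adapted local basis are differences of the global forms
  have hres : ∀ (W : (PSpace n).Opens) (hW : W ≤ U') j,
      (logForms 𝓗).presheaf.map (homOfLE hW).op (e j) =
        resForm (η (τ j.succ)) W - resForm (η (τ 0)) W := by
    intro W hW j
    refine form_ext fun y => ?_
    rw [formAt_map, he, map_sub, formAt_map, formAt_map, hη, hη, eq_sub_iff_add_eq, logVec]
    simp only [← hτ]
    exact dlog_add _ _ _
  obtain ⟨c, hc⟩ := (hbas (V ⊓ U') inf_le_right).2
    ((logForms 𝓗).presheaf.map (homOfLE (inf_le_left : V ⊓ U' ≤ V)).op s)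
  have h3 : dualEval (inf_le_left.trans hV) φ
      ((logForms 𝓗).presheaf.map (homOfLE (inf_le_left : V ⊓ U' ≤ V)).op s) =
      dualEval (inf_le_left.trans hV) ψ
      ((logForms 𝓗).presheaf.map (homOfLE (inf_le_left : V ⊓ U' ≤ V)).op s) := by
    rw [← hc]
    simp only [map_sum, _root_.map_smul, hres, map_sub, h2]
  have e1 := dualEval_map_map hV (homOfLE (inf_le_left : V ⊓ U' ≤ V)) φ s
  have e2 := dualEval_map_map hV (homOfLE (inf_le_left : V ⊓ U' ≤ V)) ψ s
  have h4 := congrArg (ratAt (⟨x.1, x.2, hxU'⟩ : (V ⊓ U' : (PSpace n).Opens)))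
    (e1.symm.trans (h3.trans e2))
  exact h4

/-- A linear relation among the equations gives a relation among the values of a section of the
dual. -/
theorem dual_logForms_relation (hη : ∀ i x, formAt x (η i) = dlog (H i).rep (H (Fin.last m)).rep
    (H i).rep_nonzero (H (Fin.last m)).rep_nonzero)
    {c : Fin (m + 1) → ℂ} (hc : ∑ i, c i • (H i).rep = 0)
    {U : (PSpace n).Opens} (φ : Γ(dual (logForms 𝓗), U)) (x : U) :
    ∑ i, toFrac n (MvPolynomial.C (c i) * (H i).eqn) *
      ratAt x (dualEval le_rfl φ (resForm (η i) U)) = 0 := by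
  set L := (H (Fin.last m)).rep with hL
  have hL0 : L ≠ 0 := (H (Fin.last m)).rep_nonzero
  have hL1 := toFrac_ne_zero (coe_ne_zero hL0)
  let W : (PSpace n).Opens := U ⊓ basicOpen (L : Pol n)
  let g : W := ⟨genericPt n, genericPt_mem x.2, coe_ne_zero hL0⟩
  choose u hu using fun i => exists_funAt (U := W)
    (z := algebraMap ℂ (FunctionField n) (c i) * FunctionField.ofFraction (H i).rep L hL0)
    fun y hy => mul_mem (by
      rw [← isRegularAt_fieldToFrac_iff, fieldToFrac_algebraMap]
      exact isRegularAt_of_mem (MvPolynomial.isHomogeneous_C _ _) y)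
      (exists_stalk_ofFraction y _ _ hy.2)
  have hsum : ∑ i, algebraMap ℂ (FunctionField n) (c i) *
      FunctionField.ofFraction (H i).rep L hL0 = 0 := by
    refine fieldToFrac_injective ?_
    have h1 : ∑ i, toFrac n (MvPolynomial.C (c i)) * toFrac n (H i).rep = 0 := by
      have := congrArg (fun f : grading n 1 => toFrac n f.1) hc
      simpa [AddSubmonoidClass.coe_finsetSum, MvPolynomial.smul_eq_C_mul] using this
    rw [map_sum, map_zero]
    simp only [map_mul, fieldToFrac_algebraMap, fieldToFrac_ofFraction, mul_div_assoc']
    rw [← Finset.sum_div, h1, zero_div]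
  -- multiplied by `H i / L`, the logarithmic derivatives become `d (H i / L)`
  have h1 : ∑ i, u i • resForm (η i) W = 0 := by
    refine form_ext fun y => ?_
    rw [map_sum, map_zero]
    simp only [formAt_smul, formAt_map, hη, hu, mul_smul]
    have h2 : ∀ i, algebraMap ℂ (FunctionField n) (c i) • FunctionField.ofFraction (H i).rep L hL0 •
        dlog (H i).rep L (H i).rep_nonzero hL0 = D ℂ (FunctionField n)
          (algebraMap ℂ (FunctionField n) (c i) * FunctionField.ofFraction (H i).rep L hL0) := by
      intro i
      rw [ofFraction_smul_dlog, Derivation.leibniz, Derivation.map_algebraMap, smul_zero, add_zero]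
    refine (Finset.sum_congr rfl fun i _ => h2 i).trans ?_
    rw [← map_sum, hsum, map_zero]
  have h2 := congrArg (fun s => ratAt g (dualEval (inf_le_left : W ≤ U) φ s)) h1
  simp only [map_sum, _root_.map_smul, map_zero, smul_eq_mul, map_mul] at h2
  have h3 : ∀ i, ratAt g (dualEval (inf_le_left : W ≤ U) φ (resForm (η i) W)) =
      ratAt x (dualEval le_rfl φ (resForm (η i) U)) := by
    intro i
    have e := map_map (logForms 𝓗) (homOfLE (le_top : U ≤ ⊤)) (homOfLE (inf_le_left : W ≤ U)) (η i)
    have e1 := dualEval_map_map le_rfl (homOfLE (inf_le_left : W ≤ U)) φ (resForm (η i) U)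
    rw [e] at e1
    refine (congrArg (ratAt g) e1).trans ?_
    rw [ratAt_map]
    exact ratAt_eq _ _ _
  have h4 : ∀ i, ratAt g (u i) * toFrac n L =
      toFrac n (MvPolynomial.C (c i) * (H i).eqn) := by
    intro i
    rw [← fieldToFrac_funAt, hu, map_mul, fieldToFrac_algebraMap, fieldToFrac_ofFraction, map_mul,
      mul_assoc, div_mul_cancel₀ _ hL1]
  have h5 := congrArg (· * toFrac n L) h2
  simp only [Finset.sum_mul, zero_mul] at h5
  rw [← h5]
  refine Finset.sum_congr rfl fun i _ => ?_
  rw [← h4, h3]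
  ring

/-- Prescribed values on the logarithmic derivatives that satisfy the relations define a section of
the dual. -/
theorem exists_dual_logForms (hη : ∀ i x, formAt x (η i) = dlog (H i).rep (H (Fin.last m)).rep
    (H i).rep_nonzero (H (Fin.last m)).rep_nonzero)
    (hH' : ∀ K ∈ 𝓗, ∃ i, H i = K)
    (h𝓗 : NormalCrossing 𝓗) (hcard : n + 1 ≤ 𝓗.card) {U : (PSpace n).Opens}
    (z : Fin (m + 1) → Γ(PSpace n, U)) (hlast : z (Fin.last m) = 0)
    (hz : ∀ c : Fin (m + 1) → ℂ, ∑ i, c i • (H i).rep = 0 → ∀ x : U,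
      ∑ i, c i • (toFrac n (H i).eqn * ratAt x (z i)) = 0) :
    ∃ φ : Γ(dual (logForms 𝓗), U), ∀ i, dualEval le_rfl φ (resForm (η i) U) = z i := by
  rcases isEmpty_or_nonempty {x // x ∈ U} with hU | ⟨⟨x₀⟩⟩
  · exact ⟨0, fun i => section_ext fun x => hU.elim x⟩
  obtain ⟨b, -, τ, hτ⟩ := h𝓗.exists_index hcard hH' x₀.1
  obtain ⟨Ψ, hΨ⟩ := exists_functional b (l := fun i => (H i).rep) (fun i => (H i).rep_nonzero)
    (fun j => funAt x₀ (z (τ j))) (fun i => funAt x₀ (z i)) fun i => by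
      -- the relation expressing the equation of `H i` in the basis `b`
      have h1 := hz (Pi.single i 1 - ∑ j, Pi.single (τ j) (b.repr (H i).rep j)) (by
        refine (sum_single_sub_smul (fun i => (H i).rep) i τ _).trans ?_
        simp only [hτ]
        rw [b.sum_repr, sub_self]) x₀
      replace h1 := (sum_single_sub_smul
        (fun i => toFrac n (H i).eqn * ratAt x₀ (z i)) i τ _).symm.trans h1
      rw [sub_eq_zero] at h1
      simp only [fieldToFrac_funAt]
      refine h1.trans (Finset.sum_congr rfl fun j _ => ?_)
      rw [map_mul, mul_assoc, Algebra.smul_def, ← hτ]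
      rfl
  obtain ⟨φ, hφ⟩ := exists_dual_section (U := U) (𝓗 := 𝓗) Ψ fun x hx ω hω => by
    -- the values on a basis adapted at `x` are differences of the prescribed ones, hence regular
    obtain ⟨b', hb', τ', hτ'⟩ := h𝓗.exists_index hcard hH' x
    refine functional_mem (b := b') (fun j => ?_) (hb'.logStalk_le hω)
    simp only [logVec, ← hτ', hΨ]
    exact sub_mem (funAt_mem _ x₀ ⟨x, hx⟩) (funAt_mem _ x₀ ⟨x, hx⟩)
  refine ⟨φ, fun i => funAt_injective x₀ ?_⟩
  rw [hφ, formAt_map, hη, hΨ, hlast, map_zero, sub_zero]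

/-- The dual of the sheaf of logarithmic forms of a normal crossing arrangement of more than `n`
hyperplanes is presented by the relations among the equations: a section is determined by its values
on the logarithmic derivatives of the quotients of the equations. -/
theorem nonempty_presentation_logForms (hH : ∀ i, H i ∈ 𝓗) (hH' : ∀ K ∈ 𝓗, ∃ i, H i = K)
    (h𝓗 : NormalCrossing 𝓗) (hcard : n + 1 ≤ 𝓗.card) {ρ : Fin k → Fin (m + 1) → ℂ}
    (hρ : ∀ j, ∑ i, ρ j i • (H i).rep = 0)
    (hspan : ∀ c : Fin (m + 1) → ℂ, ∑ i, c i • (H i).rep = 0 →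
      c ∈ Submodule.span ℂ (Set.range ρ)) :
    Nonempty (Presentation (dual (logForms 𝓗)) (logMatrix H ρ)) := by
  obtain ⟨η, hη⟩ := exists_global_form hH
  refine ⟨⟨fun i => evalHom (η i.castSucc), fun U φ ψ h => ?_, fun U φ x j => ?_,
    fun U c hc => ?_⟩⟩
  · exact dual_logForms_ext hη hH' h𝓗 hcard h
  · have h1 := dual_logForms_relation hη (hρ j) φ x
    rw [Fin.sum_univ_castSucc, resForm_last hη, map_zero, map_zero, mul_zero, add_zero] at h1
    exact h1
  · obtain ⟨φ, hφ⟩ := exists_dual_logForms hη hH' h𝓗 hcard (Fin.snoc c 0)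
      (by rw [Fin.snoc_last]) fun c' hc' x => by
        have h1 := hspan c' hc'
        clear hc'
        induction h1 using Submodule.span_induction with
        | mem c' hm =>
          obtain ⟨j, rfl⟩ := hm
          rw [Fin.sum_univ_castSucc, Fin.snoc_last, map_zero, mul_zero, smul_zero, add_zero,
            ← hc x j]
          refine Finset.sum_congr rfl fun i _ => ?_
          rw [Fin.snoc_castSucc, logMatrix, Matrix.of_apply, map_mul, mul_assoc, Algebra.smul_def]
          rfl
        | zero => simp
        | add c₁ c₂ _ _ h h' =>
          simp only [Pi.add_apply, add_smul, Finset.sum_add_distrib, h, h', add_zero]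
        | smul a c₁ _ h =>
          simp only [Pi.smul_apply, smul_assoc, ← Finset.smul_sum, h, smul_zero]
    refine ⟨φ, fun i => (hφ i.castSucc).trans ?_⟩
    rw [Fin.snoc_castSucc]

end LogPresentation

/-! ### Changes of coordinates in presentations -/

section ChangeBasis

open Module

variable {n k m : ℕ} {E : (PSpace n).Modules} {A : Matrix (Fin k) (Fin m) (Pol n)}

/-- The constant functions. -/
def constSection (c : ℂ) (U : (PSpace n).Opens) : Γ(PSpace n, U) := (exists_const c U).choose

theorem ratAt_constSection (c : ℂ) {U : (PSpace n).Opens} (x : U) :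
    ratAt x (constSection c U) = toFrac n (MvPolynomial.C c) := (exists_const c U).choose_spec x

/-- A compatible family of linear functions as a morphism to the structure sheaf. -/
def homOfLinear {X : Scheme.{0}} {M : X.Modules} (f : ∀ U : X.Opens, Γ(M, U) →ₗ[Γ(X, U)] Γ(X, U))
    (hf : ∀ (U V : X.Opens) (h : V ≤ U) (s : Γ(M, U)),
      f V (M.presheaf.map (homOfLE h).op s) = X.presheaf.map (homOfLE h).op (f U s)) :
    M ⟶ structureModule X :=
  mkHom (fun U =>
    { toFun := fun s => sectionOfFunction (f U s)
      map_add' := fun s t => congrArg sectionOfFunction (map_add (f U) s t)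
      map_smul' := fun r s => congrArg sectionOfFunction (_root_.map_smul (f U) r s) }) hf

section

variable (v : Basis (Fin m) ℂ (Fin m → ℂ))

/-- The inverse of the matrix with columns `v i`. -/
def invBasis (l i : Fin m) : ℂ := v.repr (Pi.single l 1) i

theorem sum_invBasis_mul (l l' : Fin m) :
    ∑ i, invBasis v l i * v i l' = if l' = l then 1 else 0 := by
  have := congrFun (v.sum_repr (Pi.single l 1)) l'
  rw [Pi.single_apply] at this
  rw [← this, Finset.sum_apply]
  rfl

theorem sum_mul_invBasis (i i' : Fin m) :
    ∑ l, v i l * invBasis v l i' = if i = i' then 1 else 0 := by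
  have h1 : v i = ∑ l, v i l • (Pi.single l 1 : Fin m → ℂ) := by
    funext l
    simp [Finset.sum_apply, Pi.single_apply]
  have h2 := congrArg (fun u => v.repr u i') h1
  simp only [Basis.repr_self, Finsupp.single_apply, map_sum, _root_.map_smul,
    Finsupp.coe_finsetSum, Finset.sum_apply, Finsupp.smul_apply, smul_eq_mul] at h2
  exact h2.symm

variable (P : Presentation E A)

/-- The coordinates with respect to a basis of the space of constant vectors. -/
def Presentation.basisCoord (U : (PSpace n).Opens) (i : Fin m) :
    Γ(E, U) →ₗ[Γ(PSpace n, U)] Γ(PSpace n, U) :=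
  ∑ l, constSection (invBasis v l i) U • P.coord U l

theorem Presentation.ratAt_basisCoord {U : (PSpace n).Opens} (s : Γ(E, U)) (i : Fin m) (x : U) :
    ratAt x (P.basisCoord v U i s) =
      ∑ l, toFrac n (MvPolynomial.C (invBasis v l i)) * ratAt x (P.coord U l s) := by
  simp only [basisCoord, LinearMap.sum_apply, LinearMap.smul_apply, smul_eq_mul, map_sum, map_mul,
    ratAt_constSection]

theorem Presentation.sum_basisCoord {U : (PSpace n).Opens} (s : Γ(E, U)) (l : Fin m) (x : U) :
    ∑ i, toFrac n (MvPolynomial.C (v i l)) * ratAt x (P.basisCoord v U i s) =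
      ratAt x (P.coord U l s) := by
  simp only [ratAt_basisCoord, Finset.mul_sum]
  rw [Finset.sum_comm]
  simp only [← mul_assoc, ← Finset.sum_mul, ← map_mul, ← map_sum, mul_comm (v _ l),
    sum_invBasis_mul]
  simp [apply_ite]

/-- The presentation in the coordinates with respect to a basis of the space of constant vectors. -/
def Presentation.changeBasis : Presentation E (Matrix.of fun j i => mulConst A (v i) j) where
  hom i := homOfLinear (fun U => P.basisCoord v U i) fun U V h s => section_ext fun x => by
    rw [ratAt_map, ratAt_basisCoord, ratAt_basisCoord]
    exact Finset.sum_congr rfl fun l _ => congrArg _ (Presentation.ratAt_coord_map _ _ _ _ _)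
  ext' U s t h := P.ext fun l => section_ext fun x => by
    have h' : ∀ i, P.basisCoord v U i s = P.basisCoord v U i t := h
    rw [← P.sum_basisCoord v, ← P.sum_basisCoord v]
    simp only [h']
  relation' U s x j := by
    change ∑ i, toFrac n (mulConst A (v i) j) * ratAt x (P.basisCoord v U i s) = 0
    rw [← P.relation s x j]
    simp only [← P.sum_basisCoord v, mulConst, map_sum, map_mul, Finset.sum_mul, Finset.mul_sum]
    rw [Finset.sum_comm]
    exact Finset.sum_congr rfl fun l _ => Finset.sum_congr rfl fun i _ => by ring
  exists' U c' hc' := by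
    obtain ⟨s, hs⟩ := P.exists_coord (fun l => ∑ i, constSection (v i l) U * c' i) fun x j => by
      rw [← hc' x j]
      simp only [map_sum, map_mul, ratAt_constSection, Matrix.of_apply, mulConst, Finset.sum_mul,
        Finset.mul_sum]
      rw [Finset.sum_comm]
      exact Finset.sum_congr rfl fun l _ => Finset.sum_congr rfl fun i _ => by ring
    refine ⟨s, fun i => section_ext fun x => (P.ratAt_basisCoord v s i x).trans ?_⟩
    simp only [hs, map_sum, map_mul, ratAt_constSection, Finset.mul_sum]
    rw [Finset.sum_comm]
    simp only [← mul_assoc, ← Finset.sum_mul, ← map_mul, ← map_sum,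
      mul_comm (invBasis v _ i), sum_mul_invBasis]
    simp [apply_ite]

end

theorem mulConst_zero (A : Matrix (Fin k) (Fin m) (Pol n)) : mulConst A 0 = 0 := by
  funext j
  simp [mulConst]

theorem mulConst_smul (A : Matrix (Fin k) (Fin m) (Pol n)) (a : ℂ) (c : Fin m → ℂ) (j : Fin k) :
    mulConst A (a • c) j = MvPolynomial.C a * mulConst A c j := by
  simp only [mulConst, Finset.mul_sum, Pi.smul_apply, smul_eq_mul, map_mul]
  exact Finset.sum_congr rfl fun i _ => by ring

theorem mulConst_sum {ι : Type*} (s : Finset ι) (A : Matrix (Fin k) (Fin m) (Pol n))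
    (c : ι → Fin m → ℂ) (j : Fin k) :
    mulConst A (∑ i ∈ s, c i) j = ∑ i ∈ s, mulConst A (c i) j := by
  simp only [mulConst, Finset.sum_apply, map_sum, Finset.mul_sum]
  exact Finset.sum_comm

theorem eval_mulConst (A : Matrix (Fin k) (Fin m) (Pol n)) (hA : ∀ j i, A j i ∈ grading n 1)
    (c : Fin m → ℂ) (p : Fin (n + 1) → ℂ) (j : Fin k) :
    MvPolynomial.eval p (mulConst A c j) = pencil A hA p c j := by
  simp [mulConst, pencil_apply]

end ChangeBasis

/-! ### Consequences of the presentation of the logarithmic forms -/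

section LogMatrix

open Module

variable {n k m : ℕ} {𝓗 : Finset (Hyperplane n)} {H : Fin (m + 1) → Hyperplane n}

theorem hasLocalBases_logForms (h𝓗 : NormalCrossing 𝓗) (hcard : n + 1 ≤ 𝓗.card) :
    HasLocalBases (logForms 𝓗) n := by
  intro x
  obtain ⟨b, hb, hb𝓗⟩ := h𝓗.exists_isAdapted hcard x
  obtain ⟨U, hxU, e, -, he⟩ := hb.exists_localBasis fun j => hb𝓗 j.succ
  exact ⟨U, hxU, e, he⟩

theorem rep_injective : Function.Injective (Projectivization.rep : Hyperplane n → grading n 1) :=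
  fun H K h => by
    rw [← H.mk_rep, ← K.mk_rep]
    simp only [h]

/-- The space of relations among the equations has dimension `k`. -/
theorem finrank_relations (hm : m = n + k) (h𝓗 : NormalCrossing 𝓗) (hcard : n + 1 ≤ 𝓗.card)
    (hH' : ∀ K ∈ 𝓗, ∃ i, H i = K) :
    finrank ℂ (LinearMap.ker (Fintype.linearCombination ℂ fun i => (H i).rep)) = k := by
  obtain ⟨b, -, τ, hτ⟩ := h𝓗.exists_index hcard hH' (genericPt n)
  have h1 : LinearMap.range (Fintype.linearCombination ℂ fun i => (H i).rep) = ⊤ := by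
    rw [Fintype.range_linearCombination, ← top_le_iff, ← b.span_eq, Submodule.span_le]
    rintro _ ⟨j, rfl⟩
    exact Submodule.subset_span ⟨τ j, hτ j⟩
  have h2 := (Fintype.linearCombination ℂ fun i => (H i).rep).finrank_range_add_finrank_ker
  rw [h1, finrank_top, finrank_grading_one, finrank_fin_fun] at h2
  omega

/-- Hence `k` independent relations span all relations. -/
theorem mem_span_relations (hm : m = n + k) (h𝓗 : NormalCrossing 𝓗) (hcard : n + 1 ≤ 𝓗.card)
    (hH' : ∀ K ∈ 𝓗, ∃ i, H i = K) {ρ : Fin k → Fin (m + 1) → ℂ}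
    (hρ : ∀ j, ∑ i, ρ j i • (H i).rep = 0) (hli : LinearIndependent ℂ ρ)
    {c : Fin (m + 1) → ℂ} (hc : ∑ i, c i • (H i).rep = 0) :
    c ∈ Submodule.span ℂ (Set.range ρ) := by
  let N := LinearMap.ker (Fintype.linearCombination ℂ fun i => (H i).rep)
  have hle : Submodule.span ℂ (Set.range ρ) ≤ N := by
    rw [Submodule.span_le]
    rintro _ ⟨j, rfl⟩
    exact hρ j
  have h1 : Submodule.span ℂ (Set.range ρ) = N := by
    refine Submodule.eq_of_le_of_finrank_eq hle ?_
    rw [finrank_span_eq_card hli, Fintype.card_fin]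
    exact (finrank_relations hm h𝓗 hcard hH').symm
  rw [h1]
  exact hc

theorem exists_relations (hm : m = n + k) (h𝓗 : NormalCrossing 𝓗) (hcard : n + 1 ≤ 𝓗.card)
    (hH' : ∀ K ∈ 𝓗, ∃ i, H i = K) : ∃ ρ : Fin k → Fin (m + 1) → ℂ,
      (∀ j, ∑ i, ρ j i • (H i).rep = 0) ∧ LinearIndependent ℂ ρ := by
  let N := LinearMap.ker (Fintype.linearCombination ℂ fun i => (H i).rep)
  let β := finBasisOfFinrankEq ℂ N (finrank_relations hm h𝓗 hcard hH')
  exact ⟨fun j => (β j).1, fun j => (β j).2,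
    β.linearIndependent.map' N.subtype N.ker_subtype⟩

/-- The matrix of relations has maximal rank at each point: the relations are still independent
after restriction to the complement of an adapted basis, where the equations are invertible. -/
theorem nondegenerate_logMatrix (hk : 1 ≤ k) (h𝓗 : NormalCrossing 𝓗) (hcard : n + 1 ≤ 𝓗.card)
    (hH : ∀ i, H i ∈ 𝓗) (hH' : ∀ K ∈ 𝓗, ∃ i, H i = K) (hinj : Function.Injective H)
    {ρ : Fin k → Fin (m + 1) → ℂ}
    (hρ : ∀ j, ∑ i, ρ j i • (H i).rep = 0) (hli : LinearIndependent ℂ ρ) :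
    Nondegenerate (logMatrix H ρ) := by
  classical
  intro x
  obtain ⟨b, hb, τ, hτ⟩ := h𝓗.exists_index hcard hH' x
  -- the hyperplanes outside the adapted basis; none of them contains `x`
  let N : Finset (Fin (m + 1)) := Finset.univ.filter fun i => ∀ j, i ≠ τ j
  have hN : ∀ i, i ∉ N → ∃ j, i = τ j := fun i hi => by simpa [N] using hi
  have hNx : ∀ i ∈ N, (H i).eqn ∉ pointIdeal x := fun i hi hix => by
    obtain ⟨j, hj⟩ := hb.exists_eq (H i) (hH i) hix
    refine (Finset.mem_filter.1 hi).2 j.succ (hinj (rep_injective ?_))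
    rw [hτ, hj]
  -- a relation vanishing on `N` is a relation among a basis
  let R : (Fin k → ℂ) →ₗ[ℂ] (N → ℂ) := LinearMap.pi fun i =>
    (LinearMap.proj i.1).comp (Fintype.linearCombination ℂ ρ)
  have hR : LinearMap.ker R = ⊥ := by
    rw [LinearMap.ker_eq_bot']
    intro a ha
    set c : Fin (m + 1) → ℂ := Fintype.linearCombination ℂ ρ a with hc_def
    have hcN : ∀ i ∈ N, c i = 0 := fun i hi => congrFun ha ⟨i, hi⟩
    have hcr : ∑ i, c i • (H i).rep = 0 := by
      simp only [hc_def, Fintype.linearCombination_apply, Finset.sum_apply, Pi.smul_apply,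
        Finset.sum_smul]
      rw [Finset.sum_comm]
      simp only [smul_assoc, ← Finset.smul_sum, hρ, smul_zero, Finset.sum_const_zero]
    have hτinj : Function.Injective τ := fun j j' h => b.injective (by rw [← hτ, ← hτ, h])
    have hcτ : ∑ j, c (τ j) • b j = 0 := by
      rw [← hcr]
      simp only [← hτ]
      rw [← Finset.sum_image (f := fun i => c i • (H i).rep) (s := Finset.univ) (g := τ)
        fun j _ j' _ h => hτinj h]
      refine Finset.sum_subset (Finset.subset_univ _) fun i _ hi => ?_
      rw [hcN i (Finset.mem_filter.2 ⟨Finset.mem_univ _, fun j hj => hi (by simp [hj])⟩), zero_smul]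
    have hc0 : c = 0 := by
      funext i
      by_cases hi : i ∈ N
      · exact hcN i hi
      · obtain ⟨j, rfl⟩ := hN i hi
        exact Fintype.linearIndependent_iff.1 b.linearIndependent _ hcτ j
    funext j
    refine Fintype.linearIndependent_iff.1 hli a ?_ j
    rw [← Fintype.linearCombination_apply, ← hc_def, hc0]
  obtain ⟨g, hg⟩ := LinearMap.exists_leftInverse_of_injective R hR
  -- a constant right inverse of the relations, supported on the hyperplanes in `N`
  let w (i : Fin (m + 1)) (j : Fin k) : ℂ :=
    if hi : i ∈ N then g (Pi.single ⟨i, hi⟩ 1) j else 0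
  have hw : ∀ j j', ∑ i ∈ N, ρ j i * w i j' = if j = j' then 1 else 0 := by
    intro j j'
    have h1 := congrFun (congr($hg (Pi.single j 1))) j'
    have h2 : R (Pi.single j 1) = ∑ i : N, ρ j i • (Pi.single i 1 : N → ℂ) := by
      funext i
      simp [R, Fintype.linearCombination_apply_single, Finset.sum_apply, Pi.single_apply]
    rw [LinearMap.comp_apply, h2, map_sum, Finset.sum_apply, LinearMap.id_apply, Pi.single_apply]
      at h1
    rw [← Finset.sum_coe_sort N (fun i => ρ j i * w i j')]
    simp only [eq_comm (a := j)]
    rw [← h1]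
    refine Finset.sum_congr rfl fun i _ => ?_
    simp [w]
  have hNne : N.Nonempty := by
    rw [Finset.nonempty_iff_ne_empty]
    intro h0
    have := hw ⟨0, hk⟩ ⟨0, hk⟩
    rw [h0] at this
    simp at this
  let e (i : Fin (m + 1)) (j : Fin k) : Pol n :=
    MvPolynomial.C (w i j) * ∏ i' ∈ N.erase i, (H i').eqn
  have he : ∀ i j, e i j ∈ grading n (N.card - 1) := by
    intro i j
    by_cases hi : i ∈ N
    · have h1 : ∏ i' ∈ N.erase i, (H i').eqn ∈ grading n (∑ i' ∈ N.erase i, 1) :=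
        SetLike.prod_mem_graded _ _ _ fun i' _ => (H i').eqn_mem
      rw [Finset.sum_const, smul_eq_mul, mul_one, Finset.card_erase_of_mem hi] at h1
      simp only [e, ← MvPolynomial.smul_eq_C_mul]
      exact Submodule.smul_mem _ _ h1
    · have : e i j = 0 := by simp [e, w, hi]
      rw [this]
      exact zero_mem _
  have hprod : ∏ i ∈ N, (H i).eqn ∈ grading n (N.card - 1 + 1) := by
    have h1 : ∏ i ∈ N, (H i).eqn ∈ grading n (∑ i ∈ N, 1) :=
      SetLike.prod_mem_graded _ _ _ fun i' _ => (H i').eqn_mem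
    rw [Finset.sum_const, smul_eq_mul, mul_one] at h1
    rwa [Nat.sub_add_cancel hNne.card_pos]
  have hρ' : ∀ j, ∑ i, MvPolynomial.C (ρ j i) * (H i).eqn = 0 := by
    intro j
    have := congrArg (fun f : grading n 1 => f.1) (hρ j)
    simpa [AddSubmonoidClass.coe_finsetSum, MvPolynomial.smul_eq_C_mul] using this
  -- the kernel of the full matrix of relations contains the constant vectors, which allows to make
  -- the last coordinate vanish
  refine ⟨N.card - 1, Matrix.of fun i j => e i.castSucc j - e (Fin.last m) j,
    ∏ i ∈ N, (H i).eqn, fun i j => sub_mem (he _ _) (he _ _), hprod, fun hm => ?_, ?_⟩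
  · obtain ⟨i, hi, hix⟩ := (Ideal.IsPrime.prod_mem_iff (p := pointIdeal x)).1 hm
    exact hNx i hi hix
  · ext1 j j'
    rw [Matrix.mul_apply, Matrix.smul_apply, Matrix.one_apply]
    have h1 : ∑ i, logMatrix H ρ j i * (e i.castSucc j' - e (Fin.last m) j') =
        ∑ i, MvPolynomial.C (ρ j i) * (H i).eqn * (e i j' - e (Fin.last m) j') := by
      rw [Fin.sum_univ_castSucc, sub_self, mul_zero, add_zero]
      rfl
    refine h1.trans ?_
    simp only [mul_sub, Finset.sum_sub_distrib, ← Finset.sum_mul, hρ', zero_mul, sub_zero]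
    rw [← Finset.sum_subset (Finset.subset_univ N) fun i _ hi => by simp [e, w, hi]]
    have h2 : ∀ i ∈ N, MvPolynomial.C (ρ j i) * (H i).eqn * e i j' =
        MvPolynomial.C (ρ j i * w i j') * ∏ i ∈ N, (H i).eqn := by
      intro i hi
      rw [← Finset.mul_prod_erase N _ hi, map_mul]
      simp only [e]
      ring
    rw [Finset.sum_congr rfl h2, ← Finset.sum_mul, ← map_sum, hw]
    split_ifs <;> simp

theorem mulConst_logMatrix (ρ : Fin k → Fin (m + 1) → ℂ) (i : Fin m) (j : Fin k) :
    mulConst (logMatrix H ρ) (Pi.single i 1) j =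
      MvPolynomial.C (ρ j i.castSucc) * (H i.castSucc).eqn := by
  rw [mulConst, Finset.sum_eq_single i (fun l _ hl => by simp [hl]) (by simp)]
  simp [logMatrix]

/-- The vector `(-1, …, -1)` plays the role of the unit vector of the last hyperplane. -/
theorem mulConst_logMatrix_last {ρ : Fin k → Fin (m + 1) → ℂ}
    (hρ : ∀ j, ∑ i, ρ j i • (H i).rep = 0) (j : Fin k) :
    mulConst (logMatrix H ρ) (fun _ => -1) j =
      MvPolynomial.C (ρ j (Fin.last m)) * (H (Fin.last m)).eqn := by
  have h1 := congrArg (fun f : grading n 1 => f.1) (hρ j)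
  simp only [Fin.sum_univ_castSucc] at h1
  have h2 : ∑ i : Fin m, MvPolynomial.C (ρ j i.castSucc) * (H i.castSucc).eqn +
      MvPolynomial.C (ρ j (Fin.last m)) * (H (Fin.last m)).eqn = 0 := by
    simpa [MvPolynomial.smul_eq_C_mul] using h1
  rw [← sub_eq_zero, ← neg_eq_zero, ← h2]
  simp [mulConst, logMatrix]
  ring

/-- The members of the arrangement are unstable for a sheaf presented by the relations among their
equations. -/
theorem nontrivial_of_logMatrix (hn : 1 ≤ n) (hmk : 1 ≤ m) {ρ : Fin k → Fin (m + 1) → ℂ}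
    (hρ : ∀ j, ∑ i, ρ j i • (H i).rep = 0) (hB : Nondegenerate (logMatrix H ρ))
    {E : (PSpace n).Modules} (P : Presentation E (logMatrix H ρ)) (i : Fin (m + 1)) :
    Nontrivial Γ((Scheme.Modules.pullback (H i).ι).obj E, ⊤) := by
  induction i using Fin.lastCases with
  | last =>
    refine P.nontrivial_of_mulConst _ hn (logMatrix_mem H ρ) hB (c := fun _ => -1) (fun h => ?_)
      (mulConst_logMatrix_last hρ)
    have := congrFun h ⟨0, hmk⟩
    simp at this
  | cast i =>
    refine P.nontrivial_of_mulConst _ hn (logMatrix_mem H ρ) hB (c := Pi.single i 1) (fun h => ?_)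
      (mulConst_logMatrix ρ i)
    have := congrFun h i
    simp at this

/-- A bundle presented by a nondegenerate matrix is not a sheaf of logarithmic forms of at most `n`
hyperplanes: extend the equations to a basis `b` of the linear forms; then the function with value
`1` on `dlog (b j / b 0)` for all `j ≠ 0` is a nonzero global section of the dual of the latter. -/
theorem card_gt_of_presentation (hn : 1 ≤ n) (hk : 1 ≤ k) (hm : m = n + k)
    {A : Matrix (Fin k) (Fin m) (Pol n)} (hA : ∀ j i, A j i ∈ grading n 1) (hB : Nondegenerate A)
    (P : Presentation (dual (logForms 𝓗)) A) (h𝓗 : NormalCrossing 𝓗) : n < 𝓗.card := by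
  by_contra! hcard
  obtain ⟨b, hb⟩ := h𝓗.exists_basis_of_card_le hcard
  obtain ⟨Ψ, hΨ⟩ := exists_functional b (l := b) (fun i => b.ne_zero i)
    (fun j => if j = 0 then 0 else 1) (fun j => if j = 0 then 0 else 1) fun i => by
      rw [Finset.sum_eq_single i (fun j _ hj => by simp [hj.symm]) (by simp)]
      simp
  have h01 : ∀ (x : PTop n) (j : Fin (n + 1)),
      (if j = 0 then 0 else 1 : FunctionField n) ∈ (stalkToFunctionField x).range := fun x j => by
    split_ifs
    · exact zero_mem _
    · exact one_mem _
  obtain ⟨φ, hφ⟩ := exists_dual_section (U := ⊤) (𝓗 := 𝓗) Ψ fun x _ ω hω => by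
    obtain ⟨i₀, hi₀⟩ : ∃ i, (b i : Pol n) ∉ pointIdeal x := by
      by_contra! h
      obtain ⟨i, hi⟩ := exists_X_notMem x
      refine hi ?_
      have h1 := congrArg (fun f : grading n 1 => f.1) (b.sum_repr (coordForm i))
      simp only [AddSubmonoidClass.coe_finsetSum] at h1
      rw [show (MvPolynomial.X i : Pol n) = (coordForm i).1 from rfl, ← h1]
      refine Ideal.sum_mem _ fun j _ => ?_
      rw [SetLike.val_smul, MvPolynomial.smul_eq_C_mul]
      exact Ideal.mul_mem_left _ _ (h j)
    let b' := b.reindex (Equiv.swap i₀ 0)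
    have hb' : ∀ j, b' j = b (Equiv.swap i₀ 0 j) := fun j => by simp [b']
    have had : IsAdapted b' 𝓗 x := by
      refine ⟨by rw [hb', Equiv.swap_apply_right]; exact hi₀, fun K hK hKx => ?_⟩
      obtain ⟨j, hj⟩ := hb K hK
      have hj0 : Equiv.swap i₀ 0 j ≠ 0 := fun h => by
        rw [Equiv.swap_apply_eq_iff, Equiv.swap_apply_right] at h
        subst h
        exact hi₀ (hj ▸ hKx)
      obtain ⟨j', hj'⟩ := Fin.exists_succ_eq.2 hj0
      exact ⟨j', by rw [hb', hj', Equiv.swap_apply_self, hj]⟩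
    refine functional_mem (b := b') (fun j => ?_) (had.logStalk_le hω)
    simp only [logVec, hb', hΨ]
    exact sub_mem (h01 _ _) (h01 _ _)
  have hφ0 : φ ≠ 0 := by
    rintro rfl
    let V : (PSpace n).Opens := basicOpen ((b 0 : Pol n) * (b 1 : Pol n))
    let j₀ : Fin n := ⟨0, hn⟩
    have hj₀ : j₀.succ = 1 := by
      ext
      simp [j₀, Nat.mod_eq_of_lt (show 1 < n + 1 by omega)]
    obtain ⟨s, hs⟩ := exists_formAt (U := V) (𝓗 := 𝓗) (η := logVec b j₀) fun x hx =>
      logVec_mem_logStalk (fun h => hx (Ideal.mul_mem_right _ _ h)) (Or.inr (by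
        rw [hj₀]
        exact fun h => hx (Ideal.mul_mem_left _ _ h)))
    let g : V := ⟨genericPt n, mul_ne_zero (coe_ne_zero (b.ne_zero 0)) (coe_ne_zero (b.ne_zero 1))⟩
    have h1 := hφ V le_top s g
    rw [hs, logVec, hΨ, if_neg (Fin.succ_ne_zero _), if_pos rfl, sub_zero] at h1
    exact zero_ne_one ((map_zero (funAt g)).symm.trans h1)
  choose c hc using fun i => exists_ratAt_eq_const hn (P.coord ⊤ i φ)
  have hc0 : c = 0 := by
    refine eq_zero_of_forall_pencil A hA hk hm hB fun p => funext fun j => ?_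
    rw [← eval_mulConst]
    have h1 := P.relation φ ⟨genericPt n, trivial⟩ j
    simp only [hc, ← map_mul, ← map_sum] at h1
    have h2 : mulConst A c j = 0 := toFrac_injective (h1.trans (map_zero _).symm)
    rw [h2, map_zero]
    rfl
  refine hφ0 (P.ext fun i => section_ext fun x => ?_)
  rw [hc, hc0, map_zero, map_zero]
  simp

end LogMatrix

/-! ### The characterization of logarithmic Steiner bundles -/

section Steiner

open Module

variable {n k : ℕ}

theorem normalCrossing_of_linearIndepOn {𝓗 : Finset (Hyperplane n)} {ι : Type*}
    {H : ι → Hyperplane n} (hH' : ∀ K ∈ 𝓗, ∃ i, H i = K)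
    (h : ∀ p : Fin (n + 1) → ℂ, p ≠ 0 → LinearIndepOn ℂ (fun i => evalLinear n (H i).rep)
      {i | evalLinear n (H i).rep p = 0}) : NormalCrossing 𝓗 := by
  intro p hp
  choose τ hτ using hH'
  refine LinearIndependent.of_comp (evalLinear n) ?_
  let f : {K : Hyperplane n // K ∈ 𝓗 ∧ MvPolynomial.eval p K.eqn = 0} →
      {i | evalLinear n (H i).rep p = 0} := fun K => ⟨τ K.1 K.2.1, by
    change evalLinear n (H (τ K.1 K.2.1)).rep p = 0
    rw [hτ]
    exact K.2.2⟩
  have hf : Function.Injective f := fun K K' e => by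
    refine Subtype.ext ?_
    rw [← hτ K.1 K.2.1, ← hτ K'.1 K'.2.1]
    exact congrArg (fun i => H i.1) e
  convert (h p hp).comp f hf using 1
  funext K
  exact congrArg (fun K => evalLinear n (Projectivization.rep K)) (hτ K.1 K.2.1).symm

theorem linearIndependent_pair {H K : Hyperplane n} (h : H ≠ K) :
    LinearIndependent ℂ ![evalLinear n H.rep, evalLinear n K.rep] := by
  have h1 := Projectivization.independent_iff.1 ((Projectivization.independent_pair_iff_ne H K).2 h)
  have h2 := h1.map' (evalLinear n) (LinearMap.ker_eq_bot.2 evalLinear_injective)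
  have h3 : ![evalLinear n H.rep, evalLinear n K.rep] =
      evalLinear n ∘ Projectivization.rep ∘ ![H, K] := by
    funext i
    fin_cases i <;> rfl
  rw [h3]
  exact h2

variable {S : (PSpace n).Modules} {A : Matrix (Fin k) (Fin (n + k)) (Pol n)}

theorem pencil_eq_of_mulConst (hA : ∀ j i, A j i ∈ grading n 1) {H : Hyperplane n}
    {v : Fin (n + k) → ℂ} {w : Fin k → ℂ}
    (h : ∀ j, mulConst A v j = MvPolynomial.C (w j) * H.eqn) (p : Fin (n + 1) → ℂ) :
    pencil A hA p v = evalLinear n H.rep p • w := by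
  funext j
  rw [← eval_mulConst, h, map_mul, MvPolynomial.eval_C, mul_comm]
  rfl

/-- The vectors `v i` with `A (v i) = ℓ i w i`, rescaled so that their sum vanishes, are used as
coordinates: in the basis given by the first `n + k` of them, `A` becomes the matrix of the
relations `w` among the equations `ℓ i`, which also presents the dual of the logarithmic forms. -/
theorem normalCrossing_and_nonempty_iso (hn : 1 ≤ n) (hk : 1 ≤ k) (hS : IsVectorBundleOfRank S n)
    (hA : ∀ j i, A j i ∈ grading n 1) (hB : Nondegenerate A) (P : Presentation (dual S) A)
    {𝓗 : Finset (Hyperplane n)} (h𝓗 : (𝓗 : Set (Hyperplane n)) ⊆ unstableHyperplanes S)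
    (hcard : 𝓗.card = n + k + 1) (hkNC : 2 ≤ k ∨ NormalCrossing 𝓗) :
    NormalCrossing 𝓗 ∧ Nonempty (S ≅ logForms 𝓗) := by
  have : Nonempty (Fin k) := ⟨⟨0, hk⟩⟩
  let e : 𝓗 ≃ Fin (n + k + 1) := 𝓗.equivFinOfCardEq hcard
  let H : Fin (n + k + 1) → Hyperplane n := fun i => (e.symm i).1
  have hH : ∀ i, H i ∈ 𝓗 := fun i => (e.symm i).2
  have hH' : ∀ K ∈ 𝓗, ∃ i, H i = K := fun K hK => ⟨e ⟨K, hK⟩, by simp [H]⟩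
  have hinj : Function.Injective H := Subtype.val_injective.comp e.symm.injective
  let T := pencil A hA
  have hT : ∀ p, p ≠ 0 → Function.Surjective (T p) := pencil_surjective A hA hB
  let l : Fin (n + k + 1) → Dual ℂ (Fin (n + 1) → ℂ) := fun i => evalLinear n (H i).rep
  choose v₀ w₀ hv₀ hvw₀ using fun i => P.exists_mulConst_of_nontrivial (H i) hn hA hB (h𝓗 (hH i))
  have hI : finrank ℂ (Fin (n + k) → ℂ) = n + k := finrank_fin_fun ℂ
  have hdim : finrank ℂ (Fin (n + k) → ℂ) + 1 =
      finrank ℂ (Fin (n + 1) → ℂ) + finrank ℂ (Fin k → ℂ) := by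
    simp only [finrank_fin_fun]; ring
  have hind : ∀ s : Finset (Fin (n + k + 1)), s.card ≤ n + k →
      LinearIndepOn ℂ v₀ (s : Set (Fin (n + k + 1))) := by
    refine fun s hs => linearIndepOn_of_unstable (T := T) (l := l) (w := w₀) hT hdim
      (fun i j hij => linearIndependent_pair (hinj.ne hij)) hv₀
      (fun i p => pencil_eq_of_mulConst hA (hvw₀ i) p) ?_ s (hs.trans hI.ge)
    refine hkNC.imp (fun h => by rwa [finrank_fin_fun]) fun h p hp => ?_
    have h1 := (h p hp).map' (evalLinear n) (LinearMap.ker_eq_bot.2 evalLinear_injective)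
    exact h1.comp (fun i : {i | l i p = 0} => ⟨H i, hH i, i.2⟩) fun i j hij =>
      Subtype.ext (hinj (congrArg (fun K => K.1) hij))
  -- rescale the vectors so that their sum vanishes
  obtain ⟨c, hc, hcv⟩ := exists_relation_of_unstable hI hind
  let v : Fin (n + k + 1) → Fin (n + k) → ℂ := fun i => c i • v₀ i
  let w : Fin (n + k + 1) → Fin k → ℂ := fun i => c i • w₀ i
  have hvw : ∀ i j, mulConst A (v i) j = MvPolynomial.C (w i j) * (H i).eqn := fun i j => by
    simp only [v, w, mulConst_smul, hvw₀, Pi.smul_apply, smul_eq_mul, map_mul, mul_assoc]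
  have hTv : ∀ i p, T p (v i) = l i p • w i := fun i p => pencil_eq_of_mulConst hA (hvw i) p
  have hind' : ∀ s : Finset (Fin (n + k + 1)), s.card ≤ n + k →
      LinearIndepOn ℂ v (s : Set (Fin (n + k + 1))) := fun s hs =>
    (hind s hs).units_smul fun i => Units.mk0 (c i) (hc i)
  obtain ⟨hli, hspan⟩ := top_le_span_of_unstable hI hind'
  have hz : ∀ p, p ≠ 0 → ∀ s : Finset (Fin (n + k + 1)), (∀ i ∈ s, l i p = 0) →
      s.card < finrank ℂ (Fin (n + 1) → ℂ) := fun p hp s hs =>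
    card_zeros_lt_of_unstable hT (by simp only [finrank_fin_fun]; ring) hTv hspan hcv hp s hs
  have hNC : NormalCrossing 𝓗 := by
    classical
    refine normalCrossing_of_linearIndepOn hH' fun p hp => ?_
    have h1 := linearIndepOn_of_card_zeros_lt (l := l)
      (by simp only [finrank_fin_fun, Fintype.card_fin]; omega) hz
      (Finset.univ.filter fun i => l i p = 0)
      (hz p hp _ fun i hi => (Finset.mem_filter.1 hi).2).le
    simpa using h1
  have hcard' : n + 1 ≤ 𝓗.card := by omega
  let ρ : Fin k → Fin (n + k + 1) → ℂ := fun j i => w i j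
  have hρ : ∀ j, ∑ i, ρ j i • (H i).rep = 0 := fun j => by
    have h1 := mulConst_sum Finset.univ A v j
    rw [hcv, mulConst_zero] at h1
    refine Subtype.ext ?_
    rw [AddSubmonoidClass.coe_finsetSum]
    simp only [SetLike.val_smul, MvPolynomial.smul_eq_C_mul]
    simp only [hvw] at h1
    exact h1.symm
  -- a functional vanishing on all `w i` vanishes on the image of `T p`, which is everything
  have hρli : LinearIndependent ℂ ρ := by
    rw [Fintype.linearIndependent_iff]
    intro a ha
    have h1 : ∀ i, ∑ j, a j * w i j = 0 := fun i => by
      have := congrFun ha i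
      simpa [Finset.sum_apply] using this
    let φ : (Fin k → ℂ) →ₗ[ℂ] ℂ := Fintype.linearCombination ℂ a
    have hφw : ∀ i, φ (w i) = 0 := fun i => by
      simp only [φ, Fintype.linearCombination_apply, smul_eq_mul]
      rw [← h1 i]
      exact Finset.sum_congr rfl fun j _ => mul_comm _ _
    let p : Fin (n + 1) → ℂ := fun _ => 1
    have hp : p ≠ 0 := fun h => one_ne_zero (congrFun h 0)
    have h2 : φ.comp (T p) = 0 := by
      refine LinearMap.ext_on (top_le_iff.1 hspan) ?_
      rintro _ ⟨i, rfl⟩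
      change φ (T p (v i.castSucc)) = 0
      rw [hTv, _root_.map_smul, hφw, smul_zero]
    intro j
    obtain ⟨u, hu⟩ := hT p hp (Pi.single j 1)
    have h3 := congr($h2 u)
    rw [LinearMap.comp_apply, hu] at h3
    simpa [φ, Fintype.linearCombination_apply_single] using h3
  obtain ⟨Plog⟩ := nonempty_presentation_logForms hH hH' hNC hcard' hρ
    fun c hc => mem_span_relations rfl hNC hcard' hH' hρ hρli hc
  have hPA : (Matrix.of fun j i => mulConst A (Basis.mk hli hspan i) j) = logMatrix H ρ := by
    ext1 j i
    rw [Matrix.of_apply, Basis.mk_apply, hvw]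
    rfl
  obtain ⟨f⟩ := (hPA ▸ P.changeBasis (Basis.mk hli hspan)).nonempty_iso Plog
  exact ⟨hNC, nonempty_iso_of_dual hS.hasLocalBases (hasLocalBases_logForms hNC hcard') f⟩

/-- A logarithmic Steiner bundle has the members of the arrangement as unstable hyperplanes. Their
number is `n + k' + 1` with `k'` the number of relations, and `k ≤ k'` by comparison of the two
presentations of the dual. -/
theorem card_le_encard_of_isLogarithmic (hn : 1 ≤ n) (hk : 1 ≤ k)
    (hA : ∀ j i, A j i ∈ grading n 1) (hB : Nondegenerate A) (P : Presentation (dual S) A)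
    (hS : IsLogarithmic S) : ((n + k + 1 : ℕ) : ℕ∞) ≤ (unstableHyperplanes S).encard := by
  obtain ⟨𝓗, h𝓗, ⟨f⟩⟩ := hS
  have hlt := card_gt_of_presentation hn hk rfl hA hB (P.ofIso (dualIso f)) h𝓗
  obtain ⟨k', hk'⟩ := Nat.exists_eq_add_of_le (Nat.succ_le_of_lt hlt)
  have hcard : 𝓗.card = n + k' + 1 := by omega
  have hcard' : n + 1 ≤ 𝓗.card := by omega
  let e : 𝓗 ≃ Fin (n + k' + 1) := 𝓗.equivFinOfCardEq hcard
  let H : Fin (n + k' + 1) → Hyperplane n := fun i => (e.symm i).1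
  have hH : ∀ i, H i ∈ 𝓗 := fun i => (e.symm i).2
  have hH' : ∀ K ∈ 𝓗, ∃ i, H i = K := fun K hK => ⟨e ⟨K, hK⟩, by simp [H]⟩
  have hinj : Function.Injective H := Subtype.val_injective.comp e.symm.injective
  obtain ⟨ρ, hρ, hρli⟩ := exists_relations (k := k') rfl h𝓗 hcard' hH'
  obtain ⟨Plog⟩ := nonempty_presentation_logForms hH hH' h𝓗 hcard' hρ
    fun c hc => mem_span_relations rfl h𝓗 hcard' hH' hρ hρli hc
  let P' := Plog.ofIso (dualIso f).symm
  have hkk' : k ≤ k' := P.le_of_nondegenerate hn P' hA (logMatrix_mem H ρ) hB rfl rfl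
  have hBlog := nondegenerate_logMatrix (hk.trans hkk') h𝓗 hcard' hH hH' hinj hρ hρli
  have hsub : (𝓗 : Set (Hyperplane n)) ⊆ unstableHyperplanes S := by
    intro K hK
    obtain ⟨i, rfl⟩ := hH' K hK
    exact nontrivial_of_logMatrix hn (by omega) hρ hBlog P' i
  refine le_trans ?_ (Set.encard_le_encard hsub)
  rw [Set.encard_coe_eq_coe_finsetCard, hcard]
  exact_mod_cast (by omega : n + k + 1 ≤ n + k' + 1)

/-- The coordinate hyperplanes together with the zeros of the sum of the coordinates have normal
crossing. -/
theorem exists_normalCrossing (n : ℕ) (hn : 1 ≤ n) :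
    ∃ 𝓗 : Finset (Hyperplane n), NormalCrossing 𝓗 ∧ 𝓗.card = n + 1 + 1 := by
  classical
  let f : Fin (n + 1 + 1) → grading n 1 := Fin.snoc (fun i => coordForm i) (∑ i, coordForm i)
  have hf1 : ∀ (i : Fin (n + 1)) p, evalLinear n (f i.castSucc) p = p i := fun i p => by
    simp [f, evalLinear_apply, coordForm]
  have hf2 : ∀ p, evalLinear n (f (Fin.last _)) p = ∑ i, p i := fun p => by
    simp [f, evalLinear_apply, coordForm]
  have hf0 : ∀ i, f i ≠ 0 := by
    intro i h
    have h1 : ∀ p, evalLinear n (f i) p = 0 := fun p => by rw [h, map_zero]; rfl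
    induction i using Fin.lastCases with
    | last => simpa [hf2] using h1 (Pi.single 0 1)
    | cast i => simpa [hf1] using h1 (Pi.single i 1)
  let H : Fin (n + 1 + 1) → Hyperplane n := fun i => Projectivization.mk ℂ (f i) (hf0 i)
  have hHf : ∀ i p, evalLinear n (H i).rep p = 0 ↔ evalLinear n (f i) p = 0 := by
    intro i p
    obtain ⟨a, ha⟩ := Projectivization.exists_smul_eq_mk_rep ℂ (f i) (hf0 i)
    have h1 : (H i).rep = a • f i := ha.symm
    rw [h1, Units.smul_def, _root_.map_smul, LinearMap.smul_apply, smul_eq_zero]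
    simp
  have hz : ∀ p : Fin (n + 1) → ℂ, p ≠ 0 → ∀ s : Finset (Fin (n + 1 + 1)),
      (∀ i ∈ s, evalLinear n (H i).rep p = 0) → s.card < finrank ℂ (Fin (n + 1) → ℂ) := by
    intro p hp s hs
    rw [finrank_fin_fun]
    by_contra! hlt
    -- at most one of the forms is missing from `s`
    have hc : sᶜ.card ≤ 1 := by
      rw [Finset.card_compl, Fintype.card_fin]
      omega
    have hs' : ∀ i ∈ s, evalLinear n (f i) p = 0 := fun i hi => (hHf i p).1 (hs i hi)
    refine hp (funext fun j => ?_)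
    by_contra hj
    have hjs : j.castSucc ∈ sᶜ := Finset.mem_compl.2 fun h =>
      hj ((hf1 j p).symm.trans (hs' _ h))
    have hall : ∀ i, i ≠ j.castSucc → i ∈ s := fun i hi => by
      by_contra h
      exact hi (Finset.card_le_one.1 hc _ (Finset.mem_compl.2 h) _ hjs)
    have h1 := hs' _ (hall (Fin.last _) (Fin.castSucc_lt_last j).ne')
    rw [hf2, Finset.sum_eq_single j (fun i _ hi => (hf1 i p).symm.trans
      (hs' _ (hall _ ((Fin.castSucc_injective _).ne hi)))) (by simp)] at h1
    exact hj h1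
  have hli := linearIndepOn_of_card_zeros_lt (l := fun i => evalLinear n (H i).rep)
      (by simp only [finrank_fin_fun, Fintype.card_fin]; omega) hz
  have hinj : Function.Injective H := by
    intro i j hij
    by_contra hne
    have h1 := hli {i, j} (by rw [Finset.card_pair hne, finrank_fin_fun]; omega)
    have h2 := h1.injective (a₁ := ⟨i, by simp⟩) (a₂ := ⟨j, by simp⟩) (by simp [hij])
    exact hne (congrArg Subtype.val h2)
  refine ⟨Finset.univ.image H, ?_, ?_⟩
  · refine normalCrossing_of_linearIndepOn (H := H) (fun K hK => by simpa using hK) fun p hp => ?_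
    have h1 := hli (Finset.univ.filter fun i => evalLinear n (H i).rep p = 0)
      (hz p hp _ fun i hi => (Finset.mem_filter.1 hi).2).le
    simpa using h1
  · rw [Finset.card_image_of_injective _ hinj, Finset.card_univ, Fintype.card_fin]

/-- For `k = 1`, the entries of the matrix are a basis of the linear forms, so all hyperplanes are
unstable. -/
theorem unstableHyperplanes_eq_univ (hn : 1 ≤ n) {A : Matrix (Fin 1) (Fin (n + 1)) (Pol n)}
    (hA : ∀ j i, A j i ∈ grading n 1) (hB : Nondegenerate A) (P : Presentation (dual S) A) :
    unstableHyperplanes S = Set.univ := by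
  refine Set.eq_univ_of_forall fun H => ?_
  let f : Fin (n + 1) → grading n 1 := fun i => ⟨A 0 i, hA 0 i⟩
  have hli : LinearIndependent ℂ f := by
    rw [Fintype.linearIndependent_iff]
    intro c hc
    refine congrFun (eq_zero_of_forall_pencil A hA le_rfl rfl hB (v := c)
      fun p => funext fun j => ?_)
    have h1 := congrArg (fun g => evalLinear n g p) hc
    obtain rfl : j = 0 := Subsingleton.elim _ _
    simp only [map_sum, LinearMap.sum_apply, _root_.map_smul, LinearMap.smul_apply, map_zero,
      smul_eq_mul] at h1
    rw [pencil_apply]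
    exact Eq.trans (Finset.sum_congr rfl fun i _ =>
      mul_comm (MvPolynomial.eval p (A 0 i)) (c i)) h1
  have hspan := hli.span_eq_top_of_card_eq_finrank' (by rw [finrank_grading_one, Fintype.card_fin])
  obtain ⟨c, hc⟩ := (Submodule.mem_span_range_iff_exists_fun ℂ).1
    (hspan ▸ Submodule.mem_top : H.rep ∈ Submodule.span ℂ (Set.range f))
  refine P.nontrivial_of_mulConst H hn hA hB (c := c) (w := fun _ => 1) ?_ fun j => ?_
  · rintro rfl
    exact H.rep_nonzero (by rw [← hc]; simp)
  · obtain rfl : j = 0 := Subsingleton.elim _ _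
    have h1 := congrArg (fun g : grading n 1 => g.1) hc
    simp only [AddSubmonoidClass.coe_finsetSum, SetLike.val_smul, MvPolynomial.smul_eq_C_mul] at h1
    rw [map_one, one_mul]
    exact Eq.trans (Finset.sum_congr rfl fun i _ =>
      mul_comm (A 0 i) (MvPolynomial.C (c i))) h1

end Steiner
end SteinerLog
end

theorem corollary5p11 (n k : ℕ) (hn : 1 ≤ n) (hk : 1 ≤ k)
    (S : (SteinerLog.PSpace n).Modules) (hS : SteinerLog.IsSteiner k S) :
    (SteinerLog.IsLogarithmic S ↔
      ((n + k + 1 : ℕ) : ℕ∞) ≤ (SteinerLog.unstableHyperplanes S).encard) ∧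
    ∀ 𝓗 : Finset (SteinerLog.Hyperplane n),
      (𝓗 : Set (SteinerLog.Hyperplane n)) ⊆ SteinerLog.unstableHyperplanes S →
      𝓗.card = n + k + 1 →
      (2 ≤ k ∨ SteinerLog.NormalCrossing 𝓗) →
      SteinerLog.NormalCrossing 𝓗 ∧ Nonempty (S ≅ SteinerLog.logForms 𝓗) := by
  obtain ⟨A, hA, hB, ⟨P⟩⟩ := hS.exists_presentation hn
  have key : ∀ 𝓗 : Finset (SteinerLog.Hyperplane n),
      (𝓗 : Set (SteinerLog.Hyperplane n)) ⊆ SteinerLog.unstableHyperplanes S →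
      𝓗.card = n + k + 1 → (2 ≤ k ∨ SteinerLog.NormalCrossing 𝓗) →
      SteinerLog.NormalCrossing 𝓗 ∧ Nonempty (S ≅ SteinerLog.logForms 𝓗) :=
    fun 𝓗 h𝓗 hcard h => SteinerLog.normalCrossing_and_nonempty_iso hn hk hS.isVectorBundle hA hB P
      h𝓗 hcard h
  refine ⟨⟨SteinerLog.card_le_encard_of_isLogarithmic hn hk hA hB P, fun h => ?_⟩, key⟩
  rcases hk.lt_or_eq with hk2 | rfl
  · obtain ⟨t, ht, htc⟩ := Set.exists_subset_encard_eq h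
    have hfin : t.Finite := Set.finite_of_encard_eq_coe htc
    obtain ⟨hNC, f⟩ := key hfin.toFinset (by simpa using ht) (by
      rw [hfin.encard_eq_coe_toFinset_card] at htc
      exact_mod_cast htc) (Or.inl hk2)
    exact ⟨_, hNC, f⟩
  · obtain ⟨𝓗, hNC, hcard⟩ := SteinerLog.exists_normalCrossing n hn
    exact ⟨𝓗, key 𝓗 (by
      rw [SteinerLog.unstableHyperplanes_eq_univ hn hA hB P]
      exact Set.subset_univ _) hcard (Or.inr hNC)⟩
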